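/- **Definitions.** A real Lie superalgebra is a real vector space $V=V_0\dotplus V_1$ with a graded bilinear bracket satisfying, for homogeneous $x,y,z$, $[x,y]=-(-1)^{|x||y|}[y,x]$ and $(-1)^{|x||z|}[x,[y,z]]+(-1)^{|y||x|}[y,[z,x]]+(-1)^{|z||y|}[z,[x,y]]=0$; its superdimension is $(\dim V_0,\dim V_1)$. Let $\mathcal D$ be a real Lie superalgebra with a nondegenerate bilinear form that is supersymmetric, $\langle x,y\rangle=(-1)^{|x||y|}\langle y,x\rangle$, and super ad-invariant, $\langle[x,y],z\rangle+(-1)^{|x||y|}\langle y,[x,z]\rangle=0$. A Manin supertriple $(\mathcal D,\mathcal S,\tilde{\mathcal S})$, written $(\mathcal S|\tilde{\mathcal S})$, is a decomposition $\mathcal D=\mathcal S\dotplus\tilde{\mathcal S}$ into maximal isotropic (graded) subalgebras that is boson-fermion orthogonal: $\langle\mathcal S_0,\tilde{\mathcal S}_1\rangle=\langle\mathcal S_1,\tilde{\mathcal S}_0\rangle=0$. If one exists, $\mathcal D$ is a Drinfel'd superdouble. Its T-dual is $(\tilde{\mathcal S}|\mathcal S)$. An isomorphism of superdoubles is a linear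 bijection preserving the grading, bracket and form; an isomorphism of Manin supertriples moreover maps $\mathcal S$ to $\mathcal S'$ and $\tilde{\mathcal S}$ to $\tilde{\mathcal S}'$. The commutants are $\mathcal C_1=[\mathcal D,\mathcal D]$, $\mathcal C_{n+1}=[\mathcal C_n,\mathcal C_n]$. **List of supertriples.** In superdimension $(4,2)$ use bases $b_1,b_2,f$ of $\mathcal S$ and $\tilde b^1,\tilde b^2,\tilde f$ of $\tilde{\mathcal S}$, with $b_i,\tilde b^i$ even, $f,\tilde f$ odd, $\langle b_i,\tilde b^j\rangle=\langle\tilde b^j,b_i\rangle=\delta_i^j$, $\langle f,\tilde f\rangle=-\langle\tilde f,f\rangle=1$ and all other pairings zero. Brackets between $\mathcal S$ and $\tilde{\mathcal S}$ are determined by ad-invariance. For $\mathcal S$ (nonzero brackets): $A$: none; $N$: $[f,f]=b_1$; $S$: $[b_1,f]=f$; $C_p$ ($p\in\mathbb R$): $[b_1,b_2]=b_2$, $[b_1,f]=pf$; $F$: $[b_1,b_2]=b_2$, $[b_1,f]=\frac12f$, $[f,f]=b_2$. With $\epsilon=\pm1$, the 14 families are 1. $(A|A)$: $\tilde{\mathcal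 S}$ abelian; 2. $(N|A)$: $\tilde{\mathcal S}$ abelian; 3. $(S|A)$: $\tilde{\mathcal S}$ abelian; 4. $(S|N^\epsilon)$: $[\tilde f,\tilde f]=\epsilon\tilde b^1$; 5. $(S|S)$: $[\tilde b^2,\tilde f]=\tilde f$; 6. $(C_p|A)$: $\tilde{\mathcal S}$ abelian; 7. $(C_p|N^\epsilon)$: $[\tilde f,\tilde f]=\epsilon\tilde b^1$; 8. $(C_p|C_{-p})$: $[\tilde b^1,\tilde b^2]=\tilde b^1$, $[\tilde b^2,\tilde f]=p\tilde f$; 9. $(C_{1/2}|\tilde N)$: $[\tilde f,\tilde f]=\tilde b^2$; 10. $(C_0|C_{0},\kappa)$, $\kappa\neq0$: $[\tilde b^1,\tilde b^2]=\kappa\tilde b^2$; 11. $(F|A)$: $\tilde{\mathcal S}$ abelian; 12. $(F|C^{\epsilon}_{-1/2})$: $[\tilde b^1,\tilde b^2]=\epsilon\tilde b^1$, $[\tilde b^2,\tilde f]=\frac12\epsilon\tilde f$; 13. $(F|F.i,\epsilon)$: $[\tilde b^1,\tilde b^2]=\epsilon\tilde b^1$, $[\tilde b^2,\tilde f]=-\frac12\epsilon\tilde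 f$, $[\tilde f,\tilde f]=\epsilon\tilde b^1$; 14. $(F|F.ii,\kappa)$, $\kappa\neq0$: $[\tilde b^1,\tilde b^2]=\kappa\tilde b^2$, $[\tilde b^1,\tilde f]=\frac12\kappa\tilde f$, $[\tilde f,\tilde f]=\kappa\tilde b^2$. **Classes.** A superdouble of superdimension $(4,2)$ belongs to one of the following classes if it has a decomposition isomorphic to one of the supertriples listed there; the dimensions of $\mathcal C_1,\mathcal C_2,\mathcal C_3$ and the superdimension of $\mathcal C_1$ are given in brackets. - $I$: $(A|A)$ [$0,0,0$; $(0,0)$]. - $II$: $(N|A)$ [$2,0,0$; $(1,1)$]. - $III$: $(S|A)$, $(S|N^{\pm1})$, $(S|S)$ [$3,1,0$; $(1,2)$]. - $IV_0$: $(C_0|A)$, and $(C_p|C_{-p})$ with $p=0$ [$3,1,0$; $(3,0)$]. - $IV_\kappa$ ($\kappa\ne0$): $(C_0|C_{0},\kappa)$ [$3,3,3$; $(3,0)$]. - $V$: $(C_0|N^{\pm1})$ [$4,1,0$; $(3,1)$]. - $VI_p$ ($p>0$): $(C_{p}|A)$, $(C_{-p}|A)$, $(C_{p}|N^{\pm1})$,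 $(C_{-p}|N^{\pm1})$, $(C_p|C_{-p})$ [$5,1,0$; $(3,2)$]. - $VII$: $(F|A)$, $(C_{1/2}|\tilde N)$, $(F|F.i,\pm1)$, $(F|C^{\pm1}_{-1/2})$ [$5,3,0$; $(3,2)$]. - $VIII_\kappa$ ($\kappa\ne0$): $(F|F.ii,\kappa)$ [$5,5,5$; $(3,2)$]. **Theorem.** (a) Every real Drinfel'd superdouble of superdimension $(4,2)$ belongs to exactly one of these classes (the parameters $\kappa$, $p$ being part of the class). It has decompositions isomorphic to every supertriple listed in its class and to the duals of these; each of its decompositions into a Manin supertriple is isomorphic to a listed one of its class or to the dual of one; and its commutants have the dimensions and the superdimension stated for the class. (b) Every class is nonempty, and two superdoubles in these classes are isomorphic if and only if their classes (with parameters) are equal. (c) Two supertriples from the list 1–14 are isomorphic only if they are in the same family with the same parameters. If the dual of a supertriple from the list is isomorphic to a supertriple from the list, then the two are in the same family and have the same parameters, except that in family 8 the parameter $p$ changes to $-p$ and in family 13 the parameter $\epsilon$ changes to $-\epsilon$. -/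

import Mathlib

/-- The sign `(-1)^{|x||y|}` for homogeneous elements of parities `i` and `j`. -/
def koszulSign (i j : ZMod 2) : ℝ := (-1) ^ (i.val * j.val)

/-- A real Lie superalgebra structure on the real vector space `V`: a `ℤ/2`-grading
`V = part 0 ∔ part 1` and a graded bilinear bracket that is super skew-symmetric and
satisfies the super Jacobi identity on homogeneous elements. -/
structure LieSuperalgebra (V : Type*) [AddCommGroup V] [Module ℝ V] where
  part : ZMod 2 → Submodule ℝ V
  isCompl : IsCompl (part 0) (part 1)
  bracket : V →ₗ[ℝ] V →ₗ[ℝ] V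
  bracket_mem : ∀ i j : ZMod 2, ∀ x ∈ part i, ∀ y ∈ part j, bracket x y ∈ part (i + j)
  skew : ∀ i j : ZMod 2, ∀ x ∈ part i, ∀ y ∈ part j,
    bracket x y = -(koszulSign i j • bracket y x)
  jacobi : ∀ i j k : ZMod 2, ∀ x ∈ part i, ∀ y ∈ part j, ∀ z ∈ part k,
    koszulSign i k • bracket x (bracket y z) + koszulSign j i • bracket y (bracket z x)
      + koszulSign k j • bracket z (bracket x y) = 0

/-- A real Lie superalgebra with a nondegenerate, supersymmetric and super ad-invariant
bilinear form. -/
structure MetricLieSuperalgebra (V : Type*) [AddCommGroup V] [Module ℝ V] extends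
    LieSuperalgebra V where
  form : LinearMap.BilinForm ℝ V
  nondegenerate : form.Nondegenerate
  supersymmetric : ∀ i j : ZMod 2, ∀ x ∈ part i, ∀ y ∈ part j,
    form x y = koszulSign i j * form y x
  invariant : ∀ i j k : ZMod 2, ∀ x ∈ part i, ∀ y ∈ part j, ∀ z ∈ part k,
    form (bracket x y) z + koszulSign i j * form y (bracket x z) = 0

/-- Coefficients of the brackets of a Lie superalgebra of superdimension `(2,1)` in a homogeneous
basis `b 0, b 1` (even), `f` (odd):
`[b 0, b 1] = ∑ i, bb i • b i`, `[b i, f] = bf i • f`, `[f, f] = ∑ i, ff i • b i`. -/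
structure Brackets21 where
  bb : Fin 2 → ℝ
  bf : Fin 2 → ℝ
  ff : Fin 2 → ℝ

namespace LieSuperalgebra

variable {V : Type*} [AddCommGroup V] [Module ℝ V]

/-- The superdimension is `(m, n)`. -/
def HasSuperdim (L : LieSuperalgebra V) (m n : ℕ) : Prop :=
  Module.Finite ℝ V ∧ Module.finrank ℝ (L.part 0) = m ∧ Module.finrank ℝ (L.part 1) = n

/-- `S` is a sub-superalgebra: a graded subspace closed under the bracket. -/
def IsSubalgebra (L : LieSuperalgebra V) (S : Submodule ℝ V) : Prop :=
  S = (S ⊓ L.part 0) ⊔ (S ⊓ L.part 1) ∧ ∀ x ∈ S, ∀ y ∈ S, L.bracket x y ∈ S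

/-- The iterated commutants: `C₀ = V`, `Cₙ₊₁ = [Cₙ, Cₙ]` (linear span of the brackets). -/
def commutant (L : LieSuperalgebra V) : ℕ → Submodule ℝ V
  | 0 => ⊤
  | n + 1 => Submodule.span ℝ
      {z | ∃ x ∈ L.commutant n, ∃ y ∈ L.commutant n, L.bracket x y = z}

/-- The vectors `b 0, b 1, f` have the brackets with coefficients `c`. -/
def HasBrackets (L : LieSuperalgebra V) (b : Fin 2 → V) (f : V) (c : Brackets21) : Prop :=
  L.bracket (b 0) (b 1) = ∑ i, c.bb i • b i ∧
  (∀ i, L.bracket (b i) f = c.bf i • f) ∧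
  L.bracket f f = ∑ i, c.ff i • b i

end LieSuperalgebra

namespace Brackets21

/-- `A₂₁`: the abelian superalgebra. -/
def A : Brackets21 := ⟨![0, 0], ![0, 0], ![0, 0]⟩
/-- `N₂₁`: `[f, f] = b₁`. -/
def N : Brackets21 := ⟨![0, 0], ![0, 0], ![1, 0]⟩
/-- `S₂₁`: `[b₁, f] = f`. -/
def S : Brackets21 := ⟨![0, 0], ![1, 0], ![0, 0]⟩
/-- `C¹_p`: `[b₁, b₂] = b₂`, `[b₁, f] = p f`. -/
def C (p : ℝ) : Brackets21 := ⟨![0, 1], ![p, 0], ![0, 0]⟩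
/-- `F`: `[b₁, b₂] = b₂`, `[b₁, f] = f/2`, `[f, f] = b₂`. -/
noncomputable def F : Brackets21 := ⟨![0, 1], ![1 / 2, 0], ![0, 1]⟩

end Brackets21

/-- The list of Manin supertriples `(𝒮|𝒮̃)` of superdimension `(4,2)`.
The signs `ε = ±1` are the units of `ℤ`. -/
inductive TripleType
  /-- `(A₂₁|A₂₁)` -/
  | A_A
  /-- `(N₂₁|A₂₁)` -/
  | N_A
  /-- `(S₂₁|A₂₁)` -/
  | S_A
  /-- `(S₂₁|N₂₁^ε)` -/
  | S_N (ε : ℤˣ)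
  /-- `(S₂₁|S₂₁)` -/
  | S_S
  /-- `(C¹_p|A₂₁)` -/
  | C_A (p : ℝ)
  /-- `(C¹_p|N₂₁^ε)` -/
  | C_N (p : ℝ) (ε : ℤˣ)
  /-- `(C¹_p|C¹_{-p})` -/
  | C_C (p : ℝ)
  /-- `(C¹_{1/2}|Ñ₂₁)` -/
  | Chalf_N
  /-- `(C¹_0|C¹_0,κ)`, `κ ≠ 0` -/
  | C0_C0 (κ : ℝ) (hκ : κ ≠ 0)
  /-- `(F|A₂₁)` -/
  | F_A
  /-- `(F|C^{1,ε}_{-1/2})` -/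
  | F_C (ε : ℤˣ)
  /-- `(F|F.i,ε)` -/
  | F_Fi (ε : ℤˣ)
  /-- `(F|F.ii,κ)`, `κ ≠ 0` -/
  | F_Fii (κ : ℝ) (hκ : κ ≠ 0)

namespace TripleType

/-- The brackets of `𝒮` in the basis `b₁, b₂, f`. -/
noncomputable def left : TripleType → Brackets21
  | A_A => .A
  | N_A => .N
  | S_A => .S
  | S_N _ => .S
  | S_S => .S
  | C_A p => .C p
  | C_N p _ => .C p
  | C_C p => .C p
  | Chalf_N => .C (1 / 2)
  | C0_C0 _ _ => .C 0
  | F_A => .F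
  | F_C _ => .F
  | F_Fi _ => .F
  | F_Fii _ _ => .F

/-- The brackets of `𝒮̃` in the dual basis `b̃¹, b̃², f̃`. -/
noncomputable def right : TripleType → Brackets21
  | A_A => .A
  | N_A => .A
  | S_A => .A
  | S_N ε => ⟨![0, 0], ![0, 0], ![((ε : ℤ) : ℝ), 0]⟩
  | S_S => ⟨![0, 0], ![0, 1], ![0, 0]⟩
  | C_A _ => .A
  | C_N _ ε => ⟨![0, 0], ![0, 0], ![((ε : ℤ) : ℝ), 0]⟩
  | C_C p => ⟨![1, 0], ![0, p], ![0, 0]⟩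
  | Chalf_N => ⟨![0, 0], ![0, 0], ![0, 1]⟩
  | C0_C0 κ _ => ⟨![0, κ], ![0, 0], ![0, 0]⟩
  | F_A => .A
  | F_C ε => ⟨![((ε : ℤ) : ℝ), 0], ![0, ((ε : ℤ) : ℝ) / 2], ![0, 0]⟩
  | F_Fi ε => ⟨![((ε : ℤ) : ℝ), 0], ![0, -((ε : ℤ) : ℝ) / 2], ![((ε : ℤ) : ℝ), 0]⟩
  | F_Fii κ _ => ⟨![0, κ], ![κ / 2, 0], ![0, κ]⟩

/-- The change of parameter `p ↦ -p` in `(C¹_p|C¹_{-p})` and `ε ↦ -ε` in `(F|F.i,ε)`;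
all other supertriples stay the same. -/
noncomputable def flip : TripleType → TripleType
  | C_C p => C_C (-p)
  | F_Fi ε => F_Fi (-ε)
  | t => t

end TripleType

/-- The classes of Drinfel'd superdoubles of superdimension `(4,2)`. -/
inductive DoubleClass
  | I
  | II
  | III
  | IV0
  | IV (κ : ℝ) (hκ : κ ≠ 0)
  | V
  | VI (p : ℝ) (hp : 0 < p)
  | VII
  | VIII (κ : ℝ) (hκ : κ ≠ 0)

namespace DoubleClass

open TripleType in
/-- The Manin supertriples listed in a class. -/
def triples : DoubleClass → Set TripleType
  | I => {A_A}
  | II => {N_A}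
  | III => {S_A, S_N 1, S_N (-1), S_S}
  | IV0 => {C_A 0, C_C 0}
  | IV κ hκ => {C0_C0 κ hκ}
  | V => {C_N 0 1, C_N 0 (-1)}
  | VI p _ => {C_A p, C_A (-p), C_N p 1, C_N p (-1), C_N (-p) 1, C_N (-p) (-1), C_C p}
  | VII => {F_A, Chalf_N, F_Fi 1, F_Fi (-1), F_C 1, F_C (-1)}
  | VIII κ hκ => {F_Fii κ hκ}

/-- The dimensions of the first three iterated commutants. -/
def commutantDims : DoubleClass → ℕ × ℕ × ℕ
  | I => (0, 0, 0)
  | II => (2, 0, 0)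
  | III => (3, 1, 0)
  | IV0 => (3, 1, 0)
  | IV _ _ => (3, 3, 3)
  | V => (4, 1, 0)
  | VI _ _ => (5, 1, 0)
  | VII => (5, 3, 0)
  | VIII _ _ => (5, 5, 5)

/-- The superdimension of the first commutant. -/
def commutantSuperdim : DoubleClass → ℕ × ℕ
  | I => (0, 0)
  | II => (1, 1)
  | III => (1, 2)
  | IV0 => (3, 0)
  | IV _ _ => (3, 0)
  | V => (3, 1)
  | VI _ _ => (3, 2)
  | VII => (3, 2)
  | VIII _ _ => (3, 2)

end DoubleClass

namespace MetricLieSuperalgebra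

variable {V : Type*} [AddCommGroup V] [Module ℝ V]
variable {V' : Type*} [AddCommGroup V'] [Module ℝ V']

/-- `S` is a maximal isotropic subspace. -/
def IsMaximalIsotropic (D : MetricLieSuperalgebra V) (S : Submodule ℝ V) : Prop :=
  Maximal (fun W : Submodule ℝ V => ∀ x ∈ W, ∀ y ∈ W, D.form x y = 0) S

/-- `(D, S, St)` is a boson-fermion orthogonal Manin supertriple: `D = S ∔ St` with maximal
isotropic sub-superalgebras `S`, `St`, and `⟨S₀, St₁⟩ = ⟨S₁, St₀⟩ = 0`. Its T-dual is
`(D, St, S)`. -/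
structure IsManinSupertriple (D : MetricLieSuperalgebra V) (S St : Submodule ℝ V) : Prop where
  isCompl : IsCompl S St
  left_subalgebra : D.IsSubalgebra S
  right_subalgebra : D.IsSubalgebra St
  left_isotropic : D.IsMaximalIsotropic S
  right_isotropic : D.IsMaximalIsotropic St
  even_odd : ∀ x ∈ S ⊓ D.part 0, ∀ y ∈ St ⊓ D.part 1, D.form x y = 0
  odd_even : ∀ x ∈ S ⊓ D.part 1, ∀ y ∈ St ⊓ D.part 0, D.form x y = 0

/-- `D` is a (boson-fermion orthogonal) Drinfel'd superdouble. -/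
def IsDrinfeldSuperdouble (D : MetricLieSuperalgebra V) : Prop :=
  ∃ S St : Submodule ℝ V, D.IsManinSupertriple S St

/-- `P` is an isomorphism of the superdoubles: it preserves the grading, the bracket and the
bilinear form. -/
structure IsIso (D : MetricLieSuperalgebra V) (D' : MetricLieSuperalgebra V')
    (P : V ≃ₗ[ℝ] V') : Prop where
  map_part : ∀ i x, x ∈ D.part i → P x ∈ D'.part i
  map_bracket : ∀ x y, P (D.bracket x y) = D'.bracket (P x) (P y)
  map_form : ∀ x y, D.form x y = D'.form (P x) (P y)

/-- The superdoubles `D` and `D'` are isomorphic. -/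
def Isomorphic (D : MetricLieSuperalgebra V) (D' : MetricLieSuperalgebra V') : Prop :=
  ∃ P : V ≃ₗ[ℝ] V', D.IsIso D' P

/-- The Manin supertriples `(D, S, St)` and `(D', S', St')` are isomorphic. -/
def TripleIsomorphic (D : MetricLieSuperalgebra V) (S St : Submodule ℝ V)
    (D' : MetricLieSuperalgebra V') (S' St' : Submodule ℝ V') : Prop :=
  ∃ P : V ≃ₗ[ℝ] V', D.IsIso D' P ∧
    S.map (P : V →ₗ[ℝ] V') = S' ∧ St.map (P : V →ₗ[ℝ] V') = St'

/-- `b₁, b₂, f, b̃¹, b̃², f̃` is a dual homogeneous basis of the pair `S`, `St`, where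
`b₁, b₂, f` spans `S` and `b̃¹, b̃², f̃` spans `St`. (Linear independence follows from
the pairings.) -/
structure IsDualBasis (D : MetricLieSuperalgebra V) (S St : Submodule ℝ V)
    (b : Fin 2 → V) (f : V) (bt : Fin 2 → V) (ft : V) : Prop where
  b_mem : ∀ i, b i ∈ D.part 0
  f_mem : f ∈ D.part 1
  bt_mem : ∀ i, bt i ∈ D.part 0
  ft_mem : ft ∈ D.part 1
  span_left : Submodule.span ℝ {b 0, b 1, f} = S
  span_right : Submodule.span ℝ {bt 0, bt 1, ft} = St
  b_bt : ∀ i j, D.form (b i) (bt j) = if i = j then 1 else 0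
  bt_b : ∀ i j, D.form (bt j) (b i) = if i = j then 1 else 0
  f_ft : D.form f ft = 1
  ft_f : D.form ft f = -1
  b_ft : ∀ i, D.form (b i) ft = 0
  ft_b : ∀ i, D.form ft (b i) = 0
  f_bt : ∀ j, D.form f (bt j) = 0
  bt_f : ∀ j, D.form (bt j) f = 0

/-- `(D, S, St)` is a Manin supertriple which in some dual homogeneous basis is the listed
supertriple `t`. The brackets between `S` and `St` are determined by ad-invariance. -/
def IsOfType (D : MetricLieSuperalgebra V) (t : TripleType) (S St : Submodule ℝ V) : Prop :=
  D.IsManinSupertriple S St ∧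
  ∃ (b : Fin 2 → V) (f : V) (bt : Fin 2 → V) (ft : V), D.IsDualBasis S St b f bt ft ∧
    D.HasBrackets b f t.left ∧ D.HasBrackets bt ft t.right

/-- `(D, S, St)` is a Manin supertriple whose T-dual `(D, St, S)` is the listed supertriple `t`. -/
def IsDualOfType (D : MetricLieSuperalgebra V) (t : TripleType) (S St : Submodule ℝ V) : Prop :=
  D.IsManinSupertriple S St ∧ D.IsOfType t St S

/-- `D` belongs to the class `c`: it has a decomposition into a Manin supertriple listed
in `c`. -/
def BelongsTo (D : MetricLieSuperalgebra V) (c : DoubleClass) : Prop :=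
  ∃ t ∈ c.triples, ∃ S St : Submodule ℝ V, D.IsOfType t S St

end MetricLieSuperalgebra

/-! A decomposition is encoded by a `Frame`: six homogeneous vectors with a fixed Gram matrix, and
the structure constants `k`, `l` of the two halves. Isotropy, boson-fermion orthogonality and
nondegeneracy put the two halves in duality parity by parity, so both have superdimension (2,1) and
a frame exists (`IsManinSupertriple.exists_frame`). Invariance of the form then determines the mixed
brackets (`Frame.bracket_eq`). Hence doubles with frames of equal coefficients are isomorphic
(`Frame.exists_isIso`), and two frames of one decomposition differ by GL₂ × GL₁ acting on one half
and contragrediently on the other (`HasFrame.exists_baseChange`). Everything becomes a question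
about a few real numbers.

Normal forms (`HasFrame.classify`). If some half has a nonabelian even part, a basis of it with
[b₁,b₂] = b₂ exists, and Jacobi leaves [b₁,f] = p f and [f,f] = q b₂ with q = 0 or 1. The identities
coupling the halves determine most of the other half, and the remaining shears and rescalings
normalise the rest; where only squares are available for rescaling, a sign ε survives. If both even
parts are abelian, a nonzero action on an odd vector leads to the S families, and otherwise a
nonzero odd square leads to (N|A).

Regrouping into classes (`hasType_rep_iff`). One double has many decompositions: S may be kept while
its complement is replaced by the graph of a suitable skew map to S (the twists), or b₂ and b̃², f
and f̃ may be exchanged (the reflections). These moves connect all supertriples of a class to one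
representative, so a class is a single isomorphism type of doubles.

Separation (`class_unique`). Dimensions and superdimensions of commutants distinguish the classes up
to parameters. In IV and VIII the number κ is recovered from the double commutator on the even part
of C₁ compared with the form; in VI the number p² is recovered from the eigenvalues of ad b₁. Since
every decomposition is listed in some class and the class of the double is unique, no decomposition
falls outside it.

The listed supertriples are told apart by the vanishing of brackets, by pairings between brackets of
the two halves, and by the few base changes preserving the normal forms
(`TripleType.eq_of_baseChange`, `TripleType.eq_flip_of_baseChange`). For existence only the nine
representatives need a model, built on ℝ⁶. -/

namespace LieSuperalgebra

variable {V : Type*} [AddCommGroup V] [Module ℝ V]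

/-! ### Symmetry of the bracket. -/

theorem exists_homogeneous_add (L : LieSuperalgebra V) (x : V) :
    ∃ y ∈ L.part 0, ∃ z ∈ L.part 1, y + z = x :=
  Submodule.mem_sup.1 (L.isCompl.sup_eq_top ▸ Submodule.mem_top)

/-- The Koszul sign is 1 as soon as one argument is even, so the second argument need not be
homogeneous. -/
theorem bracket_even_left (L : LieSuperalgebra V) {x : V} (hx : x ∈ L.part 0) (y : V) :
    L.bracket x y = -L.bracket y x := by
  obtain ⟨a, ha, b, hb, rfl⟩ := L.exists_homogeneous_add y
  have h₁ := L.skew 0 0 x hx a ha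
  have h₂ := L.skew 0 1 x hx b hb
  simp only [koszulSign, ZMod.val_zero, zero_mul, pow_zero, one_smul] at h₁ h₂
  rw [map_add, h₁, h₂, map_add, LinearMap.add_apply]
  abel

theorem bracket_odd_odd (L : LieSuperalgebra V) {x y : V} (hx : x ∈ L.part 1)
    (hy : y ∈ L.part 1) : L.bracket x y = L.bracket y x := by
  simpa [koszulSign, ZMod.val_one] using L.skew 1 1 x hx y hy

end LieSuperalgebra

/-! ### Frames and the bracket table of a double. -/

namespace MetricLieSuperalgebra

variable {V : Type*} [AddCommGroup V] [Module ℝ V]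

/-- Skewness and invariance each contribute a Koszul sign, and the two cancel. This leads to a
sign-free invariance valid for arbitrary vectors. -/
theorem form_bracket_assoc_of_mem (D : MetricLieSuperalgebra V) {i j k : ZMod 2} {x y z : V}
    (hx : x ∈ D.part i) (hy : y ∈ D.part j) (hz : z ∈ D.part k) :
    D.form (D.bracket x y) z = D.form x (D.bracket y z) := by
  have h₁ := D.skew i j x hx y hy
  have h₂ := D.invariant j i k y hy x hx z hz
  have hs : koszulSign i j * koszulSign j i = 1 := by
    simp only [koszulSign, mul_comm j.val, ← mul_pow]; norm_num
  rw [h₁, map_neg, map_smul, LinearMap.neg_apply, LinearMap.smul_apply, smul_eq_mul]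
  linear_combination (-koszulSign i j) * h₂ + D.form x (D.bracket y z) * hs

/-- The bilinear form is associative. -/
theorem form_bracket_assoc (D : MetricLieSuperalgebra V) (x y z : V) :
    D.form (D.bracket x y) z = D.form x (D.bracket y z) := by
  obtain ⟨x₀, hx₀, x₁, hx₁, rfl⟩ := D.exists_homogeneous_add x
  obtain ⟨y₀, hy₀, y₁, hy₁, rfl⟩ := D.exists_homogeneous_add y
  obtain ⟨z₀, hz₀, z₁, hz₁, rfl⟩ := D.exists_homogeneous_add z
  simp only [map_add, LinearMap.add_apply, D.form_bracket_assoc_of_mem hx₀ hy₀ hz₀,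
    D.form_bracket_assoc_of_mem hx₀ hy₀ hz₁, D.form_bracket_assoc_of_mem hx₀ hy₁ hz₀,
    D.form_bracket_assoc_of_mem hx₀ hy₁ hz₁, D.form_bracket_assoc_of_mem hx₁ hy₀ hz₀,
    D.form_bracket_assoc_of_mem hx₁ hy₀ hz₁, D.form_bracket_assoc_of_mem hx₁ hy₁ hz₀,
    D.form_bracket_assoc_of_mem hx₁ hy₁ hz₁]

/-- The parities of a homogeneous frame `b₁, b₂, f, b̃¹, b̃², f̃`. -/
def frameParity : Fin 6 → ZMod 2 := ![0, 0, 1, 0, 0, 1]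

/-- The Gram matrix of a dual homogeneous basis `b₁, b₂, f, b̃¹, b̃², f̃`. -/
def frameGram : Fin 6 → Fin 6 → ℝ :=
  ![![0, 0, 0, 1, 0, 0], ![0, 0, 0, 0, 1, 0], ![0, 0, 0, 0, 0, 1],
    ![1, 0, 0, 0, 0, 0], ![0, 1, 0, 0, 0, 0], ![0, 0, -1, 0, 0, 0]]

/-- The coefficients of the brackets of the double in the frame `b₁, b₂, f, b̃¹, b̃², f̃`. -/
def doubleBracket (k l : Brackets21) : Fin 6 → Fin 6 → Fin 6 → ℝ :=
  ![![![0, 0, 0, 0, 0, 0],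
      ![k.bb 0, k.bb 1, 0, 0, 0, 0],
      ![0, 0, k.bf 0, 0, 0, 0],
      ![0, l.bb 0, 0, 0, -k.bb 0, 0],
      ![-l.bb 0, 0, 0, 0, -k.bb 1, 0],
      ![0, 0, l.ff 0, 0, 0, -k.bf 0]],
    ![![-k.bb 0, -k.bb 1, 0, 0, 0, 0],
      ![0, 0, 0, 0, 0, 0],
      ![0, 0, k.bf 1, 0, 0, 0],
      ![0, l.bb 1, 0, k.bb 0, 0, 0],
      ![-l.bb 1, 0, 0, k.bb 1, 0, 0],
      ![0, 0, l.ff 1, 0, 0, -k.bf 1]],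
    ![![0, 0, -k.bf 0, 0, 0, 0],
      ![0, 0, -k.bf 1, 0, 0, 0],
      ![k.ff 0, k.ff 1, 0, 0, 0, 0],
      ![0, 0, l.bf 0, 0, 0, k.ff 0],
      ![0, 0, l.bf 1, 0, 0, k.ff 1],
      ![-l.bf 0, -l.bf 1, 0, k.bf 0, k.bf 1, 0]],
    ![![0, -l.bb 0, 0, 0, k.bb 0, 0],
      ![0, -l.bb 1, 0, -k.bb 0, 0, 0],
      ![0, 0, -l.bf 0, 0, 0, -k.ff 0],
      ![0, 0, 0, 0, 0, 0],
      ![0, 0, 0, l.bb 0, l.bb 1, 0],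
      ![0, 0, 0, 0, 0, l.bf 0]],
    ![![l.bb 0, 0, 0, 0, k.bb 1, 0],
      ![l.bb 1, 0, 0, -k.bb 1, 0, 0],
      ![0, 0, -l.bf 1, 0, 0, -k.ff 1],
      ![0, 0, 0, -l.bb 0, -l.bb 1, 0],
      ![0, 0, 0, 0, 0, 0],
      ![0, 0, 0, 0, 0, l.bf 1]],
    ![![0, 0, -l.ff 0, 0, 0, k.bf 0],
      ![0, 0, -l.ff 1, 0, 0, k.bf 1],
      ![-l.bf 0, -l.bf 1, 0, k.bf 0, k.bf 1, 0],
      ![0, 0, 0, 0, 0, -l.bf 0],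
      ![0, 0, 0, 0, 0, -l.bf 1],
      ![0, 0, 0, l.ff 0, l.ff 1, 0]]]

/-- `e = (b₁, b₂, f, b̃¹, b̃², f̃)` is a dual homogeneous basis of `D` whose first half has the
brackets `k` and whose second half has the brackets `l`. -/
structure Frame (D : MetricLieSuperalgebra V) (k l : Brackets21) (e : Fin 6 → V) : Prop where
  mem : ∀ i, e i ∈ D.part (frameParity i)
  gram : ∀ i j, D.form (e i) (e j) = frameGram i j
  top : Submodule.span ℝ (Set.range e) = ⊤
  left : D.HasBrackets ![e 0, e 1] (e 2) k
  right : D.HasBrackets ![e 3, e 4] (e 5) l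

namespace Frame

variable {D : MetricLieSuperalgebra V} {k l : Brackets21} {e : Fin 6 → V}

theorem ext_form (h : Frame D k l e) {x y : V} (H : ∀ i, D.form x (e i) = D.form y (e i)) :
    x = y := by
  have : ∀ z, D.form x z = D.form y z := by
    intro z
    have hz : z ∈ Submodule.span ℝ (Set.range e) := h.top ▸ Submodule.mem_top
    induction hz using Submodule.span_induction with
    | mem z hz => obtain ⟨i, rfl⟩ := hz; exact H i
    | zero => simp
    | add a b _ _ ha hb => simp [ha, hb]
    | smul c a _ ha => simp [ha]
  rw [← sub_eq_zero]
  exact D.nondegenerate.1 _ fun z => by simp [this z]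

theorem mem_even (h : Frame D k l e) :
    e 0 ∈ D.part 0 ∧ e 1 ∈ D.part 0 ∧ e 3 ∈ D.part 0 ∧ e 4 ∈ D.part 0 :=
  ⟨h.mem 0, h.mem 1, h.mem 3, h.mem 4⟩

theorem mem_odd (h : Frame D k l e) : e 2 ∈ D.part 1 ∧ e 5 ∈ D.part 1 := ⟨h.mem 2, h.mem 5⟩

theorem brackets_half (h : Frame D k l e) :
    (D.bracket (e 0) (e 1) = k.bb 0 • e 0 + k.bb 1 • e 1 ∧
      D.bracket (e 0) (e 2) = k.bf 0 • e 2 ∧ D.bracket (e 1) (e 2) = k.bf 1 • e 2 ∧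
      D.bracket (e 2) (e 2) = k.ff 0 • e 0 + k.ff 1 • e 1) ∧
    (D.bracket (e 3) (e 4) = l.bb 0 • e 3 + l.bb 1 • e 4 ∧
      D.bracket (e 3) (e 5) = l.bf 0 • e 5 ∧ D.bracket (e 4) (e 5) = l.bf 1 • e 5 ∧
      D.bracket (e 5) (e 5) = l.ff 0 • e 3 + l.ff 1 • e 4) := by
  obtain ⟨h₁, h₂, h₃⟩ := h.left
  obtain ⟨h₄, h₅, h₆⟩ := h.right
  have a := h₂ 0
  have b := h₂ 1
  have c := h₅ 0
  have d := h₅ 1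
  simp only [Fin.sum_univ_two, Matrix.cons_val_zero, Matrix.cons_val_one] at *
  exact ⟨⟨h₁, a, b, h₃⟩, h₄, c, d, h₆⟩

theorem ext_form_six (h : Frame D k l e) {x y : V} (h0 : D.form x (e 0) = D.form y (e 0))
    (h1 : D.form x (e 1) = D.form y (e 1)) (h2 : D.form x (e 2) = D.form y (e 2))
    (h3 : D.form x (e 3) = D.form y (e 3)) (h4 : D.form x (e 4) = D.form y (e 4))
    (h5 : D.form x (e 5) = D.form y (e 5)) : x = y := by
  refine h.ext_form fun i => ?_
  fin_cases i <;> assumption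

theorem bracket_even_odd_swap {x y : V} (hx : x ∈ D.part 0) :
    D.bracket y x = -D.bracket x y := by
  rw [D.bracket_even_left hx, neg_neg]

theorem bracket_self_of_even {x : V} (hx : x ∈ D.part 0) : D.bracket x x = 0 := by
  have h := D.bracket_even_left hx x
  have h2 : (2 : ℝ) • D.bracket x x = 0 := by
    rw [two_smul]; nth_rewrite 1 [h]; simp
  simpa using h2

theorem bracket_same_half (h : Frame D k l e) :
    D.bracket (e 0) (e 0) = 0 ∧ D.bracket (e 1) (e 1) = 0 ∧
    D.bracket (e 1) (e 0) = -(k.bb 0 • e 0 + k.bb 1 • e 1) ∧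
    D.bracket (e 2) (e 0) = -(k.bf 0 • e 2) ∧ D.bracket (e 2) (e 1) = -(k.bf 1 • e 2) ∧
    D.bracket (e 3) (e 3) = 0 ∧ D.bracket (e 4) (e 4) = 0 ∧
    D.bracket (e 4) (e 3) = -(l.bb 0 • e 3 + l.bb 1 • e 4) ∧
    D.bracket (e 5) (e 3) = -(l.bf 0 • e 5) ∧ D.bracket (e 5) (e 4) = -(l.bf 1 • e 5) := by
  obtain ⟨⟨h01, h02, h12, -⟩, h34, h35, h45, -⟩ := h.brackets_half
  obtain ⟨m0, m1, m3, m4⟩ := h.mem_even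
  rw [← h01, ← h02, ← h12, ← h34, ← h35, ← h45]
  exact ⟨bracket_self_of_even m0, bracket_self_of_even m1, bracket_even_odd_swap m0,
    bracket_even_odd_swap m0, bracket_even_odd_swap m1, bracket_self_of_even m3,
    bracket_self_of_even m4, bracket_even_odd_swap m3, bracket_even_odd_swap m3,
    bracket_even_odd_swap m4⟩

/-- A mixed bracket is found from its pairings with the six frame vectors: associativity of the form
moves the computation to a bracket of two vectors of the same half, which is known. -/
theorem bracket_mixed (h : Frame D k l e) :
    D.bracket (e 0) (e 3) = l.bb 0 • e 1 - k.bb 0 • e 4 ∧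
    D.bracket (e 0) (e 4) = -(l.bb 0 • e 0) - k.bb 1 • e 4 ∧
    D.bracket (e 1) (e 3) = l.bb 1 • e 1 + k.bb 0 • e 3 ∧
    D.bracket (e 1) (e 4) = -(l.bb 1 • e 0) + k.bb 1 • e 3 ∧
    D.bracket (e 0) (e 5) = l.ff 0 • e 2 - k.bf 0 • e 5 ∧
    D.bracket (e 1) (e 5) = l.ff 1 • e 2 - k.bf 1 • e 5 ∧
    D.bracket (e 3) (e 2) = -(l.bf 0 • e 2) - k.ff 0 • e 5 ∧
    D.bracket (e 4) (e 2) = -(l.bf 1 • e 2) - k.ff 1 • e 5 ∧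
    D.bracket (e 2) (e 5) = -(l.bf 0 • e 0) - l.bf 1 • e 1 + k.bf 0 • e 3 + k.bf 1 • e 4 := by
  obtain ⟨⟨h01, h02, h12, h22⟩, h34, h35, h45, h55⟩ := h.brackets_half
  obtain ⟨h00, h11, h10, h20, h21, h33, h44, h43, h53, h54⟩ := h.bracket_same_half
  obtain ⟨m0, m1, m3, m4⟩ := h.mem_even
  obtain ⟨m2, m5⟩ := h.mem_odd
  refine ⟨?_, ?_, ?_, ?_, ?_, ?_, ?_, ?_, ?_⟩
  · refine h.ext_form_six ?_ ?_ ?_ ?_ ?_ ?_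
    -- A test vector in the half of the first factor requires skewness, which brings that factor
    -- next to it; for the other half associativity applies directly.
    · rw [D.bracket_even_left m0, map_neg, LinearMap.neg_apply,
      D.form_bracket_assoc]; simp [h.gram, frameGram, *]
    · rw [D.bracket_even_left m0, map_neg, LinearMap.neg_apply,
      D.form_bracket_assoc]; simp [h.gram, frameGram, *]
    · rw [D.bracket_even_left m0, map_neg, LinearMap.neg_apply,
      D.form_bracket_assoc]; simp [h.gram, frameGram, *]
    · rw [D.form_bracket_assoc]; simp [h.gram, frameGram, *]
    · rw [D.form_bracket_assoc]; simp [h.gram, frameGram, *]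
    · rw [D.form_bracket_assoc]; simp [h.gram, frameGram, *]
  · refine h.ext_form_six ?_ ?_ ?_ ?_ ?_ ?_
    · rw [D.bracket_even_left m0, map_neg, LinearMap.neg_apply,
      D.form_bracket_assoc]; simp [h.gram, frameGram, *]
    · rw [D.bracket_even_left m0, map_neg, LinearMap.neg_apply,
      D.form_bracket_assoc]; simp [h.gram, frameGram, *]
    · rw [D.bracket_even_left m0, map_neg, LinearMap.neg_apply,
      D.form_bracket_assoc]; simp [h.gram, frameGram, *]
    · rw [D.form_bracket_assoc]; simp [h.gram, frameGram, *]
    · rw [D.form_bracket_assoc]; simp [h.gram, frameGram, *]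
    · rw [D.form_bracket_assoc]; simp [h.gram, frameGram, *]
  · refine h.ext_form_six ?_ ?_ ?_ ?_ ?_ ?_
    · rw [D.bracket_even_left m1, map_neg, LinearMap.neg_apply,
      D.form_bracket_assoc]; simp [h.gram, frameGram, *]
    · rw [D.bracket_even_left m1, map_neg, LinearMap.neg_apply,
      D.form_bracket_assoc]; simp [h.gram, frameGram, *]
    · rw [D.bracket_even_left m1, map_neg, LinearMap.neg_apply,
      D.form_bracket_assoc]; simp [h.gram, frameGram, *]
    · rw [D.form_bracket_assoc]; simp [h.gram, frameGram, *]
    · rw [D.form_bracket_assoc]; simp [h.gram, frameGram, *]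
    · rw [D.form_bracket_assoc]; simp [h.gram, frameGram, *]
  · refine h.ext_form_six ?_ ?_ ?_ ?_ ?_ ?_
    · rw [D.bracket_even_left m1, map_neg, LinearMap.neg_apply,
      D.form_bracket_assoc]; simp [h.gram, frameGram, *]
    · rw [D.bracket_even_left m1, map_neg, LinearMap.neg_apply,
      D.form_bracket_assoc]; simp [h.gram, frameGram, *]
    · rw [D.bracket_even_left m1, map_neg, LinearMap.neg_apply,
      D.form_bracket_assoc]; simp [h.gram, frameGram, *]
    · rw [D.form_bracket_assoc]; simp [h.gram, frameGram, *]
    · rw [D.form_bracket_assoc]; simp [h.gram, frameGram, *]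
    · rw [D.form_bracket_assoc]; simp [h.gram, frameGram, *]
  · refine h.ext_form_six ?_ ?_ ?_ ?_ ?_ ?_
    · rw [D.bracket_even_left m0, map_neg, LinearMap.neg_apply,
      D.form_bracket_assoc]; simp [h.gram, frameGram, *]
    · rw [D.bracket_even_left m0, map_neg, LinearMap.neg_apply,
      D.form_bracket_assoc]; simp [h.gram, frameGram, *]
    · rw [D.bracket_even_left m0, map_neg, LinearMap.neg_apply,
      D.form_bracket_assoc]; simp [h.gram, frameGram, *]
    · rw [D.form_bracket_assoc]; simp [h.gram, frameGram, *]
    · rw [D.form_bracket_assoc]; simp [h.gram, frameGram, *]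
    · rw [D.form_bracket_assoc]; simp [h.gram, frameGram, *]
  · refine h.ext_form_six ?_ ?_ ?_ ?_ ?_ ?_
    · rw [D.bracket_even_left m1, map_neg, LinearMap.neg_apply,
      D.form_bracket_assoc]; simp [h.gram, frameGram, *]
    · rw [D.bracket_even_left m1, map_neg, LinearMap.neg_apply,
      D.form_bracket_assoc]; simp [h.gram, frameGram, *]
    · rw [D.bracket_even_left m1, map_neg, LinearMap.neg_apply,
      D.form_bracket_assoc]; simp [h.gram, frameGram, *]
    · rw [D.form_bracket_assoc]; simp [h.gram, frameGram, *]
    · rw [D.form_bracket_assoc]; simp [h.gram, frameGram, *]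
    · rw [D.form_bracket_assoc]; simp [h.gram, frameGram, *]
  · refine h.ext_form_six ?_ ?_ ?_ ?_ ?_ ?_
    · rw [D.form_bracket_assoc]; simp [h.gram, frameGram, *]
    · rw [D.form_bracket_assoc]; simp [h.gram, frameGram, *]
    · rw [D.form_bracket_assoc]; simp [h.gram, frameGram, *]
    · rw [D.bracket_even_left m3, map_neg, LinearMap.neg_apply,
      D.form_bracket_assoc]; simp [h.gram, frameGram, *]
    · rw [D.bracket_even_left m3, map_neg, LinearMap.neg_apply,
      D.form_bracket_assoc]; simp [h.gram, frameGram, *]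
    · rw [D.bracket_even_left m3, map_neg, LinearMap.neg_apply,
      D.form_bracket_assoc]; simp [h.gram, frameGram, *]
  · refine h.ext_form_six ?_ ?_ ?_ ?_ ?_ ?_
    · rw [D.form_bracket_assoc]; simp [h.gram, frameGram, *]
    · rw [D.form_bracket_assoc]; simp [h.gram, frameGram, *]
    · rw [D.form_bracket_assoc]; simp [h.gram, frameGram, *]
    · rw [D.bracket_even_left m4, map_neg, LinearMap.neg_apply,
      D.form_bracket_assoc]; simp [h.gram, frameGram, *]
    · rw [D.bracket_even_left m4, map_neg, LinearMap.neg_apply,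
      D.form_bracket_assoc]; simp [h.gram, frameGram, *]
    · rw [D.bracket_even_left m4, map_neg, LinearMap.neg_apply,
      D.form_bracket_assoc]; simp [h.gram, frameGram, *]
  · refine h.ext_form_six ?_ ?_ ?_ ?_ ?_ ?_
    · rw [D.bracket_odd_odd m2 m5, D.form_bracket_assoc]; simp [h.gram, frameGram, *]
    · rw [D.bracket_odd_odd m2 m5, D.form_bracket_assoc]; simp [h.gram, frameGram, *]
    · rw [D.bracket_odd_odd m2 m5, D.form_bracket_assoc]; simp [h.gram, frameGram, *]
    · rw [D.form_bracket_assoc]; simp [h.gram, frameGram, *]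
    · rw [D.form_bracket_assoc]; simp [h.gram, frameGram, *]
    · rw [D.form_bracket_assoc]; simp [h.gram, frameGram, *]

theorem bracket_eq (h : Frame D k l e) (i j : Fin 6) :
    D.bracket (e i) (e j) = ∑ m, doubleBracket k l i j m • e m := by
  obtain ⟨⟨h01, h02, h12, h22⟩, h34, h35, h45, h55⟩ := h.brackets_half
  obtain ⟨h00, h11, h10, h20, h21, h33, h44, h43, h53, h54⟩ := h.bracket_same_half
  obtain ⟨h03, h04, h13, h14, h05, h15, h32, h42, h25⟩ := h.bracket_mixed
  obtain ⟨m0, m1, m3, m4⟩ := h.mem_even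
  obtain ⟨m2, m5⟩ := h.mem_odd
  have h30 := D.bracket_even_left m3 (e 0)
  have h40 := D.bracket_even_left m4 (e 0)
  have h31 := D.bracket_even_left m3 (e 1)
  have h41 := D.bracket_even_left m4 (e 1)
  have h50 := bracket_even_odd_swap (D := D) (y := e 5) m0
  have h51 := bracket_even_odd_swap (D := D) (y := e 5) m1
  have h23 := bracket_even_odd_swap (D := D) (y := e 2) m3
  have h24 := bracket_even_odd_swap (D := D) (y := e 2) m4
  have h52 := D.bracket_odd_odd m5 m2
  rw [h03] at h30
  rw [h04] at h40
  rw [h13] at h31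
  rw [h14] at h41
  rw [h05] at h50
  rw [h15] at h51
  rw [h32] at h23
  rw [h42] at h24
  rw [h25] at h52
  fin_cases i <;> fin_cases j <;>
    simp [doubleBracket, Fin.sum_univ_six, *] <;> module

end Frame
end MetricLieSuperalgebra

/-! ### Homogeneous parts of spans. -/

namespace LieSuperalgebra

variable {V : Type*} [AddCommGroup V] [Module ℝ V]

theorem eq_zero_of_mem_part (L : LieSuperalgebra V) {x : V} (h₀ : x ∈ L.part 0)
    (h₁ : x ∈ L.part 1) : x = 0 :=
  Submodule.disjoint_def.1 L.isCompl.disjoint x h₀ h₁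

theorem eq_zero_of_mem_part_of_ne (L : LieSuperalgebra V) {i j : ZMod 2} (hij : i ≠ j) {x : V}
    (h₀ : x ∈ L.part i) (h₁ : x ∈ L.part j) : x = 0 := by
  fin_cases i <;> fin_cases j
  · exact absurd rfl hij
  · exact L.eq_zero_of_mem_part h₀ h₁
  · exact L.eq_zero_of_mem_part h₁ h₀
  · exact absurd rfl hij

/-- The homogeneous parts of the span of homogeneous vectors. -/
theorem span_image_inf_part {ι : Type*} (L : LieSuperalgebra V) {v : ι → V} {p : ι → ZMod 2}
    (hv : ∀ j, v j ∈ L.part (p j)) (s : Set ι) (i : ZMod 2) :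
    Submodule.span ℝ (v '' s) ⊓ L.part i = Submodule.span ℝ (v '' (s ∩ p ⁻¹' {i})) := by
  have hpart : ∀ (t : Set ι) (k : ZMod 2), t ⊆ p ⁻¹' {k} →
      Submodule.span ℝ (v '' t) ≤ L.part k := by
    intro t k ht
    rw [Submodule.span_le]
    rintro _ ⟨j, hj, rfl⟩
    have := ht hj
    simp only [Set.mem_preimage, Set.mem_singleton_iff] at this
    exact this ▸ hv j
  apply le_antisymm
  · rintro x ⟨hx, hxi⟩
    have hs : s = (s ∩ p ⁻¹' {i}) ∪ (s ∩ p ⁻¹' {i + 1}) := by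
      rw [← Set.inter_union_distrib_left, eq_comm, Set.inter_eq_left]
      intro j _
      have : ∀ a b : ZMod 2, a = b ∨ a = b + 1 := by decide
      simpa using this (p j) i
    rw [SetLike.mem_coe, hs, Set.image_union, Submodule.span_union, Submodule.mem_sup] at hx
    obtain ⟨y, hy, z, hz, rfl⟩ := hx
    have hyi := hpart _ i Set.inter_subset_right hy
    have hz1 := hpart _ (i + 1) Set.inter_subset_right hz
    -- The component `z` of the wrong parity is the difference of `y + z` and `y`, so it also has
    -- parity `i` and must vanish.
    have hz0 : z ∈ L.part i := by simpa using (L.part i).sub_mem hxi hyi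
    have : ∀ a : ZMod 2, a ≠ a + 1 := by decide
    rw [L.eq_zero_of_mem_part_of_ne (this i) hz0 hz1, add_zero]
    exact hy
  · exact le_inf (Submodule.span_mono (Set.image_mono Set.inter_subset_left))
      (hpart _ _ Set.inter_subset_right)

end LieSuperalgebra

/-! ### Frames versus Manin supertriples with a dual basis. -/

namespace MetricLieSuperalgebra

variable {V : Type*} [AddCommGroup V] [Module ℝ V]

/-- The Gram matrix is a signed permutation matrix, so pairing a vanishing combination with the
frame vectors isolates each coefficient. -/
theorem linearIndependent_of_gram (D : MetricLieSuperalgebra V) {e : Fin 6 → V}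
    (h : ∀ i j, D.form (e i) (e j) = frameGram i j) : LinearIndependent ℝ e := by
  rw [Fintype.linearIndependent_iff]
  intro g hg
  have H : ∀ j, ∑ i, g i * frameGram i j = 0 := by
    intro j
    have := congrArg (fun x => D.form x (e j)) hg
    simpa [map_sum, LinearMap.sum_apply, h] using this
  have H0 := H 0
  have H1 := H 1
  have H2 := H 2
  have H3 := H 3
  have H4 := H 4
  have H5 := H 5
  simp [Fin.sum_univ_six, frameGram] at H0 H1 H2 H3 H4 H5
  intro i
  fin_cases i <;> assumption

/-- The span of the first half of a frame. -/
def leftSpan (e : Fin 6 → V) : Submodule ℝ V := Submodule.span ℝ {e 0, e 1, e 2}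

/-- The span of the second half of a frame. -/
def rightSpan (e : Fin 6 → V) : Submodule ℝ V := Submodule.span ℝ {e 3, e 4, e 5}

theorem leftSpan_eq_image (e : Fin 6 → V) :
    leftSpan e = Submodule.span ℝ (e '' {0, 1, 2}) := by
  simp [leftSpan, Set.image_insert_eq]

theorem rightSpan_eq_image (e : Fin 6 → V) :
    rightSpan e = Submodule.span ℝ (e '' {3, 4, 5}) := by
  simp [rightSpan, Set.image_insert_eq]

theorem leftSpan_sup_rightSpan (e : Fin 6 → V) :
    leftSpan e ⊔ rightSpan e = Submodule.span ℝ (Set.range e) := by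
  rw [leftSpan_eq_image, rightSpan_eq_image, ← Submodule.span_union, ← Set.image_union,
    ← Set.image_univ]
  congr 2
  ext i
  fin_cases i <;> simp

theorem mem_leftSpan {e : Fin 6 → V} {x : V} :
    x ∈ leftSpan e ↔ ∃ a b c : ℝ, x = a • e 0 + b • e 1 + c • e 2 := by
  simp only [leftSpan, Submodule.mem_span_triple, eq_comm]

theorem mem_rightSpan {e : Fin 6 → V} {x : V} :
    x ∈ rightSpan e ↔ ∃ a b c : ℝ, x = a • e 3 + b • e 4 + c • e 5 := by
  simp only [rightSpan, Submodule.mem_span_triple, eq_comm]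

namespace Frame

variable {D : MetricLieSuperalgebra V} {k l : Brackets21} {e : Fin 6 → V}

theorem linearIndependent (h : Frame D k l e) : LinearIndependent ℝ e :=
  D.linearIndependent_of_gram h.gram

/-- A frame as a basis. -/
noncomputable def basis (h : Frame D k l e) : Module.Basis (Fin 6) ℝ V :=
  Module.Basis.mk h.linearIndependent h.top.ge

@[simp]
theorem basis_apply (h : Frame D k l e) (i : Fin 6) : h.basis i = e i := by
  simp [basis]

theorem finrank_eq (h : Frame D k l e) : Module.finrank ℝ V = 6 := by
  simpa using Module.finrank_eq_card_basis h.basis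

theorem part_eq (h : Frame D k l e) (i : ZMod 2) :
    D.part i = Submodule.span ℝ (e '' (frameParity ⁻¹' {i})) := by
  have := D.span_image_inf_part h.mem Set.univ i
  rwa [Set.image_univ, h.top, top_inf_eq, Set.univ_inter] at this

theorem mem_even_iff (h : Frame D k l e) {x : V} : x ∈ D.part 0 ↔
    ∃ a b c d : ℝ, x = a • e 0 + b • e 1 + c • e 3 + d • e 4 := by
  have hs : frameParity ⁻¹' {0} = {0, 1, 3, 4} := by
    ext i; fin_cases i <;> simp [frameParity]
  rw [h.part_eq, hs]
  simp only [Set.image_insert_eq, Set.image_singleton, Submodule.mem_span_insert,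
    Submodule.mem_span_singleton]
  constructor
  · rintro ⟨a, _, ⟨b, _, ⟨c, _, ⟨d, rfl⟩, rfl⟩, rfl⟩, rfl⟩
    exact ⟨a, b, c, d, by abel⟩
  · rintro ⟨a, b, c, d, rfl⟩
    exact ⟨a, _, ⟨b, _, ⟨c, _, ⟨d, rfl⟩, rfl⟩, rfl⟩, by abel⟩

theorem mem_odd_iff (h : Frame D k l e) {x : V} : x ∈ D.part 1 ↔
    ∃ a b : ℝ, x = a • e 2 + b • e 5 := by
  have hs : frameParity ⁻¹' {1} = {2, 5} := by
    ext i; fin_cases i <;> simp [frameParity]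
  rw [h.part_eq, hs]
  simp only [Set.image_insert_eq, Set.image_singleton, Submodule.mem_span_insert,
    Submodule.mem_span_singleton]
  constructor
  · rintro ⟨a, _, ⟨b, rfl⟩, rfl⟩
    exact ⟨a, b, rfl⟩
  · rintro ⟨a, b, rfl⟩
    exact ⟨a, _, ⟨b, rfl⟩, rfl⟩

theorem finrank_span_image (h : Frame D k l e) (s : Finset (Fin 6)) :
    Module.finrank ℝ (Submodule.span ℝ (e '' s)) = s.card := by
  classical
  have hi := h.linearIndependent.injective
  have := finrank_span_finset_eq_card (R := ℝ) (s := s.image e) (by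
    rw [Finset.coe_image]
    exact (h.linearIndependent.linearIndepOn _).id_image)
  rwa [Finset.coe_image, Finset.card_image_of_injective _ hi] at this

theorem hasSuperdim (h : Frame D k l e) : D.HasSuperdim 4 2 := by
  refine ⟨Module.Finite.of_basis h.basis, ?_, ?_⟩
  · have hs : frameParity ⁻¹' {0} = (({0, 1, 3, 4} : Finset (Fin 6)) : Set (Fin 6)) := by
      ext i; fin_cases i <;> simp [frameParity]
    rw [h.part_eq, hs, h.finrank_span_image]
    rfl
  · have hs : frameParity ⁻¹' {1} = (({2, 5} : Finset (Fin 6)) : Set (Fin 6)) := by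
      ext i; fin_cases i <;> simp [frameParity]
    rw [h.part_eq, hs, h.finrank_span_image]
    rfl

theorem form_left (h : Frame D k l e) {x y : V} (hx : x ∈ leftSpan e) (hy : y ∈ leftSpan e) :
    D.form x y = 0 := by
  obtain ⟨a, b, c, rfl⟩ := mem_leftSpan.1 hx
  obtain ⟨a', b', c', rfl⟩ := mem_leftSpan.1 hy
  simp [h.gram, frameGram]

theorem form_right (h : Frame D k l e) {x y : V} (hx : x ∈ rightSpan e)
    (hy : y ∈ rightSpan e) : D.form x y = 0 := by
  obtain ⟨a, b, c, rfl⟩ := mem_rightSpan.1 hx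
  obtain ⟨a', b', c', rfl⟩ := mem_rightSpan.1 hy
  simp [h.gram, frameGram]

theorem form_even_odd (h : Frame D k l e) {x y : V} (hx : x ∈ D.part 0) (hy : y ∈ D.part 1) :
    D.form x y = 0 := by
  obtain ⟨a, b, c, d, rfl⟩ := h.mem_even_iff.1 hx
  obtain ⟨a', b', rfl⟩ := h.mem_odd_iff.1 hy
  simp [h.gram, frameGram]

theorem form_odd_even (h : Frame D k l e) {x y : V} (hx : x ∈ D.part 1) (hy : y ∈ D.part 0) :
    D.form x y = 0 := by
  obtain ⟨a', b', rfl⟩ := h.mem_odd_iff.1 hx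
  obtain ⟨a, b, c, d, rfl⟩ := h.mem_even_iff.1 hy
  simp [h.gram, frameGram]

/-- Exchange of the two halves of a frame. -/
theorem swap (h : Frame D k l e) : Frame D l k ![e 3, e 4, e 5, e 0, e 1, -e 2] where
  mem := by
    intro i
    have := h.mem
    fin_cases i
    · exact this 3
    · exact this 4
    · exact this 5
    · exact this 0
    · exact this 1
    · exact (D.part 1).neg_mem (this 2)
  -- The sign in `-e 2` compensates ⟨f̃,f⟩ = -1; it does not affect the brackets, since [-f,-f] =
  -- [f,f].
  gram := by
    intro i j
    fin_cases i <;> fin_cases j <;> simp [h.gram, frameGram]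
  top := by
    rw [← leftSpan_sup_rightSpan, ← h.top, ← leftSpan_sup_rightSpan, sup_comm]
    congr 1
    refine le_antisymm ?_ ?_
    · rw [rightSpan, leftSpan, Submodule.span_le]
      rintro _ (rfl | rfl | rfl)
      · exact Submodule.subset_span (by simp)
      · exact Submodule.subset_span (by simp)
      · exact Submodule.neg_mem _ (Submodule.subset_span (by simp))
    · rw [rightSpan, leftSpan, Submodule.span_le]
      rintro _ (rfl | rfl | rfl)
      · exact Submodule.subset_span (by simp)
      · exact Submodule.subset_span (by simp)
      · exact (Submodule.neg_mem_iff _).1 (Submodule.subset_span (by simp))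
  left := by simpa using h.right
  right := by
    obtain ⟨h₁, h₂, h₃⟩ := h.left
    refine ⟨by simpa using h₁, fun i => ?_, by simpa using h₃⟩
    simpa using h₂ i

theorem leftSpan_swap (e : Fin 6 → V) :
    leftSpan ![e 3, e 4, e 5, e 0, e 1, -e 2] = rightSpan e := by
  simp [leftSpan, rightSpan]

theorem rightSpan_swap (e : Fin 6 → V) :
    rightSpan ![e 3, e 4, e 5, e 0, e 1, -e 2] = leftSpan e := by
  ext x
  rw [mem_leftSpan, mem_rightSpan]
  constructor
  · rintro ⟨a, b, c, rfl⟩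
    exact ⟨a, b, -c, by simp⟩
  · rintro ⟨a, b, c, rfl⟩
    exact ⟨a, b, -c, by simp⟩

theorem isCompl (h : Frame D k l e) : IsCompl (leftSpan e) (rightSpan e) := by
  constructor
  · rw [Submodule.disjoint_def]
    intro x hx hy
    obtain ⟨a, b, c, rfl⟩ := mem_leftSpan.1 hx
    have h3 := h.form_right hy (Submodule.subset_span (by simp) : e 3 ∈ rightSpan e)
    have h4 := h.form_right hy (Submodule.subset_span (by simp) : e 4 ∈ rightSpan e)
    have h5 := h.form_right hy (Submodule.subset_span (by simp) : e 5 ∈ rightSpan e)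
    simp [h.gram, frameGram] at h3 h4 h5
    simp [h3, h4, h5]
  · rw [codisjoint_iff, leftSpan_sup_rightSpan, h.top]

theorem isSubalgebra_left (h : Frame D k l e) : D.IsSubalgebra (leftSpan e) := by
  constructor
  · refine le_antisymm ?_ (sup_le inf_le_left inf_le_left)
    intro x hx
    obtain ⟨a, b, c, rfl⟩ := mem_leftSpan.1 hx
    refine Submodule.add_mem_sup ⟨mem_leftSpan.2 ⟨a, b, 0, by simp⟩, ?_⟩
      ⟨mem_leftSpan.2 ⟨0, 0, c, by simp⟩, ?_⟩
    · exact add_mem (Submodule.smul_mem _ _ (h.mem 0)) (Submodule.smul_mem _ _ (h.mem 1))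
    · exact Submodule.smul_mem _ _ (h.mem 2)
  · intro x hx y hy
    obtain ⟨a, b, c, rfl⟩ := mem_leftSpan.1 hx
    obtain ⟨a', b', c', rfl⟩ := mem_leftSpan.1 hy
    refine mem_leftSpan.2 ⟨(a * b' - b * a') * k.bb 0 + c * c' * k.ff 0,
      (a * b' - b * a') * k.bb 1 + c * c' * k.ff 1,
      (a * c' - c * a') * k.bf 0 + (b * c' - c * b') * k.bf 1, ?_⟩
    simp [h.bracket_eq, doubleBracket, Fin.sum_univ_six]
    module

theorem isMaximalIsotropic_left (h : Frame D k l e) : D.IsMaximalIsotropic (leftSpan e) := by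
  refine ⟨fun x hx y hy => h.form_left hx hy, fun W hW hle x hx => ?_⟩
  obtain ⟨y, hy, z, hz, rfl⟩ := Submodule.mem_sup.1
    (h.isCompl.sup_eq_top ▸ Submodule.mem_top : x ∈ leftSpan e ⊔ rightSpan e)
  obtain ⟨a, b, c, rfl⟩ := mem_rightSpan.1 hz
  -- Both the given vector of `W` and its left component annihilate the left half, hence so does the
  -- right component, and duality of the halves makes it zero.
  have hs : ∀ w ∈ leftSpan e, D.form (a • e 3 + b • e 4 + c • e 5) w = 0 := by
    intro w hw
    have h₁ := hW _ hx w (hle hw)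
    rwa [map_add, LinearMap.add_apply, h.form_left hy hw, zero_add] at h₁
  have h0 := hs _ (Submodule.subset_span (by simp) : e 0 ∈ leftSpan e)
  have h1 := hs _ (Submodule.subset_span (by simp) : e 1 ∈ leftSpan e)
  have h2 := hs _ (Submodule.subset_span (by simp) : e 2 ∈ leftSpan e)
  simp [h.gram, frameGram] at h0 h1 h2
  simpa [h0, h1, h2] using hy

theorem isManinSupertriple (h : Frame D k l e) :
    D.IsManinSupertriple (leftSpan e) (rightSpan e) where
  isCompl := h.isCompl
  left_subalgebra := h.isSubalgebra_left
  right_subalgebra := leftSpan_swap e ▸ h.swap.isSubalgebra_left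
  left_isotropic := h.isMaximalIsotropic_left
  right_isotropic := leftSpan_swap e ▸ h.swap.isMaximalIsotropic_left
  even_odd := fun _ hx _ hy => h.form_even_odd hx.2 hy.2
  odd_even := fun _ hx _ hy => h.form_odd_even hx.2 hy.2

theorem isDualBasis (h : Frame D k l e) :
    D.IsDualBasis (leftSpan e) (rightSpan e) ![e 0, e 1] (e 2) ![e 3, e 4] (e 5) where
  b_mem := by
    intro i
    fin_cases i
    · exact h.mem 0
    · exact h.mem 1
  f_mem := h.mem 2
  bt_mem := by
    intro i
    fin_cases i
    · exact h.mem 3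
    · exact h.mem 4
  ft_mem := h.mem 5
  span_left := rfl
  span_right := rfl
  b_bt := by intro i j; fin_cases i <;> fin_cases j <;> simp [h.gram, frameGram]
  bt_b := by intro i j; fin_cases i <;> fin_cases j <;> simp [h.gram, frameGram]
  f_ft := by simp [h.gram, frameGram]
  ft_f := by simp [h.gram, frameGram]
  b_ft := by intro i; fin_cases i <;> simp [h.gram, frameGram]
  ft_b := by intro i; fin_cases i <;> simp [h.gram, frameGram]
  f_bt := by intro i; fin_cases i <;> simp [h.gram, frameGram]
  bt_f := by intro i; fin_cases i <;> simp [h.gram, frameGram]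

end Frame

/-- The orthogonality conditions place `S` before `St`, so exchanging the halves needs the vanishing
in the reverse order. -/
theorem IsManinSupertriple.symm {D : MetricLieSuperalgebra V} {S St : Submodule ℝ V}
    (h : D.IsManinSupertriple S St) (hform : ∀ x ∈ D.part 0, ∀ y ∈ D.part 1,
      D.form x y = 0 ∧ D.form y x = 0) : D.IsManinSupertriple St S where
  isCompl := h.isCompl.symm
  left_subalgebra := h.right_subalgebra
  right_subalgebra := h.left_subalgebra
  left_isotropic := h.right_isotropic
  right_isotropic := h.left_isotropic
  even_odd := fun _ hx _ hy => (hform _ hx.2 _ hy.2).1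
  odd_even := fun _ hx _ hy => (hform _ hy.2 _ hx.2).2

/-- A Manin supertriple with a dual homogeneous basis has a frame. -/
theorem IsDualBasis.frame {D : MetricLieSuperalgebra V} {S St : Submodule ℝ V}
    {b : Fin 2 → V} {f : V} {bt : Fin 2 → V} {ft : V} (h : D.IsDualBasis S St b f bt ft)
    (hS : D.IsManinSupertriple S St) {k l : Brackets21} (hk : D.HasBrackets b f k)
    (hl : D.HasBrackets bt ft l) : Frame D k l ![b 0, b 1, f, bt 0, bt 1, ft] where
  mem := by
    intro i
    fin_cases i
    · exact h.b_mem 0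
    · exact h.b_mem 1
    · exact h.f_mem
    · exact h.bt_mem 0
    · exact h.bt_mem 1
    · exact h.ft_mem
  gram := by
    have hl := hS.left_isotropic.prop
    have hr := hS.right_isotropic.prop
    rw [← h.span_left] at hl
    rw [← h.span_right] at hr
    have l0 : b 0 ∈ Submodule.span ℝ {b 0, b 1, f} := Submodule.subset_span (by simp)
    have l1 : b 1 ∈ Submodule.span ℝ {b 0, b 1, f} := Submodule.subset_span (by simp)
    have l2 : f ∈ Submodule.span ℝ {b 0, b 1, f} := Submodule.subset_span (by simp)
    have r0 : bt 0 ∈ Submodule.span ℝ {bt 0, bt 1, ft} := Submodule.subset_span (by simp)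
    have r1 : bt 1 ∈ Submodule.span ℝ {bt 0, bt 1, ft} := Submodule.subset_span (by simp)
    have r2 : ft ∈ Submodule.span ℝ {bt 0, bt 1, ft} := Submodule.subset_span (by simp)
    intro i j
    fin_cases i <;> fin_cases j <;>
      simp [frameGram, h.b_bt, h.bt_b, h.f_ft, h.ft_f, h.b_ft, h.ft_b, h.f_bt, h.bt_f,
        hl _ l0 _ l0, hl _ l0 _ l1, hl _ l0 _ l2, hl _ l1 _ l0, hl _ l1 _ l1, hl _ l1 _ l2,
        hl _ l2 _ l0, hl _ l2 _ l1, hl _ l2 _ l2, hr _ r0 _ r0, hr _ r0 _ r1, hr _ r0 _ r2,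
        hr _ r1 _ r0, hr _ r1 _ r1, hr _ r1 _ r2, hr _ r2 _ r0, hr _ r2 _ r1, hr _ r2 _ r2]
  top := by
    rw [← leftSpan_sup_rightSpan, ← hS.isCompl.sup_eq_top, ← h.span_left, ← h.span_right]
    rfl
  left := by
    convert hk using 1
    · ext i; fin_cases i <;> rfl
    · rfl
  right := by
    convert hl using 1
    · ext i; fin_cases i <;> rfl
    · rfl

theorem isOfType_iff {D : MetricLieSuperalgebra V} {t : TripleType} {S St : Submodule ℝ V} :
    D.IsOfType t S St ↔
      ∃ e, Frame D t.left t.right e ∧ leftSpan e = S ∧ rightSpan e = St := by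
  constructor
  · rintro ⟨hS, b, f, bt, ft, hb, hk, hl⟩
    exact ⟨_, hb.frame hS hk hl, hb.span_left, hb.span_right⟩
  · rintro ⟨e, he, rfl, rfl⟩
    exact ⟨he.isManinSupertriple, _, _, _, _, he.isDualBasis, he.left, he.right⟩

theorem isDualOfType_iff {D : MetricLieSuperalgebra V} {t : TripleType} {S St : Submodule ℝ V} :
    D.IsDualOfType t S St ↔
      ∃ e, Frame D t.left t.right e ∧ leftSpan e = St ∧ rightSpan e = S := by
  rw [IsDualOfType, isOfType_iff, and_iff_right_iff_imp]
  rintro ⟨e, he, rfl, rfl⟩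
  exact he.isManinSupertriple.symm fun x hx y hy => ⟨he.form_even_odd hx hy, he.form_odd_even hy hx⟩

end MetricLieSuperalgebra

/-! ### Coordinates, new frames and Jacobi identities. -/

namespace MetricLieSuperalgebra

variable {V : Type*} [AddCommGroup V] [Module ℝ V]

/-- The even vector with the given coordinates in a frame. -/
def evenVec (e : Fin 6 → V) (x : Fin 4 → ℝ) : V := x 0 • e 0 + x 1 • e 1 + x 2 • e 3 + x 3 • e 4

/-- The odd vector with the given coordinates in a frame. -/
def oddVec (e : Fin 6 → V) (y : Fin 2 → ℝ) : V := y 0 • e 2 + y 1 • e 5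

/-- The form on even coordinate vectors. -/
def evenForm (x y : Fin 4 → ℝ) : ℝ := x 0 * y 2 + x 2 * y 0 + x 1 * y 3 + x 3 * y 1

/-- The form on odd coordinate vectors. -/
def oddForm (x y : Fin 2 → ℝ) : ℝ := x 0 * y 1 - x 1 * y 0

/-- The bracket of even coordinate vectors. -/
def evenBracket (k l : Brackets21) (x y : Fin 4 → ℝ) : Fin 4 → ℝ :=
  ![k.bb 0 * (x 0 * y 1 - x 1 * y 0) - l.bb 0 * (x 0 * y 3 - x 3 * y 0)
      - l.bb 1 * (x 1 * y 3 - x 3 * y 1),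
    k.bb 1 * (x 0 * y 1 - x 1 * y 0) + l.bb 0 * (x 0 * y 2 - x 2 * y 0)
      + l.bb 1 * (x 1 * y 2 - x 2 * y 1),
    l.bb 0 * (x 2 * y 3 - x 3 * y 2) + k.bb 0 * (x 1 * y 2 - x 2 * y 1)
      + k.bb 1 * (x 1 * y 3 - x 3 * y 1),
    l.bb 1 * (x 2 * y 3 - x 3 * y 2) - k.bb 0 * (x 0 * y 2 - x 2 * y 0)
      - k.bb 1 * (x 0 * y 3 - x 3 * y 0)]

/-- The action of even on odd coordinate vectors. -/
def evenOddBracket (k l : Brackets21) (x : Fin 4 → ℝ) (y : Fin 2 → ℝ) : Fin 2 → ℝ :=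
  ![(k.bf 0 * x 0 + k.bf 1 * x 1 - l.bf 0 * x 2 - l.bf 1 * x 3) * y 0
      + (l.ff 0 * x 0 + l.ff 1 * x 1) * y 1,
    -(k.ff 0 * x 2 + k.ff 1 * x 3) * y 0
      - (k.bf 0 * x 0 + k.bf 1 * x 1 - l.bf 0 * x 2 - l.bf 1 * x 3) * y 1]

/-- The bracket of odd coordinate vectors. -/
def oddBracket (k l : Brackets21) (y z : Fin 2 → ℝ) : Fin 4 → ℝ :=
  ![k.ff 0 * (y 0 * z 0) - l.bf 0 * (y 0 * z 1 + y 1 * z 0),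
    k.ff 1 * (y 0 * z 0) - l.bf 1 * (y 0 * z 1 + y 1 * z 0),
    l.ff 0 * (y 1 * z 1) + k.bf 0 * (y 0 * z 1 + y 1 * z 0),
    l.ff 1 * (y 1 * z 1) + k.bf 1 * (y 0 * z 1 + y 1 * z 0)]

theorem evenVec_add (e : Fin 6 → V) (x y : Fin 4 → ℝ) :
    evenVec e (x + y) = evenVec e x + evenVec e y := by
  simp [evenVec]; module

theorem evenVec_smul (e : Fin 6 → V) (c : ℝ) (x : Fin 4 → ℝ) :
    evenVec e (c • x) = c • evenVec e x := by
  simp [evenVec]; module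

theorem oddVec_smul (e : Fin 6 → V) (c : ℝ) (x : Fin 2 → ℝ) :
    oddVec e (c • x) = c • oddVec e x := by
  simp [oddVec]; module

namespace Frame

variable {D : MetricLieSuperalgebra V} {k l : Brackets21} {e : Fin 6 → V}

theorem evenVec_mem (h : Frame D k l e) (x : Fin 4 → ℝ) : evenVec e x ∈ D.part 0 :=
  h.mem_even_iff.2 ⟨_, _, _, _, rfl⟩

theorem oddVec_mem (h : Frame D k l e) (x : Fin 2 → ℝ) : oddVec e x ∈ D.part 1 :=
  h.mem_odd_iff.2 ⟨_, _, rfl⟩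

theorem exists_evenVec (h : Frame D k l e) {v : V} (hv : v ∈ D.part 0) :
    ∃ x, evenVec e x = v := by
  obtain ⟨a, b, c, d, rfl⟩ := h.mem_even_iff.1 hv
  exact ⟨![a, b, c, d], rfl⟩

theorem exists_oddVec (h : Frame D k l e) {v : V} (hv : v ∈ D.part 1) :
    ∃ x, oddVec e x = v := by
  obtain ⟨a, b, rfl⟩ := h.mem_odd_iff.1 hv
  exact ⟨![a, b], rfl⟩

theorem form_evenVec (h : Frame D k l e) (x y : Fin 4 → ℝ) :
    D.form (evenVec e x) (evenVec e y) = evenForm x y := by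
  simp [evenVec, evenForm, h.gram, frameGram]; ring

theorem form_oddVec (h : Frame D k l e) (x y : Fin 2 → ℝ) :
    D.form (oddVec e x) (oddVec e y) = oddForm x y := by
  simp [oddVec, oddForm, h.gram, frameGram]; ring

theorem evenVec_injective (h : Frame D k l e) : Function.Injective (evenVec e) := by
  intro x y hxy
  have H : ∀ z, evenForm x z = evenForm y z := fun z => by
    rw [← h.form_evenVec, ← h.form_evenVec, hxy]
  ext i
  fin_cases i
  · simpa [evenForm] using H ![0, 0, 1, 0]
  · simpa [evenForm] using H ![0, 0, 0, 1]
  · simpa [evenForm] using H ![1, 0, 0, 0]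
  · simpa [evenForm] using H ![0, 1, 0, 0]

theorem oddVec_injective (h : Frame D k l e) : Function.Injective (oddVec e) := by
  intro x y hxy
  have H : ∀ z, oddForm x z = oddForm y z := fun z => by
    rw [← h.form_oddVec, ← h.form_oddVec, hxy]
  ext i
  fin_cases i
  · simpa [oddForm] using H ![0, 1]
  · simpa [oddForm] using H ![1, 0]

theorem bracket_evenVec (h : Frame D k l e) (x y : Fin 4 → ℝ) :
    D.bracket (evenVec e x) (evenVec e y) = evenVec e (evenBracket k l x y) := by
  simp [evenVec, evenBracket, h.bracket_eq, doubleBracket, Fin.sum_univ_six]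
  module

theorem bracket_evenVec_oddVec (h : Frame D k l e) (x : Fin 4 → ℝ) (y : Fin 2 → ℝ) :
    D.bracket (evenVec e x) (oddVec e y) = oddVec e (evenOddBracket k l x y) := by
  simp [evenVec, oddVec, evenOddBracket, h.bracket_eq, doubleBracket, Fin.sum_univ_six]
  module

theorem bracket_oddVec (h : Frame D k l e) (x y : Fin 2 → ℝ) :
    D.bracket (oddVec e x) (oddVec e y) = evenVec e (oddBracket k l x y) := by
  simp [evenVec, oddVec, oddBracket, h.bracket_eq, doubleBracket, Fin.sum_univ_six]
  module

/-- A new frame of the same double from the coordinates of its vectors. -/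
theorem of_coords (h : Frame D k l e) {k' l' : Brackets21} (A : Fin 4 → Fin 4 → ℝ)
    (C : Fin 2 → Fin 2 → ℝ)
    (hA : ∀ i j, evenForm (A i) (A j) =
      (![![0, 0, 1, 0], ![0, 0, 0, 1], ![1, 0, 0, 0], ![0, 1, 0, 0]] : Fin 4 → Fin 4 → ℝ) i j)
    (hC : oddForm (C 0) (C 1) = 1)
    (hbb : evenBracket k l (A 0) (A 1) = k'.bb 0 • A 0 + k'.bb 1 • A 1)
    (hb₀f : evenOddBracket k l (A 0) (C 0) = k'.bf 0 • C 0)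
    (hb₁f : evenOddBracket k l (A 1) (C 0) = k'.bf 1 • C 0)
    (hff : oddBracket k l (C 0) (C 0) = k'.ff 0 • A 0 + k'.ff 1 • A 1)
    (hcc : evenBracket k l (A 2) (A 3) = l'.bb 0 • A 2 + l'.bb 1 • A 3)
    (hc₀g : evenOddBracket k l (A 2) (C 1) = l'.bf 0 • C 1)
    (hc₁g : evenOddBracket k l (A 3) (C 1) = l'.bf 1 • C 1)
    (hgg : oddBracket k l (C 1) (C 1) = l'.ff 0 • A 2 + l'.ff 1 • A 3) :
    Frame D k' l' ![evenVec e (A 0), evenVec e (A 1), oddVec e (C 0), evenVec e (A 2),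
      evenVec e (A 3), oddVec e (C 1)] := by
  have hC' : ∀ i j, oddForm (C i) (C j) = (![![0, 1], ![-1, 0]] : Fin 2 → Fin 2 → ℝ) i j := by
    intro i j
    rw [oddForm] at hC
    fin_cases i <;> fin_cases j <;> simp [oddForm] <;> linarith
  have gram : ∀ i j, D.form (![evenVec e (A 0), evenVec e (A 1), oddVec e (C 0),
      evenVec e (A 2), evenVec e (A 3), oddVec e (C 1)] i) (![evenVec e (A 0), evenVec e (A 1),
      oddVec e (C 0), evenVec e (A 2), evenVec e (A 3), oddVec e (C 1)] j) = frameGram i j := by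
    intro i j
    fin_cases i <;> fin_cases j <;>
      simp [h.form_evenVec, h.form_oddVec, hA, hC', frameGram,
        h.form_even_odd (h.evenVec_mem _) (h.oddVec_mem _),
        h.form_odd_even (h.oddVec_mem _) (h.evenVec_mem _)]
  refine ⟨?_, gram, ?_, ⟨?_, ?_, ?_⟩, ⟨?_, ?_, ?_⟩⟩
  · intro i
    fin_cases i
    · exact h.evenVec_mem _
    · exact h.evenVec_mem _
    · exact h.oddVec_mem _
    · exact h.evenVec_mem _
    · exact h.evenVec_mem _
    · exact h.oddVec_mem _
  · have := h.hasSuperdim.1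
    exact (D.linearIndependent_of_gram gram).span_eq_top_of_card_eq_finrank
      (by simp [h.finrank_eq])
  · simp [h.bracket_evenVec, hbb, evenVec_add, evenVec_smul]
  · intro i
    fin_cases i <;> simp [h.bracket_evenVec_oddVec, hb₀f, hb₁f, oddVec_smul]
  · simp [h.bracket_oddVec, hff, evenVec_add, evenVec_smul]
  · simp [h.bracket_evenVec, hcc, evenVec_add, evenVec_smul]
  · intro i
    fin_cases i <;> simp [h.bracket_evenVec_oddVec, hc₀g, hc₁g, oddVec_smul]
  · simp [h.bracket_oddVec, hgg, evenVec_add, evenVec_smul]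

/-- These come from the triples (b₁,b₂,f), (f,f,f), (b₁,f,f), (b₂,f,f); the purely even identities
are void in dimension two. -/
theorem jacobi_left (h : Frame D k l e) :
    k.bb 0 * k.bf 0 + k.bb 1 * k.bf 1 = 0 ∧ k.bf 0 * k.ff 0 + k.bf 1 * k.ff 1 = 0 ∧
    2 * k.bf 0 * k.ff 0 = k.ff 1 * k.bb 0 ∧ 2 * k.bf 0 * k.ff 1 = k.ff 1 * k.bb 1 ∧
    2 * k.bf 1 * k.ff 0 = -(k.ff 0 * k.bb 0) ∧ 2 * k.bf 1 * k.ff 1 = -(k.ff 0 * k.bb 1) := by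
  have h1 := D.jacobi 0 0 1 _ (h.mem 0) _ (h.mem 1) _ (h.mem 2)
  have h2 := D.jacobi 1 1 1 _ (h.mem 2) _ (h.mem 2) _ (h.mem 2)
  have h3 := D.jacobi 0 1 1 _ (h.mem 0) _ (h.mem 2) _ (h.mem 2)
  have h4 := D.jacobi 0 1 1 _ (h.mem 1) _ (h.mem 2) _ (h.mem 2)
  simp [h.bracket_eq, doubleBracket, Fin.sum_univ_six, koszulSign, ZMod.val_one] at h1 h2 h3 h4
  have f1 := congrArg (fun x => D.form x (e 5)) h1
  have f2 := congrArg (fun x => D.form x (e 5)) h2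
  have f3 := congrArg (fun x => D.form x (e 3)) h3
  have f3' := congrArg (fun x => D.form x (e 4)) h3
  have f4 := congrArg (fun x => D.form x (e 3)) h4
  have f4' := congrArg (fun x => D.form x (e 4)) h4
  simp [h.gram, frameGram] at f1 f2 f3 f3' f4 f4'
  refine ⟨?_, ?_, ?_, ?_, ?_, ?_⟩ <;> linarith

/-- Replacing one `f` by `f̃` in those triples couples `k` and `l`. Only the components needed for
the classification are extracted; the versions with the halves exchanged follow from `Frame.swap`.
-/
theorem jacobi_mixed (h : Frame D k l e) :
    l.ff 0 * k.bb 0 + l.ff 1 * k.bb 1 = 2 * (k.bf 0 * l.ff 1 - k.bf 1 * l.ff 0) ∧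
    l.ff 0 * k.ff 0 + l.ff 1 * k.ff 1 = 4 * (k.bf 0 * l.bf 0 + k.bf 1 * l.bf 1) ∧
    l.bf 1 * k.bb 0 = -(l.bb 0 * k.bf 1) - l.ff 0 * k.ff 0 ∧
    l.bf 1 * k.bb 1 = l.bb 0 * k.bf 0 - l.ff 0 * k.ff 1 ∧
    -(l.bf 0 * k.bb 0) = -(l.bb 1 * k.bf 1) - l.ff 1 * k.ff 0 ∧
    -(l.bf 0 * k.bb 1) = l.bb 1 * k.bf 0 - l.ff 1 * k.ff 1 := by
  have h1 := D.jacobi 0 0 1 _ (h.mem 0) _ (h.mem 1) _ (h.mem 5)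
  have h2 := D.jacobi 1 1 1 _ (h.mem 2) _ (h.mem 2) _ (h.mem 5)
  have h3 := D.jacobi 0 1 1 _ (h.mem 0) _ (h.mem 2) _ (h.mem 5)
  have h4 := D.jacobi 0 1 1 _ (h.mem 1) _ (h.mem 2) _ (h.mem 5)
  simp [h.bracket_eq, doubleBracket, Fin.sum_univ_six, koszulSign, ZMod.val_one] at h1 h2 h3 h4
  have f1 := congrArg (fun x => D.form x (e 5)) h1
  have f2 := congrArg (fun x => D.form x (e 5)) h2
  have f3 := congrArg (fun x => D.form x (e 3)) h3
  have f3' := congrArg (fun x => D.form x (e 4)) h3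
  have f4 := congrArg (fun x => D.form x (e 3)) h4
  have f4' := congrArg (fun x => D.form x (e 4)) h4
  simp [h.gram, frameGram] at f1 f2 f3 f3' f4 f4'
  refine ⟨?_, ?_, ?_, ?_, ?_, ?_⟩ <;> linarith

end Frame
end MetricLieSuperalgebra

/-! ### Existence of a frame. -/

/-- Pairing with a basis of `S` maps `T` to ℝⁿ. The map is injective by hypothesis, hence bijective
by dimension, and the preimages of the unit vectors are the dual family. -/
theorem LinearMap.BilinForm.exists_dual_families {V : Type*} [AddCommGroup V] [Module ℝ V]
    [Module.Finite ℝ V] (B : LinearMap.BilinForm ℝ V) {n : ℕ} {S T : Submodule ℝ V}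
    (hS : Module.finrank ℝ S = n) (hT : Module.finrank ℝ T = n)
    (h : ∀ y ∈ T, (∀ x ∈ S, B x y = 0) → y = 0) :
    ∃ b c : Fin n → V, (∀ i, b i ∈ S) ∧ (∀ i, c i ∈ T) ∧ Submodule.span ℝ (Set.range b) = S ∧
      Submodule.span ℝ (Set.range c) = T ∧ ∀ i j, B (b i) (c j) = if i = j then 1 else 0 := by
  let v := Module.finBasisOfFinrankEq ℝ S hS
  let Φ : T →ₗ[ℝ] (Fin n → ℝ) := LinearMap.pi fun i => (B (v i)).comp T.subtype
  have hspan : Submodule.span ℝ (Set.range fun i => (v i : V)) = S := by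
    have := congrArg (Submodule.map S.subtype) v.span_eq
    rw [Submodule.map_span, Submodule.map_top, Submodule.range_subtype, ← Set.range_comp] at this
    exact this
  have hΦ : Function.Injective Φ := by
    rw [injective_iff_map_eq_zero]
    intro y hy
    refine Subtype.ext (h y y.2 fun x hx => ?_)
    rw [← hspan] at hx
    induction hx using Submodule.span_induction with
    | mem x hx =>
      obtain ⟨i, rfl⟩ := hx
      exact congrFun hy i
    | zero => simp
    | add a b _ _ ha hb => simp [ha, hb]
    | smul c a _ ha => simp [ha]
  have hsurj : Function.Surjective Φ :=
    (LinearMap.injective_iff_surjective_of_finrank_eq_finrank (by simp [hT])).1 hΦ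
  choose c hc using fun j : Fin n => hsurj (Pi.single j 1)
  refine ⟨fun i => v i, fun i => c i, fun i => (v i).2, fun i => (c i).2, hspan, ?_, ?_⟩
  · refine le_antisymm (Submodule.span_le.2 ?_) fun y hy => ?_
    · rintro _ ⟨i, rfl⟩
      exact (c i).2
    · have : (⟨y, hy⟩ : T) = ∑ j, Φ ⟨y, hy⟩ j • c j := by
        apply hΦ
        rw [map_sum]
        simp only [map_smul, hc]
        ext i
        simp [Finset.sum_apply, Pi.single_apply]
      have hy' := congrArg Subtype.val this
      simp only [Submodule.coe_sum, Submodule.coe_smul] at hy'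
      rw [hy']
      exact Submodule.sum_mem _ fun j _ =>
        Submodule.smul_mem _ _ (Submodule.subset_span ⟨j, rfl⟩)
  · intro i j
    have := congrFun (hc j) i
    simpa [Φ, Pi.single_apply] using this

theorem LinearMap.BilinForm.finrank_le_of_separating {V : Type*} [AddCommGroup V] [Module ℝ V]
    [Module.Finite ℝ V] (B : LinearMap.BilinForm ℝ V) {S T : Submodule ℝ V}
    (h : ∀ x ∈ S, (∀ y ∈ T, B x y = 0) → x = 0) :
    Module.finrank ℝ S ≤ Module.finrank ℝ T := by
  let Φ : S →ₗ[ℝ] Module.Dual ℝ T :=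
    (LinearMap.lcomp ℝ ℝ T.subtype) ∘ₗ (LinearMap.comp (σ₁₂ := RingHom.id ℝ) B S.subtype)
  have hΦ : Function.Injective Φ := by
    rw [injective_iff_map_eq_zero]
    intro x hx
    exact Subtype.ext (h x x.2 fun y hy => LinearMap.congr_fun hx ⟨y, hy⟩)
  calc Module.finrank ℝ S ≤ Module.finrank ℝ (Module.Dual ℝ T) :=
        LinearMap.finrank_le_finrank_of_injective hΦ
    _ = _ := Subspace.dual_finrank_eq

namespace MetricLieSuperalgebra

variable {V : Type*} [AddCommGroup V] [Module ℝ V]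

namespace IsManinSupertriple

variable {D : MetricLieSuperalgebra V} {S St : Submodule ℝ V}

theorem form_comm_eq_zero (D : MetricLieSuperalgebra V) {i j : ZMod 2} {x y : V}
    (hx : x ∈ D.part i) (hy : y ∈ D.part j) (h : D.form x y = 0) : D.form y x = 0 := by
  rw [D.supersymmetric j i y hy x hx, h, mul_zero]

theorem exists_homogeneous_left (h : D.IsManinSupertriple S St) {x : V} (hx : x ∈ S) :
    ∃ y ∈ S ⊓ D.part 0, ∃ z ∈ S ⊓ D.part 1, y + z = x :=
  Submodule.mem_sup.1 (h.left_subalgebra.1 ▸ hx)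

theorem exists_homogeneous_right (h : D.IsManinSupertriple S St) {x : V} (hx : x ∈ St) :
    ∃ y ∈ St ⊓ D.part 0, ∃ z ∈ St ⊓ D.part 1, y + z = x :=
  Submodule.mem_sup.1 (h.right_subalgebra.1 ▸ hx)

theorem part_eq (h : D.IsManinSupertriple S St) (i : ZMod 2) :
    D.part i = (S ⊓ D.part i) ⊔ (St ⊓ D.part i) := by
  refine le_antisymm (fun x hx => ?_) (sup_le inf_le_right inf_le_right)
  obtain ⟨s, hs, t, ht, rfl⟩ := Submodule.mem_sup.1
    (h.isCompl.sup_eq_top ▸ Submodule.mem_top : x ∈ S ⊔ St)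
  obtain ⟨s₀, hs₀, s₁, hs₁, rfl⟩ := h.exists_homogeneous_left hs
  obtain ⟨t₀, ht₀, t₁, ht₁, rfl⟩ := h.exists_homogeneous_right ht
  fin_cases i
  · have h₁ : s₁ + t₁ ∈ D.part 1 := add_mem hs₁.2 ht₁.2
    have h₀ : s₁ + t₁ ∈ D.part 0 := by
      rw [show s₁ + t₁ = s₀ + s₁ + (t₀ + t₁) - (s₀ + t₀) by abel]
      exact sub_mem hx (add_mem hs₀.2 ht₀.2)
    have hz := D.eq_zero_of_mem_part h₀ h₁
    refine Submodule.mem_sup.2 ⟨s₀, hs₀, t₀, ht₀, ?_⟩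
    rw [add_add_add_comm, hz, add_zero]
  · have h₀ : s₀ + t₀ ∈ D.part 0 := add_mem hs₀.2 ht₀.2
    have h₁ : s₀ + t₀ ∈ D.part 1 := by
      rw [show s₀ + t₀ = s₀ + s₁ + (t₀ + t₁) - (s₁ + t₁) by abel]
      exact sub_mem hx (add_mem hs₁.2 ht₁.2)
    have hz := D.eq_zero_of_mem_part h₀ h₁
    refine Submodule.mem_sup.2 ⟨s₁, hs₁, t₁, ht₁, ?_⟩
    rw [add_add_add_comm, hz, zero_add]

theorem form_ne (h : D.IsManinSupertriple S St) {i j : ZMod 2} (hij : i ≠ j) {x y : V}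
    (hx : x ∈ S ⊓ D.part i) (hy : y ∈ St ⊓ D.part j) : D.form x y = 0 := by
  fin_cases i <;> fin_cases j
  · exact absurd rfl hij
  · exact h.even_odd x hx y hy
  · exact h.odd_even x hx y hy
  · exact absurd rfl hij

/-- Isotropy disposes of `S` and boson-fermion orthogonality of the other parity, so nondegeneracy
needs testing only on vectors of `St` of the same parity. -/
theorem form_right_eq_zero (h : D.IsManinSupertriple S St) {i : ZMod 2} {x : V}
    (hx : x ∈ S ⊓ D.part i) (H : ∀ y ∈ St ⊓ D.part i, D.form x y = 0) : x = 0 := by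
  have key : ∀ j, ∀ y ∈ St ⊓ D.part j, D.form x y = 0 := by
    intro j y hy
    by_cases hij : i = j
    · subst hij; exact H y hy
    · exact h.form_ne hij hx hy
  refine D.nondegenerate.1 x fun z => ?_
  obtain ⟨s, hs, t, ht, rfl⟩ := Submodule.mem_sup.1
    (h.isCompl.sup_eq_top ▸ Submodule.mem_top : z ∈ S ⊔ St)
  obtain ⟨t₀, ht₀, t₁, ht₁, rfl⟩ := h.exists_homogeneous_right ht
  rw [map_add, map_add, h.left_isotropic.prop x hx.1 s hs, key 0 t₀ ht₀, key 1 t₁ ht₁]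
  simp

theorem form_left_eq_zero (h : D.IsManinSupertriple S St) {i : ZMod 2} {y : V}
    (hy : y ∈ St ⊓ D.part i) (H : ∀ x ∈ S ⊓ D.part i, D.form x y = 0) : y = 0 := by
  have key : ∀ j, ∀ x ∈ S ⊓ D.part j, D.form y x = 0 := by
    intro j x hx
    refine form_comm_eq_zero D hx.2 hy.2 ?_
    by_cases hij : j = i
    · subst hij; exact H x hx
    · exact h.form_ne hij hx hy
  refine D.nondegenerate.1 y fun z => ?_
  obtain ⟨s, hs, t, ht, rfl⟩ := Submodule.mem_sup.1
    (h.isCompl.sup_eq_top ▸ Submodule.mem_top : z ∈ S ⊔ St)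
  obtain ⟨s₀, hs₀, s₁, hs₁, rfl⟩ := h.exists_homogeneous_left hs
  rw [map_add, map_add, h.right_isotropic.prop y hy.1 t ht, key 0 s₀ hs₀, key 1 s₁ hs₁]
  simp

/-- The form separates points on both sides of the pairing of the two homogeneous parts, so these
have equal dimension; they are also complementary in `D.part i`. -/
theorem two_mul_finrank (h : D.IsManinSupertriple S St) [Module.Finite ℝ V] (i : ZMod 2) :
    2 * Module.finrank ℝ (S ⊓ D.part i : Submodule ℝ V) = Module.finrank ℝ (D.part i) ∧
    2 * Module.finrank ℝ (St ⊓ D.part i : Submodule ℝ V) = Module.finrank ℝ (D.part i) := by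
  have h₁ : Module.finrank ℝ (S ⊓ D.part i : Submodule ℝ V) ≤
      Module.finrank ℝ (St ⊓ D.part i : Submodule ℝ V) :=
    D.form.finrank_le_of_separating fun x hx H => h.form_right_eq_zero hx H
  have h₂ : Module.finrank ℝ (St ⊓ D.part i : Submodule ℝ V) ≤
      Module.finrank ℝ (S ⊓ D.part i : Submodule ℝ V) :=
    D.form.finrank_le_of_separating fun x hx H => h.form_left_eq_zero hx
      fun y hy => form_comm_eq_zero D hx.2 hy.2 (H y hy)
  have h₃ := Submodule.finrank_sup_add_finrank_inf_eq (S ⊓ D.part i) (St ⊓ D.part i)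
  have h₄ : (S ⊓ D.part i) ⊓ (St ⊓ D.part i) = ⊥ :=
    (h.isCompl.disjoint.mono inf_le_left inf_le_left).eq_bot
  rw [← h.part_eq, h₄, finrank_bot] at h₃
  omega

theorem exists_coeff {b : Fin 2 → V} {f : V} {S : Submodule ℝ V}
    (hS : D.IsSubalgebra S) (hbS : Submodule.span ℝ (Set.range b) = S ⊓ D.part 0)
    (hfS : Submodule.span ℝ {f} = S ⊓ D.part 1) : ∃ k, D.HasBrackets b f k := by
  have hb : ∀ i, b i ∈ S ⊓ D.part 0 := fun i => hbS ▸ Submodule.subset_span ⟨i, rfl⟩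
  have hf : f ∈ S ⊓ D.part 1 := hfS ▸ Submodule.subset_span rfl
  have h₁ : D.bracket (b 0) (b 1) ∈ S ⊓ D.part 0 :=
    ⟨hS.2 _ (hb 0).1 _ (hb 1).1, D.bracket_mem 0 0 _ (hb 0).2 _ (hb 1).2⟩
  have h₂ : ∀ i, D.bracket (b i) f ∈ S ⊓ D.part 1 := fun i =>
    ⟨hS.2 _ (hb i).1 _ hf.1, D.bracket_mem 0 1 _ (hb i).2 _ hf.2⟩
  have h₃ : D.bracket f f ∈ S ⊓ D.part 0 :=
    ⟨hS.2 _ hf.1 _ hf.1, D.bracket_mem 1 1 _ hf.2 _ hf.2⟩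
  rw [← hbS, Submodule.mem_span_range_iff_exists_fun] at h₁ h₃
  rw [← hfS] at h₂
  simp only [Submodule.mem_span_singleton] at h₂
  obtain ⟨β, hβ⟩ := h₁
  obtain ⟨φ, hφ⟩ := h₃
  choose ρ hρ using h₂
  exact ⟨⟨β, ρ, φ⟩, hβ.symm, fun i => (hρ i).symm, hφ.symm⟩

theorem span_triple_eq {b : Fin 2 → V} {f : V} {S : Submodule ℝ V}
    (hS : D.IsSubalgebra S) (hbS : Submodule.span ℝ (Set.range b) = S ⊓ D.part 0)
    (hfS : Submodule.span ℝ {f} = S ⊓ D.part 1) : Submodule.span ℝ {b 0, b 1, f} = S := by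
  rw [hS.1, ← hbS, ← hfS, ← Submodule.span_union]
  congr 1
  ext x
  simp only [Set.mem_insert_iff, Set.mem_singleton_iff, Set.mem_union, Set.mem_range,
    Fin.exists_fin_two, eq_comm, or_assoc]

/-- Every Manin supertriple of superdimension `(4,2)` has a frame. -/
theorem exists_frame (h : D.IsManinSupertriple S St) (hdim : D.HasSuperdim 4 2) :
    ∃ k l e, Frame D k l e ∧ leftSpan e = S ∧ rightSpan e = St := by
  obtain ⟨hfin, h0, h1⟩ := hdim
  have d0 := h.two_mul_finrank 0
  have d1 := h.two_mul_finrank 1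
  obtain ⟨b, bt, hb, hbt, hbS, hbtS, hbb⟩ := D.form.exists_dual_families (n := 2)
    (by omega) (by omega) fun y hy H => h.form_left_eq_zero (i := 0) hy H
  obtain ⟨f, ft, hf, hft, hfS, hftS, hff⟩ := D.form.exists_dual_families (n := 1)
    (by omega) (by omega) fun y hy H => h.form_left_eq_zero (i := 1) hy H
  have hr : ∀ v : Fin 1 → V, Set.range v = {v 0} := fun v => by ext; simp [eq_comm]
  rw [hr] at hfS hftS
  have symm : ∀ {i j : ZMod 2} {x y : V}, x ∈ D.part i → y ∈ D.part j → D.form x y = 0 →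
      D.form y x = 0 := fun hx hy hxy => form_comm_eq_zero D hx hy hxy
  obtain ⟨k, hk⟩ := exists_coeff h.left_subalgebra hbS hfS
  obtain ⟨l, hl⟩ := exists_coeff h.right_subalgebra hbtS hftS
  have hD : D.IsDualBasis S St b (f 0) bt (ft 0) :=
    { b_mem := fun i => (hb i).2
      f_mem := (hf 0).2
      bt_mem := fun i => (hbt i).2
      ft_mem := (hft 0).2
      span_left := span_triple_eq h.left_subalgebra hbS hfS
      span_right := span_triple_eq h.right_subalgebra hbtS hftS
      b_bt := hbb
      bt_b := fun i j => by
        rw [D.supersymmetric 0 0 _ (hbt j).2 _ (hb i).2, hbb]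
        simp [koszulSign]
      f_ft := by simpa using hff 0 0
      ft_f := by
        rw [D.supersymmetric 1 1 _ (hft 0).2 _ (hf 0).2, hff]
        simp [koszulSign, ZMod.val_one]
      b_ft := fun i => h.even_odd _ (hb i) _ (hft 0)
      ft_b := fun i => symm (hb i).2 (hft 0).2 (h.even_odd _ (hb i) _ (hft 0))
      f_bt := fun i => h.odd_even _ (hf 0) _ (hbt i)
      bt_f := fun i => symm (hf 0).2 (hbt i).2 (h.odd_even _ (hf 0) _ (hbt i)) }
  exact ⟨k, l, _, hD.frame h hk hl, hD.span_left, hD.span_right⟩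

end IsManinSupertriple

end MetricLieSuperalgebra

/-! ### Base changes preserving a decomposition. -/

/-- A change of homogeneous bases `b₁' = a b₁ + b b₂`, `b₂' = c b₁ + d b₂`, `f' = u f`, together
with the corresponding change (with dashes) of the dual basis. -/
structure BaseChange where
  (a b c d u a' b' c' d' u' : ℝ)
  aa : a * a' + b * b' = 1
  ac : a * c' + b * d' = 0
  ca : c * a' + d * b' = 0
  cc : c * c' + d * d' = 1
  uu : u * u' = 1

namespace BaseChange

/-- The same change of bases with the roles of the two dual bases exchanged. -/
def dual (P : BaseChange) : BaseChange where
  a := P.a'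
  b := P.b'
  c := P.c'
  d := P.d'
  u := P.u'
  a' := P.a
  b' := P.b
  c' := P.c
  d' := P.d
  u' := P.u
  aa := by linarith [P.aa]
  ac := by linarith [P.ca]
  ca := by linarith [P.ac]
  cc := by linarith [P.cc]
  uu := by linarith [P.uu]

/-- The determinant of the even block. -/
def det (P : BaseChange) : ℝ := P.a * P.d - P.b * P.c

theorem det_mul_det_dual (P : BaseChange) : P.det * P.dual.det = 1 := by
  simp only [det, dual]
  linear_combination (P.c * P.c' + P.d * P.d') * P.aa - (P.c * P.a' + P.d * P.b') * P.ac + P.cc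

theorem det_ne_zero (P : BaseChange) : P.det ≠ 0 :=
  left_ne_zero_of_mul_eq_one P.det_mul_det_dual

theorem u_ne_zero (P : BaseChange) : P.u ≠ 0 := left_ne_zero_of_mul_eq_one P.uu

/-- The fields say M M'ᵀ = 1 for the even block M and its dashed partner M'; here M'ᵀ M = 1. The
intermediate identities are Cramer's rule. -/
theorem transpose (P : BaseChange) :
    P.a * P.a' + P.c * P.c' = 1 ∧ P.a * P.b' + P.c * P.d' = 0 ∧
    P.b * P.a' + P.d * P.c' = 0 ∧ P.b * P.b' + P.d * P.d' = 1 := by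
  have h := P.det_ne_zero
  have ha : P.det * P.a' = P.d := by rw [det]; linear_combination P.d * P.aa - P.b * P.ca
  have hb : P.det * P.b' = -P.c := by rw [det]; linear_combination P.a * P.ca - P.c * P.aa
  have hc : P.det * P.c' = -P.b := by rw [det]; linear_combination P.d * P.ac - P.b * P.cc
  have hd : P.det * P.d' = P.a := by rw [det]; linear_combination P.a * P.cc - P.c * P.ac
  have hdet : P.det = P.a * P.d - P.b * P.c := rfl
  refine ⟨?_, ?_, ?_, ?_⟩ <;> apply mul_left_cancel₀ h
  · linear_combination P.a * ha + P.c * hc - hdet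
  · linear_combination P.a * hb + P.c * hd
  · linear_combination P.b * ha + P.d * hc
  · linear_combination P.b * hb + P.d * hd - hdet

/-- The bracket coefficients in the new basis. -/
def apply (P : BaseChange) (k : Brackets21) : Brackets21 :=
  ⟨![P.det * (k.bb 0 * P.a' + k.bb 1 * P.b'), P.det * (k.bb 0 * P.c' + k.bb 1 * P.d')],
    ![P.a * k.bf 0 + P.b * k.bf 1, P.c * k.bf 0 + P.d * k.bf 1],
    ![P.u ^ 2 * (k.ff 0 * P.a' + k.ff 1 * P.b'), P.u ^ 2 * (k.ff 0 * P.c' + k.ff 1 * P.d')]⟩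

/-- The change of bases that is upper triangular with first entry `1`. -/
noncomputable def shear (x y u : ℝ) (hy : y ≠ 0) (hu : u ≠ 0) : BaseChange where
  a := 1
  b := x
  c := 0
  d := y
  u := u
  a' := 1
  b' := 0
  c' := -x / y
  d' := 1 / y
  u' := 1 / u
  aa := by ring
  ac := by field_simp; ring
  ca := by ring
  cc := by field_simp; ring
  uu := by field_simp

end BaseChange

namespace Brackets21

theorem ext_six {k k' : Brackets21} (h₁ : k.bb 0 = k'.bb 0) (h₂ : k.bb 1 = k'.bb 1)
    (h₃ : k.bf 0 = k'.bf 0) (h₄ : k.bf 1 = k'.bf 1) (h₅ : k.ff 0 = k'.ff 0)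
    (h₆ : k.ff 1 = k'.ff 1) : k = k' := by
  have h : ∀ f g : Fin 2 → ℝ, f 0 = g 0 → f 1 = g 1 → f = g := fun f g h h' => by
    ext i; fin_cases i <;> assumption
  cases k
  cases k'
  congr
  · exact h _ _ h₁ h₂
  · exact h _ _ h₃ h₄
  · exact h _ _ h₅ h₆

end Brackets21

namespace MetricLieSuperalgebra

variable {V : Type*} [AddCommGroup V] [Module ℝ V]

/-- The decomposition `(D, S, St)` has a frame with brackets `k` and `l`. -/
def HasFrame (D : MetricLieSuperalgebra V) (S St : Submodule ℝ V) (k l : Brackets21) : Prop :=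
  ∃ e, Frame D k l e ∧ leftSpan e = S ∧ rightSpan e = St

theorem HasFrame.swap {D : MetricLieSuperalgebra V} {S St : Submodule ℝ V} {k l : Brackets21}
    (h : D.HasFrame S St k l) : D.HasFrame St S l k := by
  obtain ⟨e, he, rfl, rfl⟩ := h
  exact ⟨_, he.swap, Frame.leftSpan_swap e, Frame.rightSpan_swap e⟩

namespace Frame

variable {D : MetricLieSuperalgebra V} {k l : Brackets21} {e : Fin 6 → V}

theorem finrank_leftSpan (h : Frame D k l e) : Module.finrank ℝ (leftSpan e) = 3 := by
  have := h.finrank_span_image {0, 1, 2}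
  rwa [Finset.coe_insert, Finset.coe_insert, Finset.coe_singleton, ← leftSpan_eq_image] at this

theorem finrank_rightSpan (h : Frame D k l e) : Module.finrank ℝ (rightSpan e) = 3 := by
  rw [← leftSpan_swap, h.swap.finrank_leftSpan]

theorem hasFrame_change (h : Frame D k l e) (P : BaseChange) :
    D.HasFrame (leftSpan e) (rightSpan e) (P.apply k) (P.dual.apply l) := by
  have t := P.transpose
  have huu := P.uu
  have haa := P.aa
  have hac := P.ac
  have hca := P.ca
  have hcc := P.cc
  obtain ⟨t1, t2, t3, t4⟩ := t
  have main := h.of_coords (k' := P.apply k) (l' := P.dual.apply l)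
    ![![P.a, P.b, 0, 0], ![P.c, P.d, 0, 0], ![0, 0, P.a', P.b'], ![0, 0, P.c', P.d']]
    ![![P.u, 0], ![0, P.u']] ?_ ?_ ?_ ?_ ?_ ?_ ?_ ?_ ?_ ?_
  · refine ⟨_, main, ?_, ?_⟩
    · have := h.hasSuperdim.1
      -- The new vectors lie in the old half, and both spans have dimension three.
      refine Submodule.eq_of_le_of_finrank_eq (Submodule.span_le.2 ?_)
        (by rw [main.finrank_leftSpan, h.finrank_leftSpan])
      rintro x (rfl | rfl | rfl)
      · exact mem_leftSpan.2 ⟨P.a, P.b, 0, by simp [evenVec]⟩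
      · exact mem_leftSpan.2 ⟨P.c, P.d, 0, by simp [evenVec]⟩
      · exact mem_leftSpan.2 ⟨0, 0, P.u, by simp [oddVec]⟩
    · have := h.hasSuperdim.1
      refine Submodule.eq_of_le_of_finrank_eq (Submodule.span_le.2 ?_)
        (by rw [main.finrank_rightSpan, h.finrank_rightSpan])
      rintro x (rfl | rfl | rfl)
      · exact mem_rightSpan.2 ⟨P.a', P.b', 0, by simp [evenVec]⟩
      · exact mem_rightSpan.2 ⟨P.c', P.d', 0, by simp [evenVec]⟩
      · exact mem_rightSpan.2 ⟨0, 0, P.u', by simp [oddVec]⟩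
  · intro i j
    fin_cases i <;> fin_cases j <;> simp [evenForm] <;> linarith
  · simpa [oddForm] using huu
  · ext i
    fin_cases i <;> simp [evenBracket, BaseChange.apply, BaseChange.det]
    · linear_combination (P.a * P.d - P.b * P.c) * (-k.bb 0 * t1 - k.bb 1 * t2)
    · linear_combination (P.a * P.d - P.b * P.c) * (-k.bb 0 * t3 - k.bb 1 * t4)
  · ext i
    fin_cases i <;> simp [evenOddBracket, BaseChange.apply, -mul_eq_mul_right_iff] <;> ring
  · ext i
    fin_cases i <;> simp [evenOddBracket, BaseChange.apply, -mul_eq_mul_right_iff] <;> ring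
  · ext i
    fin_cases i <;> simp [oddBracket, BaseChange.apply]
    · linear_combination P.u ^ 2 * (-k.ff 0 * t1 - k.ff 1 * t2)
    · linear_combination P.u ^ 2 * (-k.ff 0 * t3 - k.ff 1 * t4)
  · ext i
    fin_cases i <;> simp [evenBracket, BaseChange.apply, BaseChange.det, BaseChange.dual]
    · linear_combination (P.a' * P.d' - P.b' * P.c') * (-l.bb 0 * t1 - l.bb 1 * t3)
    · linear_combination (P.a' * P.d' - P.b' * P.c') * (-l.bb 0 * t2 - l.bb 1 * t4)
  · ext i
    fin_cases i <;> simp [evenOddBracket, BaseChange.apply, BaseChange.dual] <;> ring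
  · ext i
    fin_cases i <;> simp [evenOddBracket, BaseChange.apply, BaseChange.dual] <;> ring
  · ext i
    fin_cases i <;> simp [oddBracket, BaseChange.apply, BaseChange.dual]
    · linear_combination P.u' ^ 2 * (-l.ff 0 * t1 - l.ff 1 * t3)
    · linear_combination P.u' ^ 2 * (-l.ff 0 * t2 - l.ff 1 * t4)

end Frame

theorem HasFrame.change {D : MetricLieSuperalgebra V} {S St : Submodule ℝ V} {k l : Brackets21}
    (h : D.HasFrame S St k l) (P : BaseChange) :
    D.HasFrame S St (P.apply k) (P.dual.apply l) := by
  obtain ⟨e, he, rfl, rfl⟩ := h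
  exact he.hasFrame_change P

/-- Two frames of the same decomposition are related by a change of bases. -/
theorem HasFrame.exists_baseChange {D : MetricLieSuperalgebra V} {S St : Submodule ℝ V}
    {k l k' l' : Brackets21} (h : D.HasFrame S St k l) (h' : D.HasFrame S St k' l') :
    ∃ P : BaseChange, k' = P.apply k ∧ l' = P.dual.apply l := by
  obtain ⟨e, he, rfl, rfl⟩ := h
  obtain ⟨e', he', hl, hr⟩ := h'
  have l0 : e' 0 ∈ leftSpan e := hl ▸ Submodule.subset_span (by simp)
  have l1 : e' 1 ∈ leftSpan e := hl ▸ Submodule.subset_span (by simp)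
  have l2 : e' 2 ∈ leftSpan e := hl ▸ Submodule.subset_span (by simp)
  have r0 : e' 3 ∈ rightSpan e := hr ▸ Submodule.subset_span (by simp)
  have r1 : e' 4 ∈ rightSpan e := hr ▸ Submodule.subset_span (by simp)
  have r2 : e' 5 ∈ rightSpan e := hr ▸ Submodule.subset_span (by simp)
  rw [mem_leftSpan] at l0 l1 l2
  rw [mem_rightSpan] at r0 r1 r2
  obtain ⟨a, b, a₀, h0⟩ := l0
  obtain ⟨c, d, c₀, h1⟩ := l1
  obtain ⟨u₀, u₁, u, h2⟩ := l2
  obtain ⟨a', b', a₀', h3⟩ := r0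
  obtain ⟨c', d', c₀', h4⟩ := r1
  obtain ⟨u₀', u₁', u', h5⟩ := r2
  -- A homogeneous vector has no component of the other parity: pairing with the vector dual to that
  -- component shows that its coefficient vanishes.
  have z0 := he.form_even_odd (he'.mem 0) (he.mem 5)
  have z1 := he.form_even_odd (he'.mem 1) (he.mem 5)
  have z2 := he.form_odd_even (he'.mem 2) (he.mem 3)
  have z2' := he.form_odd_even (he'.mem 2) (he.mem 4)
  have z3 := he.form_even_odd (he'.mem 3) (he.mem 2)
  have z4 := he.form_even_odd (he'.mem 4) (he.mem 2)
  have z5 := he.form_odd_even (he'.mem 5) (he.mem 0)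
  have z5' := he.form_odd_even (he'.mem 5) (he.mem 1)
  rw [h0] at z0
  rw [h1] at z1
  rw [h2] at z2 z2'
  rw [h3] at z3
  rw [h4] at z4
  rw [h5] at z5 z5'
  simp [he.gram, frameGram] at z0 z1 z2 z2' z3 z4 z5 z5'
  subst z0 z1 z2 z2' z3 z4 z5 z5'
  -- These five pairings are the five relations in `BaseChange`.
  have g03 := he'.gram 0 3
  have g04 := he'.gram 0 4
  have g13 := he'.gram 1 3
  have g14 := he'.gram 1 4
  have g25 := he'.gram 2 5
  rw [h0, h3] at g03
  rw [h0, h4] at g04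
  rw [h1, h3] at g13
  rw [h1, h4] at g14
  rw [h2, h5] at g25
  simp [he.gram, frameGram] at g03 g04 g13 g14 g25
  let P : BaseChange := ⟨a, b, c, d, u, a', b', c', d', u', by linarith, by linarith,
    by linarith, by linarith, by linarith⟩
  obtain ⟨⟨k1, k2, k3, k4⟩, l1, l2, l3, l4⟩ := he'.brackets_half
  refine ⟨P, Brackets21.ext_six ?_ ?_ ?_ ?_ ?_ ?_, Brackets21.ext_six ?_ ?_ ?_ ?_ ?_ ?_⟩
  -- Each coefficient is read off by pairing the bracket in the new frame with the vector dual to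
  -- the one it multiplies.
  · have := congrArg (fun x => D.form x (e' 3)) k1
    simp only [map_add, map_smul, LinearMap.add_apply, LinearMap.smul_apply, he'.gram] at this
    rw [h0, h1, h3] at this
    simp [he.bracket_eq, he.gram, doubleBracket, frameGram, Fin.sum_univ_six] at this
    simp [BaseChange.apply, P, BaseChange.det]
    linarith
  · have := congrArg (fun x => D.form x (e' 4)) k1
    simp only [map_add, map_smul, LinearMap.add_apply, LinearMap.smul_apply, he'.gram] at this
    rw [h0, h1, h4] at this
    simp [he.bracket_eq, he.gram, doubleBracket, frameGram, Fin.sum_univ_six] at this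
    simp [BaseChange.apply, P, BaseChange.det]
    linarith
  · have := congrArg (fun x => D.form x (e' 5)) k2
    simp only [map_add, map_smul, LinearMap.add_apply, LinearMap.smul_apply, he'.gram] at this
    rw [h0, h2, h5] at this
    simp [he.bracket_eq, he.gram, doubleBracket, frameGram, Fin.sum_univ_six] at this
    simp [BaseChange.apply, P]
    linear_combination -this + (a * k.bf 0 + b * k.bf 1) * g25
  · have := congrArg (fun x => D.form x (e' 5)) k3
    simp only [map_add, map_smul, LinearMap.add_apply, LinearMap.smul_apply, he'.gram] at this
    rw [h1, h2, h5] at this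
    simp [he.bracket_eq, he.gram, doubleBracket, frameGram, Fin.sum_univ_six] at this
    simp [BaseChange.apply, P]
    linear_combination -this + (c * k.bf 0 + d * k.bf 1) * g25
  · have := congrArg (fun x => D.form x (e' 3)) k4
    simp only [map_add, map_smul, LinearMap.add_apply, LinearMap.smul_apply, he'.gram] at this
    rw [h2, h3] at this
    simp [he.bracket_eq, he.gram, doubleBracket, frameGram, Fin.sum_univ_six] at this
    simp [BaseChange.apply, P]
    linarith
  · have := congrArg (fun x => D.form x (e' 4)) k4
    simp only [map_add, map_smul, LinearMap.add_apply, LinearMap.smul_apply, he'.gram] at this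
    rw [h2, h4] at this
    simp [he.bracket_eq, he.gram, doubleBracket, frameGram, Fin.sum_univ_six] at this
    simp [BaseChange.apply, P]
    linarith
  · have := congrArg (fun x => D.form x (e' 0)) l1
    simp only [map_add, map_smul, LinearMap.add_apply, LinearMap.smul_apply, he'.gram] at this
    rw [h0, h3, h4] at this
    simp [he.bracket_eq, he.gram, doubleBracket, frameGram, Fin.sum_univ_six] at this
    simp [BaseChange.apply, P, BaseChange.det, BaseChange.dual]
    linarith
  · have := congrArg (fun x => D.form x (e' 1)) l1
    simp only [map_add, map_smul, LinearMap.add_apply, LinearMap.smul_apply, he'.gram] at this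
    rw [h1, h3, h4] at this
    simp [he.bracket_eq, he.gram, doubleBracket, frameGram, Fin.sum_univ_six] at this
    simp [BaseChange.apply, P, BaseChange.det, BaseChange.dual]
    linarith
  · have := congrArg (fun x => D.form x (e' 2)) l2
    simp only [map_add, map_smul, LinearMap.add_apply, LinearMap.smul_apply, he'.gram] at this
    rw [h2, h3, h5] at this
    simp [he.bracket_eq, he.gram, doubleBracket, frameGram, Fin.sum_univ_six] at this
    simp [BaseChange.apply, P, BaseChange.dual]
    linear_combination this + (a' * l.bf 0 + b' * l.bf 1) * g25
  · have := congrArg (fun x => D.form x (e' 2)) l3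
    simp only [map_add, map_smul, LinearMap.add_apply, LinearMap.smul_apply, he'.gram] at this
    rw [h2, h4, h5] at this
    simp [he.bracket_eq, he.gram, doubleBracket, frameGram, Fin.sum_univ_six] at this
    simp [BaseChange.apply, P, BaseChange.dual]
    linear_combination this + (c' * l.bf 0 + d' * l.bf 1) * g25
  · have := congrArg (fun x => D.form x (e' 0)) l4
    simp only [map_add, map_smul, LinearMap.add_apply, LinearMap.smul_apply, he'.gram] at this
    rw [h0, h5] at this
    simp [he.bracket_eq, he.gram, doubleBracket, frameGram, Fin.sum_univ_six] at this
    simp [BaseChange.apply, P, BaseChange.dual]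
    linarith
  · have := congrArg (fun x => D.form x (e' 1)) l4
    simp only [map_add, map_smul, LinearMap.add_apply, LinearMap.smul_apply, he'.gram] at this
    rw [h1, h5] at this
    simp [he.bracket_eq, he.gram, doubleBracket, frameGram, Fin.sum_univ_six] at this
    simp [BaseChange.apply, P, BaseChange.dual]
    linarith

end MetricLieSuperalgebra

/-! ### Normal forms of Manin supertriples. -/

/-- The signs ε of the list originate here: some coefficients can only be rescaled by squares. -/
theorem exists_unit_mul_sq {r : ℝ} (hr : r ≠ 0) :
    ∃ (ε : ℤˣ) (u : ℝ), u ≠ 0 ∧ r = ((ε : ℤ) : ℝ) * u ^ 2 := by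
  rcases lt_or_gt_of_ne hr with h | h
  · refine ⟨-1, √(-r), (Real.sqrt_pos.2 (by linarith)).ne', ?_⟩
    rw [Real.sq_sqrt (by linarith)]; simp
  · refine ⟨1, √r, (Real.sqrt_pos.2 h).ne', ?_⟩
    rw [Real.sq_sqrt h.le]; simp

theorem unit_sq_real (ε : ℤˣ) : ((ε : ℤ) : ℝ) ^ 2 = 1 := by
  rcases Int.units_eq_one_or ε with rfl | rfl <;> simp

namespace MetricLieSuperalgebra

variable {V : Type*} [AddCommGroup V] [Module ℝ V]

theorem HasFrame.isOfType {D : MetricLieSuperalgebra V} {S St : Submodule ℝ V}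
    {k l : Brackets21} (h : D.HasFrame S St k l) {t : TripleType} (hk : k = t.left)
    (hl : l = t.right) : D.IsOfType t S St := by
  subst hk hl
  exact isOfType_iff.2 h

namespace HasFrame

variable {D : MetricLieSuperalgebra V} {S St : Submodule ℝ V} {k l : Brackets21}

theorem jacobi (h : D.HasFrame S St k l) :
    (k.bb 0 * k.bf 0 + k.bb 1 * k.bf 1 = 0 ∧ k.bf 0 * k.ff 0 + k.bf 1 * k.ff 1 = 0 ∧
      2 * k.bf 0 * k.ff 0 = k.ff 1 * k.bb 0 ∧ 2 * k.bf 0 * k.ff 1 = k.ff 1 * k.bb 1 ∧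
      2 * k.bf 1 * k.ff 0 = -(k.ff 0 * k.bb 0) ∧ 2 * k.bf 1 * k.ff 1 = -(k.ff 0 * k.bb 1)) ∧
    (l.ff 0 * k.bb 0 + l.ff 1 * k.bb 1 = 2 * (k.bf 0 * l.ff 1 - k.bf 1 * l.ff 0) ∧
      l.ff 0 * k.ff 0 + l.ff 1 * k.ff 1 = 4 * (k.bf 0 * l.bf 0 + k.bf 1 * l.bf 1) ∧
      l.bf 1 * k.bb 0 = -(l.bb 0 * k.bf 1) - l.ff 0 * k.ff 0 ∧
      l.bf 1 * k.bb 1 = l.bb 0 * k.bf 0 - l.ff 0 * k.ff 1 ∧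
      -(l.bf 0 * k.bb 0) = -(l.bb 1 * k.bf 1) - l.ff 1 * k.ff 0 ∧
      -(l.bf 0 * k.bb 1) = l.bb 1 * k.bf 0 - l.ff 1 * k.ff 1) := by
  obtain ⟨e, he, -⟩ := h
  exact ⟨he.jacobi_left, he.jacobi_mixed⟩

/-- Change of bases by a shear if `[b₁, b₂] = b₂`. -/
theorem shear {β₀ β₁ ρ₀ ρ₁ φ₀ φ₁ p q : ℝ}
    (h : D.HasFrame S St ⟨![0, 1], ![p, 0], ![0, q]⟩ ⟨![β₀, β₁], ![ρ₀, ρ₁], ![φ₀, φ₁]⟩)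
    (x y u : ℝ) (hy : y ≠ 0) (hu : u ≠ 0) :
    D.HasFrame S St ⟨![0, 1], ![p, 0], ![0, u ^ 2 * q / y]⟩
      ⟨![(β₀ + x * β₁) / y, β₁], ![ρ₀, (ρ₁ - x * ρ₀) / y],
        ![(φ₀ + x * φ₁) / u ^ 2, y * φ₁ / u ^ 2]⟩ := by
  have := h.change (BaseChange.shear x y u hy hu)
  convert this using 1
  · apply Brackets21.ext_six <;>
      simp [BaseChange.shear, BaseChange.apply, BaseChange.det] <;> field_simp
  · apply Brackets21.ext_six <;>
      simp [BaseChange.shear, BaseChange.apply, BaseChange.det, BaseChange.dual] <;>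
      field_simp <;> ring

/-- Take `[b₁, b₂]` as new `b₂` and choose `b₁` so that the change has determinant 1, which leaves
the commutator unchanged. The Jacobi identities then remove the action of `b₂` on `f` and the `b₁`
component of `[f, f]`. -/
theorem normalize_bb (h : D.HasFrame S St k l) (hk : k.bb 0 ≠ 0 ∨ k.bb 1 ≠ 0) :
    ∃ p q β₀ β₁ ρ₀ ρ₁ φ₀ φ₁ : ℝ, (q = 0 ∨ q = 1) ∧
      D.HasFrame S St ⟨![0, 1], ![p, 0], ![0, q]⟩ ⟨![β₀, β₁], ![ρ₀, ρ₁], ![φ₀, φ₁]⟩ := by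
  have hn : k.bb 0 ^ 2 + k.bb 1 ^ 2 ≠ 0 := by
    rcases hk with hk | hk <;> positivity
  let P : BaseChange :=
    { a := k.bb 1 / (k.bb 0 ^ 2 + k.bb 1 ^ 2)
      b := -k.bb 0 / (k.bb 0 ^ 2 + k.bb 1 ^ 2)
      c := k.bb 0
      d := k.bb 1
      u := 1
      a' := k.bb 1
      b' := -k.bb 0
      c' := k.bb 0 / (k.bb 0 ^ 2 + k.bb 1 ^ 2)
      d' := k.bb 1 / (k.bb 0 ^ 2 + k.bb 1 ^ 2)
      u' := 1
      aa := by field_simp; ring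
      ac := by field_simp; ring
      ca := by ring
      cc := by field_simp
      uu := by ring }
  have h' := h.change P
  set k' := P.apply k with hk'
  set l' := P.dual.apply l
  have hb0 : k'.bb 0 = 0 := by
    simp [hk', BaseChange.apply, P]
    exact Or.inr (by ring)
  have hb1 : k'.bb 1 = 1 := by
    simp [hk', BaseChange.apply, P, BaseChange.det]
    field_simp
    ring
  obtain ⟨⟨j1, j2, j3, j4, j5, j6⟩, -⟩ := h'.jacobi
  rw [hb0, hb1] at j1
  rw [hb1] at j6
  have hρ : k'.bf 1 = 0 := by linarith
  have hφ : k'.ff 0 = 0 := by rw [hρ] at j6; linarith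
  have hke : k' = ⟨![0, 1], ![k'.bf 0, 0], ![0, k'.ff 1]⟩ := by
    apply Brackets21.ext_six <;> simp [hb0, hb1, hρ, hφ]
  have hle : l' = ⟨![l'.bb 0, l'.bb 1], ![l'.bf 0, l'.bf 1], ![l'.ff 0, l'.ff 1]⟩ := by
    apply Brackets21.ext_six <;> simp
  rw [hke, hle] at h'
  by_cases hq : k'.ff 1 = 0
  · rw [hq] at h'
    exact ⟨_, _, _, _, _, _, _, _, Or.inl rfl, h'⟩
  -- Rescaling `b₂` by the coefficient of `[f, f]` turns that coefficient into 1.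
  · have := h'.shear 0 (k'.ff 1) 1 hq one_ne_zero
    rw [one_pow, one_mul, div_self hq] at this
    exact ⟨_, _, _, _, _, _, _, _, Or.inr rfl, this⟩

/-- Jacobi forces p = 1/2, ρ₀ = β₁/2, φ₁ = β₁ and ρ₁ = β₀/2 - φ₀, and moreover φ₀ is 0 or β₀ when β₁
= 0. Keeping [f,f] = b₂ requires y = u² in a shear, so β₀ is only scaled by positive factors. -/
theorem classify_F {p β₀ β₁ ρ₀ ρ₁ φ₀ φ₁ : ℝ}
    (h : D.HasFrame S St ⟨![0, 1], ![p, 0], ![0, 1]⟩ ⟨![β₀, β₁], ![ρ₀, ρ₁], ![φ₀, φ₁]⟩) :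
    ∃ t, D.IsOfType t S St := by
  obtain ⟨⟨-, -, -, j4, -⟩, m1, m2, m3, m4, m5, m6⟩ := h.jacobi
  obtain ⟨⟨i1, i2, i3, i4, i5, i6⟩, n1, -⟩ := h.swap.jacobi
  simp at j4 m1 m2 m3 m4 m5 m6 i1 i2 i3 i4 i5 i6 n1
  obtain rfl : p = 1 / 2 := by linarith
  obtain rfl : ρ₀ = β₁ / 2 := by linarith
  obtain rfl : φ₁ = β₁ := by linarith
  obtain rfl : ρ₁ = β₀ / 2 - φ₀ := by linarith
  by_cases hβ : φ₁ = 0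
  · subst hβ
    rcases eq_or_ne φ₀ 0 with rfl | hφ
    · by_cases hβ₀ : β₀ = 0
      · subst hβ₀
        exact ⟨.F_A, h.isOfType (by simp [TripleType.left, Brackets21.F])
          (by simp [TripleType.right, Brackets21.A])⟩
      · obtain ⟨ε, u, hu, rfl⟩ := exists_unit_mul_sq hβ₀
        have := h.shear 0 (u ^ 2) u (pow_ne_zero 2 hu) hu
        refine ⟨.F_C ε, this.isOfType ?_ ?_⟩ <;> apply Brackets21.ext_six <;>
          simp [TripleType.left, TripleType.right, Brackets21.F, hu]
        field_simp
    · have hβ₀ : φ₀ = β₀ := mul_left_cancel₀ hφ (by linarith)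
      subst hβ₀
      obtain ⟨ε, u, hu, rfl⟩ := exists_unit_mul_sq hφ
      have := h.shear 0 (u ^ 2) u (pow_ne_zero 2 hu) hu
      refine ⟨.F_Fi ε, this.isOfType ?_ ?_⟩ <;> apply Brackets21.ext_six <;>
        simp [TripleType.left, TripleType.right, Brackets21.F, hu]
      field_simp
      norm_num
  · have hφ₀ : φ₀ = β₀ := mul_left_cancel₀ hβ (by linarith)
    subst hφ₀
    -- [b̃¹,b̃²] and [f̃,f̃] now have the same coefficients, so one shear clears the first component
    -- of both; the second survives as κ.
    have := h.shear (-φ₀ / φ₁) 1 1 one_ne_zero one_ne_zero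
    refine ⟨.F_Fii φ₁ hβ, this.isOfType ?_ ?_⟩ <;> apply Brackets21.ext_six <;>
      simp [TripleType.left, TripleType.right, Brackets21.F] <;> field_simp <;> ring

/-- Jacobi gives ρ₀ = -pβ₁, ρ₁ = pβ₀ and φ₁ = 2pφ₁. For β₁ ≠ 0 it forces p = 0 and no odd square in
the second half, leaving κ = β₁. For β₁ = 0 the cases follow the vanishing of β₀, φ₀ and φ₁. Only
one branch leads to the dual of a listed supertriple. -/
theorem classify_C {p β₀ β₁ ρ₀ ρ₁ φ₀ φ₁ : ℝ}
    (h : D.HasFrame S St ⟨![0, 1], ![p, 0], ![0, 0]⟩ ⟨![β₀, β₁], ![ρ₀, ρ₁], ![φ₀, φ₁]⟩) :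
    ∃ t, D.IsOfType t S St ∨ D.IsOfType t St S := by
  obtain ⟨-, m1, m2, m3, m4, m5, m6⟩ := h.jacobi
  obtain ⟨⟨i1, i2, i3, i4, i5, i6⟩, n1, -⟩ := h.swap.jacobi
  simp at m1 m2 m3 m4 m5 m6 i1 i2 i3 i4 i5 i6 n1
  obtain rfl : ρ₀ = -(β₁ * p) := by linarith
  subst m4
  by_cases hβ₁ : β₁ = 0
  · subst hβ₁
    by_cases hβ₀ : β₀ = 0
    · subst hβ₀
      by_cases hφ₁ : φ₁ = 0
      · subst hφ₁
        by_cases hφ₀ : φ₀ = 0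
        · subst hφ₀
          refine ⟨.C_A p, Or.inl (h.isOfType ?_ ?_)⟩ <;> apply Brackets21.ext_six <;>
            simp [TripleType.left, TripleType.right, Brackets21.C, Brackets21.A]
        · obtain ⟨ε, u, hu, rfl⟩ := exists_unit_mul_sq hφ₀
          have := h.shear 0 1 u one_ne_zero hu
          refine ⟨.C_N p ε, Or.inl (this.isOfType ?_ ?_)⟩ <;> apply Brackets21.ext_six <;>
            simp [TripleType.left, TripleType.right, Brackets21.C]
          field_simp
      · obtain rfl : p = 1 / 2 := by
          have : φ₁ * (2 * p - 1) = 0 := by linarith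
          rcases mul_eq_zero.1 this with h | h
          · exact absurd h hφ₁
          · linarith
        have := h.shear (-φ₀ / φ₁) (1 / φ₁) 1 (one_div_ne_zero hφ₁) one_ne_zero
        refine ⟨.Chalf_N, Or.inl (this.isOfType ?_ ?_)⟩ <;> apply Brackets21.ext_six <;>
          simp [TripleType.left, TripleType.right, Brackets21.C] <;> try field_simp
        ring
    · by_cases hφ₀ : φ₀ = 0
      · subst hφ₀
        obtain rfl : φ₁ = 0 := by
          by_contra hφ₁
          have hp : p = 0 := by simpa [hβ₀, hφ₁] using i2
          rw [hp] at m1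
          exact hφ₁ (by linarith)
        have := h.shear 0 β₀ 1 hβ₀ one_ne_zero
        refine ⟨.C_C p, Or.inl (this.isOfType ?_ ?_)⟩ <;> apply Brackets21.ext_six <;>
          simp [TripleType.left, TripleType.right, Brackets21.C, hβ₀]
      · obtain rfl : p = -1 / 2 := by
          have : β₀ * φ₀ * (2 * p + 1) = 0 := by linarith
          rcases mul_eq_zero.1 this with h | h
          · exact absurd h (mul_ne_zero hβ₀ hφ₀)
          · linarith
        obtain rfl : φ₁ = 0 := by linarith
        obtain ⟨ε, u, hu, rfl⟩ := exists_unit_mul_sq hφ₀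
        have hε := unit_sq_real ε
        have hε0 : ((ε : ℤ) : ℝ) ≠ 0 := by
          intro h0; rw [h0] at hε; norm_num at hε
        -- Here the second half is of type F, with -b̃²/β₀ as `b₁`, ε b̃¹ as `b₂` and f̃/u as `f`,
        -- so the listed supertriple is the dual one.
        let P : BaseChange :=
          { a := 0
            b := -1 / β₀
            c := (ε : ℤ)
            d := 0
            u := 1 / u
            a' := 0
            b' := -β₀
            c' := (ε : ℤ)
            d' := 0
            u' := u
            aa := by field_simp; ring
            ac := by ring
            ca := by ring
            cc := by linear_combination hε
            uu := by field_simp }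
        have := h.swap.change P
        refine ⟨.F_C (-ε), Or.inr (this.isOfType ?_ ?_)⟩ <;> apply Brackets21.ext_six <;>
          simp [TripleType.left, TripleType.right, Brackets21.F, BaseChange.apply,
            BaseChange.dual, BaseChange.det, P] <;> field_simp <;> linarith
  · have hp : p = 0 := by
      simpa [hβ₁] using m2
    subst hp
    have hφ₁ : φ₁ = 0 := by linarith
    have hφ₀ : φ₀ = 0 := by
      have : φ₀ * β₁ = 0 := by linarith
      simpa [hβ₁] using this
    subst hφ₁ hφ₀
    have := h.shear (-β₀ / β₁) 1 1 one_ne_zero one_ne_zero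
    refine ⟨.C0_C0 β₁ hβ₁, Or.inl (this.isOfType ?_ ?_)⟩ <;> apply Brackets21.ext_six <;>
      simp [TripleType.left, TripleType.right, Brackets21.C] <;> field_simp
    ring

/-- Choose the even basis so that `b₁` acts on `f` by 1 and `b₂` by 0. Jacobi then leaves at most
the action of b̃² on f̃ and the b̃¹ component of [f̃,f̃], whose product is zero: hence three
families. -/
theorem classify_S (h : D.HasFrame S St k l) (hk : k.bb = 0) (hl : l.bb = 0)
    (hρ : k.bf 0 ≠ 0 ∨ k.bf 1 ≠ 0) : ∃ t, D.IsOfType t S St := by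
  have hn : k.bf 0 ^ 2 + k.bf 1 ^ 2 ≠ 0 := by
    rcases hρ with hk | hk <;> positivity
  let P : BaseChange :=
    { a := k.bf 0 / (k.bf 0 ^ 2 + k.bf 1 ^ 2)
      b := k.bf 1 / (k.bf 0 ^ 2 + k.bf 1 ^ 2)
      c := -k.bf 1
      d := k.bf 0
      u := 1
      a' := k.bf 0
      b' := k.bf 1
      c' := -k.bf 1 / (k.bf 0 ^ 2 + k.bf 1 ^ 2)
      d' := k.bf 0 / (k.bf 0 ^ 2 + k.bf 1 ^ 2)
      u' := 1
      aa := by field_simp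
      ac := by field_simp; ring
      ca := by ring
      cc := by field_simp; ring
      uu := by ring }
  have h' := h.change P
  set k' := P.apply k with hk'
  set l' := P.dual.apply l with hl'
  have hb0 : k'.bb 0 = 0 := by simp [hk', BaseChange.apply, hk]
  have hb1 : k'.bb 1 = 0 := by simp [hk', BaseChange.apply, hk]
  have hc0 : l'.bb 0 = 0 := by simp [hl', BaseChange.apply, hl]
  have hc1 : l'.bb 1 = 0 := by simp [hl', BaseChange.apply, hl]
  have hρ0 : k'.bf 0 = 1 := by simp [hk', BaseChange.apply, P]; field_simp
  have hρ1 : k'.bf 1 = 0 := by simp [hk', BaseChange.apply, P]; ring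
  obtain ⟨⟨-, -, j3, j4, -⟩, m1, m2, -⟩ := h'.jacobi
  obtain ⟨⟨-, -, i3, i4, i5, i6⟩, -⟩ := h'.swap.jacobi
  simp only [hb0, hb1, hc0, hc1, hρ0, hρ1] at j3 j4 m1 m2 i3 i4 i5 i6
  have hφ0 : k'.ff 0 = 0 := by linarith
  have hφ1 : k'.ff 1 = 0 := by linarith
  rw [hφ0, hφ1] at m2
  have hψ1 : l'.ff 1 = 0 := by linarith
  have hσ0 : l'.bf 0 = 0 := by linarith
  by_cases hσ1 : l'.bf 1 = 0
  · by_cases hψ0 : l'.ff 0 = 0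
    · refine ⟨.S_A, h'.isOfType ?_ ?_⟩ <;> apply Brackets21.ext_six <;>
        simp [TripleType.left, TripleType.right, Brackets21.S, Brackets21.A, hb0, hb1, hc0, hc1,
          hρ0, hρ1,
          hφ0, hφ1, hψ1, hσ0, hσ1, hψ0]
    · obtain ⟨ε, u, hu, he⟩ := exists_unit_mul_sq hψ0
      have := h'.change (.shear 0 1 u one_ne_zero hu)
      refine ⟨.S_N ε, this.isOfType ?_ ?_⟩ <;> apply Brackets21.ext_six <;>
        simp [TripleType.left, TripleType.right, Brackets21.S, BaseChange.apply,
          BaseChange.shear, BaseChange.dual, hb0, hb1, hc0, hc1, hρ0, hρ1, hφ0, hφ1, hψ1, hσ0,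
          hσ1, he]
      field_simp
  · have hψ0 : l'.ff 0 = 0 := by
      have : l'.bf 1 * l'.ff 0 = 0 := by linarith
      simpa [hσ1] using this
    have := h'.change (.shear 0 (l'.bf 1) 1 hσ1 one_ne_zero)
    refine ⟨.S_S, this.isOfType ?_ ?_⟩ <;> apply Brackets21.ext_six <;>
      simp [TripleType.left, TripleType.right, Brackets21.S, BaseChange.apply,
        BaseChange.shear, BaseChange.dual, hb0, hb1, hc0, hc1, hρ0, hρ1, hφ0, hφ1, hψ1, hσ0,
        hσ1, hψ0]

/-- The mixed identities reduce to the vanishing of all products of an entry of `k.ff` with an entry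
of `l.ff`, so only one half has an odd square. -/
theorem classify_N (h : D.HasFrame S St k l) (hk : k.bb = 0) (hl : l.bb = 0) (hρ : k.bf = 0)
    (hσ : l.bf = 0) (hφ : k.ff 0 ≠ 0 ∨ k.ff 1 ≠ 0) : ∃ t, D.IsOfType t S St := by
  have hn : k.ff 0 ^ 2 + k.ff 1 ^ 2 ≠ 0 := by
    rcases hφ with hk | hk <;> positivity
  let P : BaseChange :=
    { a := k.ff 0
      b := k.ff 1
      c := -k.ff 1 / (k.ff 0 ^ 2 + k.ff 1 ^ 2)
      d := k.ff 0 / (k.ff 0 ^ 2 + k.ff 1 ^ 2)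
      u := 1
      a' := k.ff 0 / (k.ff 0 ^ 2 + k.ff 1 ^ 2)
      b' := k.ff 1 / (k.ff 0 ^ 2 + k.ff 1 ^ 2)
      c' := -k.ff 1
      d' := k.ff 0
      u' := 1
      aa := by field_simp
      ac := by ring
      ca := by field_simp; ring
      cc := by field_simp; ring
      uu := by ring }
  obtain ⟨-, -, -, m3, m4, m5, m6⟩ := h.jacobi
  simp [hk, hl, hρ, hσ] at m3 m4 m5 m6
  have hψ0 : l.ff 0 = 0 := by
    rcases hφ with hφ | hφ
    · simpa [hφ] using m3
    · simpa [hφ] using m4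
  have hψ1 : l.ff 1 = 0 := by
    rcases hφ with hφ | hφ
    · simpa [hφ] using m5
    · simpa [hφ] using m6
  have := h.change P
  refine ⟨.N_A, this.isOfType ?_ ?_⟩ <;> apply Brackets21.ext_six <;>
    simp [TripleType.left, TripleType.right, Brackets21.N, Brackets21.A, BaseChange.apply,
      BaseChange.dual, P, hk, hl, hρ, hσ, hψ0, hψ1] <;> field_simp
  ring

theorem classify (h : D.HasFrame S St k l) :
    ∃ t, D.IsOfType t S St ∨ D.IsOfType t St S := by
  have dich : ∀ v : Fin 2 → ℝ, v = 0 ∨ v 0 ≠ 0 ∨ v 1 ≠ 0 := by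
    intro v
    by_contra! H
    exact H.1 (by ext i; fin_cases i; exacts [H.2.1, H.2.2])
  have aux : ∀ {S St : Submodule ℝ V} {k l : Brackets21}, D.HasFrame S St k l →
      k.bb 0 ≠ 0 ∨ k.bb 1 ≠ 0 → ∃ t, D.IsOfType t S St ∨ D.IsOfType t St S := by
    intro S St k l h hk
    obtain ⟨p, q, β₀, β₁, ρ₀, ρ₁, φ₀, φ₁, rfl | rfl, h'⟩ := h.normalize_bb hk
    · exact h'.classify_C
    · obtain ⟨t, ht⟩ := h'.classify_F
      exact ⟨t, Or.inl ht⟩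
  rcases dich k.bb with hk | hk
  · rcases dich l.bb with hl | hl
    · rcases dich k.bf with hρ | hρ
      · rcases dich l.bf with hσ | hσ
        · rcases dich k.ff with hφ | hφ
          · rcases dich l.ff with hψ | hψ
            · refine ⟨.A_A, Or.inl (h.isOfType ?_ ?_)⟩ <;> apply Brackets21.ext_six <;>
                simp [TripleType.left, TripleType.right, Brackets21.A, *]
            · obtain ⟨t, ht⟩ := h.swap.classify_N hl hk hσ hρ hψ
              exact ⟨t, Or.inr ht⟩
          · obtain ⟨t, ht⟩ := h.classify_N hk hl hρ hσ hφ
            exact ⟨t, Or.inl ht⟩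
        · obtain ⟨t, ht⟩ := h.swap.classify_S hl hk hσ
          exact ⟨t, Or.inr ht⟩
      · obtain ⟨t, ht⟩ := h.classify_S hk hl hρ
        exact ⟨t, Or.inl ht⟩
    · obtain ⟨t, ht⟩ := aux h.swap hl
      exact ⟨t, ht.symm⟩
  · exact aux h hk

end HasFrame

/-- Every Manin supertriple of superdimension `(4,2)` is, up to duality, in the list. -/
theorem IsManinSupertriple.classify {D : MetricLieSuperalgebra V} {S St : Submodule ℝ V}
    (h : D.IsManinSupertriple S St) (hdim : D.HasSuperdim 4 2) :
    ∃ t, D.IsOfType t S St ∨ D.IsOfType t St S := by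
  obtain ⟨k, l, h⟩ := h.exists_frame hdim
  exact HasFrame.classify h

end MetricLieSuperalgebra

/-! ### Different decompositions of the same double. -/

namespace MetricLieSuperalgebra

variable {V : Type*} [AddCommGroup V] [Module ℝ V]

/-- `D` has a decomposition isomorphic to the listed supertriple `t`. -/
def HasType (D : MetricLieSuperalgebra V) (t : TripleType) : Prop :=
  ∃ e, Frame D t.left t.right e

theorem hasType_iff {D : MetricLieSuperalgebra V} {t : TripleType} :
    D.HasType t ↔ ∃ S St, D.IsOfType t S St := by
  simp only [isOfType_iff]
  exact ⟨fun ⟨e, he⟩ => ⟨_, _, e, he, rfl, rfl⟩, fun ⟨_, _, e, he, _⟩ => ⟨e, he⟩⟩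

namespace Frame

variable {D : MetricLieSuperalgebra V} {k l : Brackets21} {e : Fin 6 → V}

/-- Two frames of `D` with the same brackets up to a rewriting of the coefficients. -/
theorem exists_of_eq {k' l' : Brackets21} (h : ∃ e, Frame D k l e) (hk : k = k') (hl : l = l') :
    ∃ e, Frame D k' l' e := hk ▸ hl ▸ h

/-- The twist `f̃ ↦ f̃ + c f`. -/
theorem twist_odd {s p r : ℝ}
    (h : Frame D ⟨![0, s], ![p, 0], ![0, 0]⟩ ⟨![0, 0], ![0, 0], ![r, 0]⟩ e) (c : ℝ) :
    ∃ e', Frame D ⟨![0, s], ![p, 0], ![0, 0]⟩ ⟨![0, 0], ![0, 0], ![r + 2 * p * c, 0]⟩ e' := by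
  -- As [f,f] = 0 and [f,f̃] = p b̃¹, the odd square of f̃ + c f is [f̃,f̃] + 2pc b̃¹.
  refine ⟨_, h.of_coords ![![1, 0, 0, 0], ![0, 1, 0, 0], ![0, 0, 1, 0], ![0, 0, 0, 1]]
    ![![1, 0], ![c, 1]] ?_ ?_ ?_ ?_ ?_ ?_ ?_ ?_ ?_ ?_⟩
  · intro i j; fin_cases i <;> fin_cases j <;> simp [evenForm]
  · simp [oddForm]
  all_goals
    ext i
    fin_cases i <;> simp [evenBracket, evenOddBracket, oddBracket]
  ring

/-- The twist `b̃¹ ↦ b̃¹ + c b₂`, `b̃² ↦ b̃² - c b₁`. -/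
theorem twist_even {s p q r : ℝ}
    (h : Frame D ⟨![0, s], ![p, 0], ![0, q]⟩ ⟨![s * r, 0], ![0, p * r], ![0, 0]⟩ e) (c : ℝ) :
    ∃ e', Frame D ⟨![0, s], ![p, 0], ![0, q]⟩
      ⟨![s * (r + c), 0], ![0, p * (r + c)], ![0, 0]⟩ e' := by
  -- The opposite signs of `c` keep the new complement isotropic.
  refine ⟨_, h.of_coords ![![1, 0, 0, 0], ![0, 1, 0, 0], ![0, c, 1, 0], ![-c, 0, 0, 1]]
    ![![1, 0], ![0, 1]] ?_ ?_ ?_ ?_ ?_ ?_ ?_ ?_ ?_ ?_⟩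
  · intro i j; fin_cases i <;> fin_cases j <;> simp [evenForm]
  · simp [oddForm]
  all_goals
    ext i
    fin_cases i <;> simp [evenBracket, evenOddBracket, oddBracket] <;> ring

/-- The combined twist `b̃¹ ↦ b̃¹ + c b₂`, `b̃² ↦ b̃² - c b₁`, `f̃ ↦ f̃ + c f`. -/
theorem twist_F {r : ℝ}
    (h : Frame D ⟨![0, 1], ![1 / 2, 0], ![0, 1]⟩ ⟨![r, 0], ![0, -r / 2], ![r, 0]⟩ e) (c : ℝ) :
    ∃ e', Frame D ⟨![0, 1], ![1 / 2, 0], ![0, 1]⟩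
      ⟨![r + c, 0], ![0, -(r + c) / 2], ![r + c, 0]⟩ e' := by
  -- The odd square of f̃ + c f is (r + c)(b̃¹ + c b₂), so the even shift must use the same `c`.
  refine ⟨_, h.of_coords ![![1, 0, 0, 0], ![0, 1, 0, 0], ![0, c, 1, 0], ![-c, 0, 0, 1]]
    ![![1, 0], ![c, 1]] ?_ ?_ ?_ ?_ ?_ ?_ ?_ ?_ ?_ ?_⟩
  · intro i j; fin_cases i <;> fin_cases j <;> simp [evenForm]
  · simp [oddForm]
  all_goals
    ext i
    fin_cases i <;> simp [evenBracket, evenOddBracket, oddBracket] <;> ring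

/-- The exchange of `f` and `f̃`. -/
theorem exchange_odd {s p : ℝ}
    (h : Frame D ⟨![0, s], ![p, 0], ![0, 0]⟩ ⟨![0, 0], ![0, 0], ![0, 0]⟩ e) :
    ∃ e', Frame D ⟨![0, s], ![-p, 0], ![0, 0]⟩ ⟨![0, 0], ![0, 0], ![0, 0]⟩ e' := by
  refine ⟨_, h.of_coords ![![1, 0, 0, 0], ![0, 1, 0, 0], ![0, 0, 1, 0], ![0, 0, 0, 1]]
    ![![0, 1], ![-1, 0]] ?_ ?_ ?_ ?_ ?_ ?_ ?_ ?_ ?_ ?_⟩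
  · intro i j; fin_cases i <;> fin_cases j <;> simp [evenForm]
  · simp [oddForm]
  all_goals
    ext i
    fin_cases i <;> simp [evenBracket, evenOddBracket, oddBracket]

/-- The reflection `b₁ ↦ -b₁`, `b₂ ↔ b̃²`. -/
theorem reflect_even {r : ℝ}
    (h : Frame D ⟨![0, 1], ![0, 0], ![0, 0]⟩ ⟨![0, 0], ![0, 0], ![r, 0]⟩ e) :
    ∃ e', Frame D ⟨![0, 1], ![0, 0], ![0, 0]⟩ ⟨![0, 0], ![0, 0], ![-r, 0]⟩ e' := by
  refine ⟨_, h.of_coords ![![-1, 0, 0, 0], ![0, 0, 0, 1], ![0, 0, -1, 0], ![0, 1, 0, 0]]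
    ![![1, 0], ![0, 1]] ?_ ?_ ?_ ?_ ?_ ?_ ?_ ?_ ?_ ?_⟩
  · intro i j; fin_cases i <;> fin_cases j <;> simp [evenForm]
  · simp [oddForm]
  all_goals
    ext i
    fin_cases i <;> simp [evenBracket, evenOddBracket, oddBracket]

/-- The reflection `b₁ ↦ -b₁`, `b₂ ↔ b̃²`, `f ↔ f̃`. -/
theorem reflect {q r : ℝ}
    (h : Frame D ⟨![0, 1], ![1 / 2, 0], ![0, q]⟩ ⟨![0, 0], ![0, 0], ![0, r]⟩ e) :
    ∃ e', Frame D ⟨![0, 1], ![1 / 2, 0], ![0, r]⟩ ⟨![0, 0], ![0, 0], ![0, q]⟩ e' := by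
  refine ⟨_, h.of_coords ![![-1, 0, 0, 0], ![0, 0, 0, 1], ![0, 0, -1, 0], ![0, 1, 0, 0]]
    ![![0, 1], ![-1, 0]] ?_ ?_ ?_ ?_ ?_ ?_ ?_ ?_ ?_ ?_⟩
  · intro i j; fin_cases i <;> fin_cases j <;> simp [evenForm]
  · simp [oddForm]
  all_goals
    ext i
    fin_cases i <;> simp [evenBracket, evenOddBracket, oddBracket]

end Frame

namespace HasType

variable {D : MetricLieSuperalgebra V}

open TripleType Brackets21

theorem S_A_iff_S_N (ε : ℤˣ) : D.HasType S_A ↔ D.HasType (S_N ε) := by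
  constructor
  · rintro ⟨e, h⟩
    refine Frame.exists_of_eq (Frame.twist_odd (s := 0) (p := 1) (r := 0) h (((ε : ℤ) : ℝ) / 2))
      rfl ?_
    simp only [right, zero_add]
    congr 3
    ring
  · rintro ⟨e, h⟩
    refine Frame.exists_of_eq (Frame.twist_odd (s := 0) (p := 1) h (-((ε : ℤ) : ℝ) / 2))
      rfl ?_
    simp only [right, A]
    congr 3
    ring

/-- The twist changes the odd square of f̃ by 2pc, which reaches every value because p ≠ 0. For p =
0 it does nothing, and (C₀|N^ε) forms a class of its own. -/
theorem C_A_iff_C_N {p : ℝ} (hp : p ≠ 0) (ε : ℤˣ) :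
    D.HasType (C_A p) ↔ D.HasType (C_N p ε) := by
  constructor
  · rintro ⟨e, h⟩
    refine Frame.exists_of_eq (Frame.twist_odd (s := 1) (r := 0) h (((ε : ℤ) : ℝ) / (2 * p)))
      rfl ?_
    simp only [right, zero_add]
    congr 3
    field_simp
  · rintro ⟨e, h⟩
    refine Frame.exists_of_eq (Frame.twist_odd (s := 1) h (-((ε : ℤ) : ℝ) / (2 * p)))
      rfl ?_
    simp only [right, A]
    congr 3
    field_simp
    ring

theorem S_A_iff_S_S : D.HasType S_A ↔ D.HasType S_S := by
  constructor
  · rintro ⟨e, h⟩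
    exact Frame.exists_of_eq (Frame.twist_even (s := 0) (p := 1) (q := 0) (r := 0) (e := e)
      (by simpa [left, right, S, A] using h) 1) rfl (by simp [right])
  · rintro ⟨e, h⟩
    exact Frame.exists_of_eq (Frame.twist_even (s := 0) (p := 1) (q := 0) (r := 1) (e := e)
      (by simpa [left, right, S] using h) (-1)) rfl (by simp [right, A])

theorem C_A_iff_C_C (p : ℝ) : D.HasType (C_A p) ↔ D.HasType (C_C p) := by
  constructor
  · rintro ⟨e, h⟩
    exact Frame.exists_of_eq (Frame.twist_even (s := 1) (p := p) (q := 0) (r := 0) (e := e)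
      (by simpa [left, right, C, A] using h) 1) rfl (by simp [right])
  · rintro ⟨e, h⟩
    exact Frame.exists_of_eq (Frame.twist_even (s := 1) (p := p) (q := 0) (r := 1) (e := e)
      (by simpa [left, right, C] using h) (-1)) rfl (by simp [right, A])

/-- `b₁` acts on the odd plane with eigenvalues p and -p; exchanging f and f̃ interchanges them. -/
theorem C_A_neg {p : ℝ} (h : D.HasType (C_A p)) : D.HasType (C_A (-p)) := by
  obtain ⟨e, h⟩ := h
  exact Frame.exchange_odd (s := 1) h

theorem C_A_neg_iff (p : ℝ) : D.HasType (C_A p) ↔ D.HasType (C_A (-p)) :=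
  ⟨C_A_neg, fun h => by simpa using C_A_neg h⟩

/-- The reflection reverses b̃¹ and fixes f̃, hence it reverses the sign of the coefficient of
[f̃,f̃]. -/
theorem C_N_zero_iff : D.HasType (C_N 0 1) ↔ D.HasType (C_N 0 (-1)) := by
  constructor
  · rintro ⟨e, h⟩
    exact Frame.exists_of_eq (Frame.reflect_even h) rfl (by simp [right])
  · rintro ⟨e, h⟩
    exact Frame.exists_of_eq (Frame.reflect_even h) rfl (by simp [right])

/-- Under ad b₁ the vectors b₂, f have eigenvalues 1, 1/2 and b̃², f̃ the opposite ones. Replacing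
b₁ by -b₁ exchanges the two pairs, and [f,f] = b₂ turns into [f̃,f̃] = b̃². -/
theorem F_A_iff_Chalf_N : D.HasType F_A ↔ D.HasType Chalf_N :=
  ⟨fun ⟨_, h⟩ => Frame.reflect h, fun ⟨_, h⟩ => Frame.reflect h⟩

theorem F_A_iff_F_C (ε : ℤˣ) : D.HasType F_A ↔ D.HasType (F_C ε) := by
  constructor
  · rintro ⟨e, h⟩
    exact Frame.exists_of_eq (Frame.twist_even (s := 1) (p := 1 / 2) (q := 1) (r := 0) (e := e)
      (by simpa [left, right, F, A] using h) (ε : ℤ)) rfl (by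
        simp only [right]
        apply Brackets21.ext_six <;> simp
        ring)
  · rintro ⟨e, h⟩
    have hr : (F_C ε).right = ⟨![1 * ((ε : ℤ) : ℝ), 0], ![0, 1 / 2 * ((ε : ℤ) : ℝ)], ![0, 0]⟩ := by
      apply Brackets21.ext_six <;> simp [right]
      ring
    refine Frame.exists_of_eq (Frame.twist_even (s := 1) (p := 1 / 2) (q := 1)
      (r := (ε : ℤ)) (e := e) (hr ▸ h) (-(ε : ℤ))) rfl ?_
    · simp only [right]
      apply Brackets21.ext_six <;> simp [A]

theorem F_A_iff_F_Fi (ε : ℤˣ) : D.HasType F_A ↔ D.HasType (F_Fi ε) := by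
  constructor
  · rintro ⟨e, h⟩
    exact Frame.exists_of_eq (Frame.twist_F (r := 0) (e := e)
      (by simpa [left, right, F, A] using h) (ε : ℤ)) rfl (by simp [right])
  · rintro ⟨e, h⟩
    exact Frame.exists_of_eq (Frame.twist_F h (-(ε : ℤ))) rfl (by simp [right, A])

end HasType

end MetricLieSuperalgebra

/-! ### Representatives of the classes. -/

namespace DoubleClass

open TripleType

/-- A representative of the supertriples listed in a class. -/
def rep : DoubleClass → TripleType
  | I => A_A
  | II => N_A
  | III => S_A
  | IV0 => C_A 0
  | IV κ hκ => C0_C0 κ hκ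
  | V => C_N 0 1
  | VI p _ => C_A p
  | VII => F_A
  | VIII κ hκ => F_Fii κ hκ

theorem rep_mem (c : DoubleClass) : c.rep ∈ c.triples := by
  cases c <;> simp [rep, triples]

end DoubleClass

namespace MetricLieSuperalgebra

variable {V : Type*} [AddCommGroup V] [Module ℝ V] {D : MetricLieSuperalgebra V}

theorem hasType_rep_iff {c : DoubleClass} {t : TripleType} (ht : t ∈ c.triples) :
    D.HasType c.rep ↔ D.HasType t := by
  cases c with
  | I => obtain rfl := ht; rfl
  | II => obtain rfl := ht; rfl
  | III =>
    rcases ht with rfl | rfl | rfl | rfl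
    · rfl
    · exact HasType.S_A_iff_S_N _
    · exact HasType.S_A_iff_S_N _
    · exact HasType.S_A_iff_S_S
  | IV0 =>
    rcases ht with rfl | rfl
    · rfl
    · exact HasType.C_A_iff_C_C 0
  | IV κ hκ => obtain rfl := ht; rfl
  | V =>
    rcases ht with rfl | rfl
    · rfl
    · exact HasType.C_N_zero_iff
  | VI p hp =>
    have hn := HasType.C_A_neg_iff (D := D) p
    rcases ht with rfl | rfl | rfl | rfl | rfl | rfl | rfl
    · rfl
    · exact hn
    · exact HasType.C_A_iff_C_N hp.ne' _
    · exact HasType.C_A_iff_C_N hp.ne' _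
    · exact hn.trans (HasType.C_A_iff_C_N (neg_ne_zero.2 hp.ne') _)
    · exact hn.trans (HasType.C_A_iff_C_N (neg_ne_zero.2 hp.ne') _)
    · exact HasType.C_A_iff_C_C p
  | VII =>
    rcases ht with rfl | rfl | rfl | rfl | rfl | rfl
    · rfl
    · exact HasType.F_A_iff_Chalf_N
    · exact HasType.F_A_iff_F_Fi _
    · exact HasType.F_A_iff_F_Fi _
    · exact HasType.F_A_iff_F_C _
    · exact HasType.F_A_iff_F_C _
  | VIII κ hκ => obtain rfl := ht; rfl

theorem belongsTo_iff {c : DoubleClass} : D.BelongsTo c ↔ D.HasType c.rep := by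
  constructor
  · rintro ⟨t, ht, h⟩
    exact (hasType_rep_iff ht).2 (hasType_iff.2 h)
  · intro h
    exact ⟨c.rep, c.rep_mem, hasType_iff.1 h⟩

theorem BelongsTo.hasType {c : DoubleClass} (h : D.BelongsTo c) {t : TripleType}
    (ht : t ∈ c.triples) : D.HasType t :=
  (hasType_rep_iff ht).1 (belongsTo_iff.1 h)

/-- In `(C¹_p|C¹_{-p})` and `(F|F.i,ε)` the dual is a listed supertriple with other parameters,
so that every decomposition is, up to duality, listed in a class. -/
theorem IsOfType.exists_class {t : TripleType} {S St : Submodule ℝ V} (h : D.IsOfType t S St) :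
    ∃ c : DoubleClass, ∃ t' ∈ c.triples, D.IsOfType t' S St ∨ D.IsOfType t' St S := by
  have sign : ∀ ε : ℤˣ, ε = 1 ∨ ε = -1 := Int.units_eq_one_or
  cases t with
  | A_A => exact ⟨.I, _, rfl, Or.inl h⟩
  | N_A => exact ⟨.II, _, rfl, Or.inl h⟩
  | S_A => exact ⟨.III, _, by simp [DoubleClass.triples], Or.inl h⟩
  | S_N ε =>
    refine ⟨.III, _, ?_, Or.inl h⟩
    rcases sign ε with rfl | rfl <;> simp [DoubleClass.triples]
  | S_S => exact ⟨.III, _, by simp [DoubleClass.triples], Or.inl h⟩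
  | C_A p =>
    rcases lt_trichotomy p 0 with hp | rfl | hp
    · exact ⟨.VI (-p) (by linarith), _, by simp [DoubleClass.triples], Or.inl h⟩
    · exact ⟨.IV0, _, by simp [DoubleClass.triples], Or.inl h⟩
    · exact ⟨.VI p hp, _, by simp [DoubleClass.triples], Or.inl h⟩
  | C_N p ε =>
    rcases lt_trichotomy p 0 with hp | rfl | hp
    · refine ⟨.VI (-p) (by linarith), _, ?_, Or.inl h⟩
      rcases sign ε with rfl | rfl <;> simp [DoubleClass.triples]
    · refine ⟨.V, _, ?_, Or.inl h⟩
      rcases sign ε with rfl | rfl <;> simp [DoubleClass.triples]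
    · refine ⟨.VI p hp, _, ?_, Or.inl h⟩
      rcases sign ε with rfl | rfl <;> simp [DoubleClass.triples]
  | C_C p =>
    rcases lt_trichotomy p 0 with hp | rfl | hp
    · refine ⟨.VI (-p) (by linarith), .C_C (-p), by simp [DoubleClass.triples], Or.inr ?_⟩
      obtain ⟨e, he⟩ := isOfType_iff.1 h
      have hf : D.HasFrame S St _ _ := ⟨e, he⟩
      -- For negative p the dual is listed: with -b̃² and -b̃¹ as `b₁` and `b₂`, the swapped
      -- supertriple has the normal form with parameter -p.
      let P : BaseChange :=
        { a := 0
          b := -1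
          c := -1
          d := 0
          u := 1
          a' := 0
          b' := -1
          c' := -1
          d' := 0
          u' := 1
          aa := by norm_num
          ac := by norm_num
          ca := by norm_num
          cc := by norm_num
          uu := by norm_num }
      refine (hf.swap.change P).isOfType ?_ ?_ <;> apply Brackets21.ext_six <;>
        simp [TripleType.left, TripleType.right, Brackets21.C, BaseChange.apply,
          BaseChange.dual, BaseChange.det, P]
    · exact ⟨.IV0, _, by simp [DoubleClass.triples], Or.inl h⟩
    · exact ⟨.VI p hp, _, by simp [DoubleClass.triples], Or.inl h⟩
  | Chalf_N => exact ⟨.VII, _, by simp [DoubleClass.triples], Or.inl h⟩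
  | C0_C0 κ hκ => exact ⟨.IV κ hκ, _, rfl, Or.inl h⟩
  | F_A => exact ⟨.VII, _, by simp [DoubleClass.triples], Or.inl h⟩
  | F_C ε =>
    refine ⟨.VII, _, ?_, Or.inl h⟩
    rcases sign ε with rfl | rfl <;> simp [DoubleClass.triples]
  | F_Fi ε =>
    refine ⟨.VII, _, ?_, Or.inl h⟩
    rcases sign ε with rfl | rfl <;> simp [DoubleClass.triples]
  | F_Fii κ hκ => exact ⟨.VIII κ hκ, _, rfl, Or.inl h⟩

end MetricLieSuperalgebra

/-! ### Dimensions of the commutants. -/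

namespace LieSuperalgebra

variable {V : Type*} [AddCommGroup V] [Module ℝ V]

theorem commutant_zero_eq_span (L : LieSuperalgebra V) {v : Fin 6 → V}
    (hv : Submodule.span ℝ (Set.range v) = ⊤) :
    L.commutant 0 = Submodule.span ℝ (v '' ((Finset.univ : Finset (Fin 6)) : Set (Fin 6))) := by
  rw [Finset.coe_univ, Set.image_univ, hv]
  rfl

/-- `hzero` keeps all brackets inside the span of `t`, and `hne` produces every vector of `t` as a
multiple of a single bracket. Commutants are thus read off the bracket table, provided the basis is
adapted to them. -/
theorem commutant_succ_eq_span (L : LieSuperalgebra V) {v : Fin 6 → V}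
    {T : Fin 6 → Fin 6 → Fin 6 → ℝ} (hT : ∀ i j, L.bracket (v i) (v j) = ∑ m, T i j m • v m)
    {n : ℕ} {s t : Finset (Fin 6)} (hs : L.commutant n = Submodule.span ℝ (v '' s))
    (hzero : ∀ i ∈ s, ∀ j ∈ s, ∀ m, m ∉ t → T i j m = 0)
    (hne : ∀ m ∈ t, ∃ i ∈ s, ∃ j ∈ s, ∃ c : ℝ, c ≠ 0 ∧ L.bracket (v i) (v j) = c • v m) :
    L.commutant (n + 1) = Submodule.span ℝ (v '' t) := by
  have hmem : ∀ i ∈ s, ∀ j ∈ s, L.bracket (v i) (v j) ∈ Submodule.span ℝ (v '' t) := by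
    intro i hi j hj
    rw [hT]
    refine Submodule.sum_mem _ fun m _ => ?_
    by_cases hm : m ∈ t
    · exact Submodule.smul_mem _ _ (Submodule.subset_span ⟨m, hm, rfl⟩)
    · rw [hzero i hi j hj m hm, zero_smul]
      exact Submodule.zero_mem _
  apply le_antisymm
  · rw [commutant, Submodule.span_le]
    rintro _ ⟨x, hx, y, hy, rfl⟩
    rw [hs] at hx hy
    refine Submodule.span_induction₂ (p := fun x y _ _ => L.bracket x y ∈ Submodule.span ℝ (v '' t))
      ?_ ?_ ?_ ?_ ?_ ?_ ?_ hx hy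
    · rintro _ _ ⟨i, hi, rfl⟩ ⟨j, hj, rfl⟩
      exact hmem i hi j hj
    · intro y _
      simp
    · intro x _
      simp
    · intro x y z _ _ _ h₁ h₂
      rw [map_add, LinearMap.add_apply]
      exact add_mem h₁ h₂
    · intro x y z _ _ _ h₁ h₂
      rw [map_add]
      exact add_mem h₁ h₂
    · intro r x y _ _ h
      rw [map_smul, LinearMap.smul_apply]
      exact Submodule.smul_mem _ _ h
    · intro r x y _ _ h
      rw [map_smul]
      exact Submodule.smul_mem _ _ h
  · rw [Submodule.span_le]
    rintro _ ⟨m, hm, rfl⟩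
    obtain ⟨i, hi, j, hj, c, hc, h⟩ := hne m hm
    have : v m = c⁻¹ • L.bracket (v i) (v j) := by rw [h, inv_smul_smul₀ hc]
    rw [this]
    refine Submodule.smul_mem _ _ (Submodule.subset_span ⟨v i, ?_, v j, ?_, rfl⟩)
    · rw [hs]; exact Submodule.subset_span ⟨i, hi, rfl⟩
    · rw [hs]; exact Submodule.subset_span ⟨j, hj, rfl⟩

theorem finrank_span_image {v : Fin 6 → V} (hv : LinearIndependent ℝ v) (s : Finset (Fin 6)) :
    Module.finrank ℝ (Submodule.span ℝ (v '' s)) = s.card := by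
  classical
  have := finrank_span_finset_eq_card (R := ℝ) (s := s.image v) (by
    rw [Finset.coe_image]
    exact (hv.linearIndepOn _).id_image)
  rwa [Finset.coe_image, Finset.card_image_of_injective _ hv.injective] at this

end LieSuperalgebra

namespace MetricLieSuperalgebra

variable {V : Type*} [AddCommGroup V] [Module ℝ V] {D : MetricLieSuperalgebra V}

/-- The dimensions of the first three commutants are `d` and the superdimension of the first one
is `s`. -/
def HasCommutantDims (D : MetricLieSuperalgebra V) (d : ℕ × ℕ × ℕ) (s : ℕ × ℕ) : Prop :=
  (Module.finrank ℝ (D.commutant 1), Module.finrank ℝ (D.commutant 2),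
    Module.finrank ℝ (D.commutant 3)) = d ∧
  (Module.finrank ℝ (D.commutant 1 ⊓ D.part 0 : Submodule ℝ V),
    Module.finrank ℝ (D.commutant 1 ⊓ D.part 1 : Submodule ℝ V)) = s

theorem hasCommutantDims_of_table {v : Fin 6 → V} (hv : LinearIndependent ℝ v)
    (hp : ∀ i, v i ∈ D.part (frameParity i)) {t₁ t₂ t₃ : Finset (Fin 6)}
    (h₁ : D.commutant 1 = Submodule.span ℝ (v '' t₁))
    (h₂ : D.commutant 2 = Submodule.span ℝ (v '' t₂))
    (h₃ : D.commutant 3 = Submodule.span ℝ (v '' t₃)) :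
    D.HasCommutantDims (t₁.card, t₂.card, t₃.card)
      ((t₁.filter fun i => frameParity i = 0).card,
        (t₁.filter fun i => frameParity i = 1).card) := by
  have hf : ∀ k : ZMod 2, (t₁ : Set (Fin 6)) ∩ frameParity ⁻¹' {k} =
      ((t₁.filter fun i => frameParity i = k : Finset (Fin 6)) : Set (Fin 6)) := by
    intro k
    ext i
    simp
  constructor
  · rw [h₁, h₂, h₃]
    simp only [LieSuperalgebra.finrank_span_image hv]
  · rw [h₁, D.span_image_inf_part hp, D.span_image_inf_part hp, hf, hf]
    simp only [LieSuperalgebra.finrank_span_image hv]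

/-- Vectors of the first commutant are orthogonal to central vectors. -/
theorem form_eq_zero_of_mem_commutant {z : V} (hz : ∀ y, D.bracket y z = 0) {x : V}
    (hx : x ∈ D.commutant 1) : D.form x z = 0 := by
  rw [LieSuperalgebra.commutant] at hx
  induction hx using Submodule.span_induction with
  | mem x hx =>
    obtain ⟨a, -, b, -, rfl⟩ := hx
    rw [D.form_bracket_assoc, hz, map_zero]
  | zero => simp
  | add a b _ _ ha hb => rw [map_add, LinearMap.add_apply, ha, hb, add_zero]
  | smul c a _ ha => rw [map_smul, LinearMap.smul_apply, ha, smul_zero]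

namespace Frame

open TripleType Brackets21

variable {e : Fin 6 → V}

/-- The bracket coefficients in the frame with `b̃¹` replaced by `b̃¹ - κ b₁`. -/
def semisimpleBracket (κ p q : ℝ) : Fin 6 → Fin 6 → Fin 6 → ℝ :=
  ![![0, ![0, 1, 0, 0, 0, 0], ![0, 0, p, 0, 0, 0], 0, ![0, 0, 0, 0, -1, 0],
      ![0, 0, 0, 0, 0, -p]],
    ![![0, -1, 0, 0, 0, 0], 0, 0, ![0, 2 * κ, 0, 0, 0, 0], ![0, 0, 0, 1, 0, 0],
      ![0, 0, κ * q, 0, 0, 0]],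
    ![![0, 0, -p, 0, 0, 0], 0, ![0, q, 0, 0, 0, 0], ![0, 0, 2 * κ * p, 0, 0, 0],
      ![0, 0, 0, 0, 0, q], ![0, 0, 0, p, 0, 0]],
    ![0, ![0, -2 * κ, 0, 0, 0, 0], ![0, 0, -2 * κ * p, 0, 0, 0], 0,
      ![0, 0, 0, 0, 2 * κ, 0], ![0, 0, 0, 0, 0, 2 * κ * p]],
    ![![0, 0, 0, 0, 1, 0], ![0, 0, 0, -1, 0, 0], ![0, 0, 0, 0, 0, -q],
      ![0, 0, 0, 0, -2 * κ, 0], 0, 0],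
    ![![0, 0, 0, 0, 0, p], ![0, 0, -κ * q, 0, 0, 0], ![0, 0, 0, p, 0, 0],
      ![0, 0, 0, 0, 0, -2 * κ * p], 0, ![0, 0, 0, 0, κ * q, 0]]]

/-- The frame with `b̃¹` replaced by `b̃¹ - κ b₁`. -/
def shifted (κ : ℝ) (e : Fin 6 → V) : Fin 6 → V := ![e 0, e 1, e 2, e 3 - κ • e 0, e 4, e 5]

theorem shifted_mem {k l : Brackets21} (h : Frame D k l e) (κ : ℝ) (i : Fin 6) :
    shifted κ e i ∈ D.part (frameParity i) := by
  fin_cases i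
  · exact h.mem 0
  · exact h.mem 1
  · exact h.mem 2
  · exact sub_mem (h.mem 3) (Submodule.smul_mem _ _ (h.mem 0))
  · exact h.mem 4
  · exact h.mem 5

theorem span_shifted {k l : Brackets21} (h : Frame D k l e) (κ : ℝ) :
    Submodule.span ℝ (Set.range (shifted κ e)) = ⊤ := by
  rw [eq_top_iff, ← h.top, Submodule.span_le]
  have hm : ∀ i, shifted κ e i ∈ Submodule.span ℝ (Set.range (shifted κ e)) :=
    fun i => Submodule.subset_span ⟨i, rfl⟩
  rintro _ ⟨i, rfl⟩
  fin_cases i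
  · exact hm 0
  · exact hm 1
  · exact hm 2
  · have := add_mem (hm 3) (Submodule.smul_mem _ κ (hm 0))
    simpa [shifted] using this
  · exact hm 4
  · exact hm 5

theorem linearIndependent_shifted {k l : Brackets21} (h : Frame D k l e) (κ : ℝ) :
    LinearIndependent ℝ (shifted κ e) :=
  linearIndependent_of_top_le_span_of_card_eq_finrank (h.span_shifted κ).ge
    (by simp [h.finrank_eq])

/-- Since [b₂,b̃²] = b̃¹ - κ b₁ is not a multiple of a frame vector, the original frame is not
adapted to the commutants; the shifted one is. For p = q = 0 and for p = 1/2, q = 1 this covers the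
classes IV and VIII. -/
theorem bracket_shifted {κ p q : ℝ}
    (h : Frame D ⟨![0, 1], ![p, 0], ![0, q]⟩ ⟨![0, κ], ![κ * p, 0], ![0, κ * q]⟩ e)
    (i j : Fin 6) : D.bracket (shifted κ e i) (shifted κ e j) =
      ∑ m, semisimpleBracket κ p q i j m • shifted κ e m := by
  fin_cases i <;> fin_cases j <;>
    simp [shifted, semisimpleBracket, h.bracket_eq, doubleBracket, Fin.sum_univ_six] <;> module

end Frame

theorem HasType.commutantDims_I (h : D.HasType .A_A) :
    D.HasCommutantDims (0, 0, 0) (0, 0) := by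
  obtain ⟨e, h⟩ := h
  have c0 := D.commutant_zero_eq_span h.top
  have c1 := D.commutant_succ_eq_span (t := ∅) h.bracket_eq c0 (by
    intro i hi j hj m hm
    fin_cases m <;> simp at hm <;> fin_cases i <;> fin_cases j <;> first | rfl |
      simp [doubleBracket, TripleType.left, TripleType.right, Brackets21.A]) (by simp)
  have c2 := D.commutant_succ_eq_span (t := ∅) h.bracket_eq c1 (by
    intro i hi j hj m hm
    simp at hi) (by simp)
  have c3 := D.commutant_succ_eq_span (t := ∅) h.bracket_eq c2 (by
    intro i hi j hj m hm
    simp at hi) (by simp)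
  exact hasCommutantDims_of_table h.linearIndependent h.mem c1 c2 c3

theorem HasType.commutantDims_II (h : D.HasType .N_A) :
    D.HasCommutantDims (2, 0, 0) (1, 1) := by
  obtain ⟨e, h⟩ := h
  have c0 := D.commutant_zero_eq_span h.top
  have c1 := D.commutant_succ_eq_span (t := {0, 5}) h.bracket_eq c0 (by
    intro i hi j hj m hm
    fin_cases m <;> simp at hm <;> fin_cases i <;> fin_cases j <;> first | rfl |
      simp [doubleBracket, TripleType.left, TripleType.right, Brackets21.N, Brackets21.A]) (by
    intro m hm
    simp only [Finset.mem_insert, Finset.mem_singleton] at hm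
    rcases hm with rfl | rfl
    · exact ⟨2, by simp, 2, by simp, 1, one_ne_zero, by
        simp [h.bracket_eq, doubleBracket, TripleType.left, TripleType.right, Brackets21.N,
          Brackets21.A, Fin.sum_univ_six]⟩
    · exact ⟨2, by simp, 3, by simp, 1, one_ne_zero, by
        simp [h.bracket_eq, doubleBracket, TripleType.left, TripleType.right, Brackets21.N,
          Brackets21.A, Fin.sum_univ_six]⟩)
  have c2 := D.commutant_succ_eq_span (t := ∅) h.bracket_eq c1 (by
    intro i hi j hj m hm
    fin_cases i <;> simp at hi <;> fin_cases j <;> simp at hj <;> fin_cases m <;> simp at hm <;>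
      first | rfl | simp [doubleBracket, TripleType.left, TripleType.right, Brackets21.N, Brackets21.A]) (by simp)
  have c3 := D.commutant_succ_eq_span (t := ∅) h.bracket_eq c2 (by
    intro i hi j hj m hm
    simp at hi) (by simp)
  exact hasCommutantDims_of_table h.linearIndependent h.mem c1 c2 c3

theorem HasType.commutantDims_III (h : D.HasType .S_A) :
    D.HasCommutantDims (3, 1, 0) (1, 2) := by
  obtain ⟨e, h⟩ := h
  have c0 := D.commutant_zero_eq_span h.top
  have c1 := D.commutant_succ_eq_span (t := {2, 3, 5}) h.bracket_eq c0 (by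
    intro i hi j hj m hm
    fin_cases m <;> simp at hm <;> fin_cases i <;> fin_cases j <;> first | rfl |
      simp [doubleBracket, TripleType.left, TripleType.right, Brackets21.S, Brackets21.A]) (by
    intro m hm
    simp only [Finset.mem_insert, Finset.mem_singleton] at hm
    rcases hm with rfl | rfl | rfl
    · exact ⟨0, by simp, 2, by simp, 1, one_ne_zero, by
        simp [h.bracket_eq, doubleBracket, TripleType.left, TripleType.right, Brackets21.S,
          Brackets21.A, Fin.sum_univ_six]⟩
    · exact ⟨2, by simp, 5, by simp, 1, one_ne_zero, by
        simp [h.bracket_eq, doubleBracket, TripleType.left, TripleType.right, Brackets21.S,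
          Brackets21.A, Fin.sum_univ_six]⟩
    · exact ⟨0, by simp, 5, by simp, -1, neg_ne_zero.2 one_ne_zero, by
        simp [h.bracket_eq, doubleBracket, TripleType.left, TripleType.right, Brackets21.S,
          Brackets21.A, Fin.sum_univ_six]⟩)
  have c2 := D.commutant_succ_eq_span (t := {3}) h.bracket_eq c1 (by
    intro i hi j hj m hm
    fin_cases i <;> simp at hi <;> fin_cases j <;> simp at hj <;> fin_cases m <;> simp at hm <;>
      first | rfl | simp [doubleBracket, TripleType.left, TripleType.right, Brackets21.S, Brackets21.A]) (by
    intro m hm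
    simp only [Finset.mem_insert, Finset.mem_singleton] at hm
    subst hm
    exact ⟨2, by simp, 5, by simp, 1, one_ne_zero, by
      simp [h.bracket_eq, doubleBracket, TripleType.left, TripleType.right, Brackets21.S,
        Brackets21.A, Fin.sum_univ_six]⟩)
  have c3 := D.commutant_succ_eq_span (t := ∅) h.bracket_eq c2 (by
    intro i hi j hj m hm
    fin_cases i <;> simp at hi <;> fin_cases j <;> simp at hj <;> fin_cases m <;> simp at hm <;>
      first | rfl | simp [doubleBracket, TripleType.left, TripleType.right, Brackets21.S, Brackets21.A]) (by simp)
  exact hasCommutantDims_of_table h.linearIndependent h.mem c1 c2 c3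

theorem HasType.commutantDims_IV0 (h : D.HasType (.C_A 0)) :
    D.HasCommutantDims (3, 1, 0) (3, 0) := by
  obtain ⟨e, h⟩ := h
  have c0 := D.commutant_zero_eq_span h.top
  have c1 := D.commutant_succ_eq_span (t := {1, 3, 4}) h.bracket_eq c0 (by
    intro i hi j hj m hm
    fin_cases m <;> simp at hm <;> fin_cases i <;> fin_cases j <;> first | rfl |
      simp [doubleBracket, TripleType.left, TripleType.right, Brackets21.C, Brackets21.A]) (by
    intro m hm
    simp only [Finset.mem_insert, Finset.mem_singleton] at hm
    rcases hm with rfl | rfl | rfl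
    · exact ⟨0, by simp, 1, by simp, 1, one_ne_zero, by
        simp [h.bracket_eq, doubleBracket, TripleType.left, TripleType.right, Brackets21.C,
          Brackets21.A, Fin.sum_univ_six]⟩
    · exact ⟨1, by simp, 4, by simp, 1, one_ne_zero, by
        simp [h.bracket_eq, doubleBracket, TripleType.left, TripleType.right, Brackets21.C,
          Brackets21.A, Fin.sum_univ_six]⟩
    · exact ⟨0, by simp, 4, by simp, -1, neg_ne_zero.2 one_ne_zero, by
        simp [h.bracket_eq, doubleBracket, TripleType.left, TripleType.right, Brackets21.C,
          Brackets21.A, Fin.sum_univ_six]⟩)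
  have c2 := D.commutant_succ_eq_span (t := {3}) h.bracket_eq c1 (by
    intro i hi j hj m hm
    fin_cases i <;> simp at hi <;> fin_cases j <;> simp at hj <;> fin_cases m <;> simp at hm <;>
      first | rfl | simp [doubleBracket, TripleType.left, TripleType.right, Brackets21.C, Brackets21.A]) (by
    intro m hm
    simp only [Finset.mem_insert, Finset.mem_singleton] at hm
    subst hm
    exact ⟨1, by simp, 4, by simp, 1, one_ne_zero, by
      simp [h.bracket_eq, doubleBracket, TripleType.left, TripleType.right, Brackets21.C,
        Brackets21.A, Fin.sum_univ_six]⟩)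
  have c3 := D.commutant_succ_eq_span (t := ∅) h.bracket_eq c2 (by
    intro i hi j hj m hm
    fin_cases i <;> simp at hi <;> fin_cases j <;> simp at hj <;> fin_cases m <;> simp at hm <;>
      first | rfl | simp [doubleBracket, TripleType.left, TripleType.right, Brackets21.C, Brackets21.A]) (by simp)
  exact hasCommutantDims_of_table h.linearIndependent h.mem c1 c2 c3

theorem HasType.commutantDims_V (h : D.HasType (.C_N 0 1)) :
    D.HasCommutantDims (4, 1, 0) (3, 1) := by
  obtain ⟨e, h⟩ := h
  have c0 := D.commutant_zero_eq_span h.top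
  have c1 := D.commutant_succ_eq_span (t := {1, 2, 3, 4}) h.bracket_eq c0 (by
    intro i hi j hj m hm
    fin_cases m <;> simp at hm <;> fin_cases i <;> fin_cases j <;> first | rfl |
      simp [doubleBracket, TripleType.left, TripleType.right, Brackets21.C]) (by
    intro m hm
    simp only [Finset.mem_insert, Finset.mem_singleton] at hm
    rcases hm with rfl | rfl | rfl | rfl
    · exact ⟨0, by simp, 1, by simp, 1, one_ne_zero, by
        simp [h.bracket_eq, doubleBracket, TripleType.left, TripleType.right, Brackets21.C,
          Fin.sum_univ_six]⟩
    · exact ⟨0, by simp, 5, by simp, 1, one_ne_zero, by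
        simp [h.bracket_eq, doubleBracket, TripleType.left, TripleType.right, Brackets21.C,
          Fin.sum_univ_six]⟩
    · exact ⟨1, by simp, 4, by simp, 1, one_ne_zero, by
        simp [h.bracket_eq, doubleBracket, TripleType.left, TripleType.right, Brackets21.C,
          Fin.sum_univ_six]⟩
    · exact ⟨0, by simp, 4, by simp, -1, neg_ne_zero.2 one_ne_zero, by
        simp [h.bracket_eq, doubleBracket, TripleType.left, TripleType.right, Brackets21.C,
          Fin.sum_univ_six]⟩)
  have c2 := D.commutant_succ_eq_span (t := {3}) h.bracket_eq c1 (by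
    intro i hi j hj m hm
    fin_cases i <;> simp at hi <;> fin_cases j <;> simp at hj <;> fin_cases m <;> simp at hm <;>
      first | rfl | simp [doubleBracket, TripleType.left, TripleType.right, Brackets21.C]) (by
    intro m hm
    simp only [Finset.mem_insert, Finset.mem_singleton] at hm
    subst hm
    exact ⟨1, by simp, 4, by simp, 1, one_ne_zero, by
      simp [h.bracket_eq, doubleBracket, TripleType.left, TripleType.right, Brackets21.C,
        Fin.sum_univ_six]⟩)
  have c3 := D.commutant_succ_eq_span (t := ∅) h.bracket_eq c2 (by
    intro i hi j hj m hm
    fin_cases i <;> simp at hi <;> fin_cases j <;> simp at hj <;> fin_cases m <;> simp at hm <;>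
      first | rfl | simp [doubleBracket, TripleType.left, TripleType.right, Brackets21.C]) (by simp)
  exact hasCommutantDims_of_table h.linearIndependent h.mem c1 c2 c3

theorem HasType.commutantDims_VI {p : ℝ} (hp : p ≠ 0) (h : D.HasType (.C_A p)) :
    D.HasCommutantDims (5, 1, 0) (3, 2) := by
  obtain ⟨e, h⟩ := h
  have c0 := D.commutant_zero_eq_span h.top
  have c1 := D.commutant_succ_eq_span (t := {1, 2, 3, 4, 5}) h.bracket_eq c0 (by
    intro i hi j hj m hm
    fin_cases m <;> simp at hm <;> fin_cases i <;> fin_cases j <;> first | rfl |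
      simp [doubleBracket, TripleType.left, TripleType.right, Brackets21.C, Brackets21.A]) (by
    intro m hm
    simp only [Finset.mem_insert, Finset.mem_singleton] at hm
    rcases hm with rfl | rfl | rfl | rfl | rfl
    · exact ⟨0, by simp, 1, by simp, 1, one_ne_zero, by
        simp [h.bracket_eq, doubleBracket, TripleType.left, TripleType.right, Brackets21.C,
          Brackets21.A, Fin.sum_univ_six]⟩
    · exact ⟨0, by simp, 2, by simp, p, hp, by
        simp [h.bracket_eq, doubleBracket, TripleType.left, TripleType.right, Brackets21.C,
          Brackets21.A, Fin.sum_univ_six]⟩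
    · exact ⟨1, by simp, 4, by simp, 1, one_ne_zero, by
        simp [h.bracket_eq, doubleBracket, TripleType.left, TripleType.right, Brackets21.C,
          Brackets21.A, Fin.sum_univ_six]⟩
    · exact ⟨0, by simp, 4, by simp, -1, neg_ne_zero.2 one_ne_zero, by
        simp [h.bracket_eq, doubleBracket, TripleType.left, TripleType.right, Brackets21.C,
          Brackets21.A, Fin.sum_univ_six]⟩
    · exact ⟨0, by simp, 5, by simp, -p, neg_ne_zero.2 hp, by
        simp [h.bracket_eq, doubleBracket, TripleType.left, TripleType.right, Brackets21.C,
          Brackets21.A, Fin.sum_univ_six]⟩)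
  have c2 := D.commutant_succ_eq_span (t := {3}) h.bracket_eq c1 (by
    intro i hi j hj m hm
    fin_cases i <;> simp at hi <;> fin_cases j <;> simp at hj <;> fin_cases m <;> simp at hm <;>
      first | rfl | simp [doubleBracket, TripleType.left, TripleType.right, Brackets21.C, Brackets21.A]) (by
    intro m hm
    simp only [Finset.mem_insert, Finset.mem_singleton] at hm
    subst hm
    exact ⟨1, by simp, 4, by simp, 1, one_ne_zero, by
      simp [h.bracket_eq, doubleBracket, TripleType.left, TripleType.right, Brackets21.C,
        Brackets21.A, Fin.sum_univ_six]⟩)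
  have c3 := D.commutant_succ_eq_span (t := ∅) h.bracket_eq c2 (by
    intro i hi j hj m hm
    fin_cases i <;> simp at hi <;> fin_cases j <;> simp at hj <;> fin_cases m <;> simp at hm <;>
      first | rfl | simp [doubleBracket, TripleType.left, TripleType.right, Brackets21.C, Brackets21.A]) (by simp)
  exact hasCommutantDims_of_table h.linearIndependent h.mem c1 c2 c3

theorem HasType.commutantDims_VII (h : D.HasType .F_A) :
    D.HasCommutantDims (5, 3, 0) (3, 2) := by
  obtain ⟨e, h⟩ := h
  have c0 := D.commutant_zero_eq_span h.top
  have c1 := D.commutant_succ_eq_span (t := {1, 2, 3, 4, 5}) h.bracket_eq c0 (by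
    intro i hi j hj m hm
    fin_cases m <;> simp at hm <;> fin_cases i <;> fin_cases j <;> first | rfl |
      simp [doubleBracket, TripleType.left, TripleType.right, Brackets21.F, Brackets21.A]) (by
    intro m hm
    simp only [Finset.mem_insert, Finset.mem_singleton] at hm
    rcases hm with rfl | rfl | rfl | rfl | rfl
    · exact ⟨0, by simp, 1, by simp, 1, one_ne_zero, by
        simp [h.bracket_eq, doubleBracket, TripleType.left, TripleType.right, Brackets21.F,
          Brackets21.A, Fin.sum_univ_six]⟩
    · exact ⟨0, by simp, 2, by simp, 1 / 2, by norm_num, by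
        simp [h.bracket_eq, doubleBracket, TripleType.left, TripleType.right, Brackets21.F,
          Brackets21.A, Fin.sum_univ_six]⟩
    · exact ⟨1, by simp, 4, by simp, 1, one_ne_zero, by
        simp [h.bracket_eq, doubleBracket, TripleType.left, TripleType.right, Brackets21.F,
          Brackets21.A, Fin.sum_univ_six]⟩
    · exact ⟨0, by simp, 4, by simp, -1, neg_ne_zero.2 one_ne_zero, by
        simp [h.bracket_eq, doubleBracket, TripleType.left, TripleType.right, Brackets21.F,
          Brackets21.A, Fin.sum_univ_six]⟩
    · exact ⟨2, by simp, 4, by simp, 1, one_ne_zero, by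
        simp [h.bracket_eq, doubleBracket, TripleType.left, TripleType.right, Brackets21.F,
          Brackets21.A, Fin.sum_univ_six]⟩)
  have c2 := D.commutant_succ_eq_span (t := {1, 3, 5}) h.bracket_eq c1 (by
    intro i hi j hj m hm
    fin_cases i <;> simp at hi <;> fin_cases j <;> simp at hj <;> fin_cases m <;> simp at hm <;>
      first | rfl | simp [doubleBracket, TripleType.left, TripleType.right, Brackets21.F, Brackets21.A]) (by
    intro m hm
    simp only [Finset.mem_insert, Finset.mem_singleton] at hm
    rcases hm with rfl | rfl | rfl
    · exact ⟨2, by simp, 2, by simp, 1, one_ne_zero, by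
        simp [h.bracket_eq, doubleBracket, TripleType.left, TripleType.right, Brackets21.F,
          Brackets21.A, Fin.sum_univ_six]⟩
    · exact ⟨1, by simp, 4, by simp, 1, one_ne_zero, by
        simp [h.bracket_eq, doubleBracket, TripleType.left, TripleType.right, Brackets21.F,
          Brackets21.A, Fin.sum_univ_six]⟩
    · exact ⟨2, by simp, 4, by simp, 1, one_ne_zero, by
        simp [h.bracket_eq, doubleBracket, TripleType.left, TripleType.right, Brackets21.F,
          Brackets21.A, Fin.sum_univ_six]⟩)
  have c3 := D.commutant_succ_eq_span (t := ∅) h.bracket_eq c2 (by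
    intro i hi j hj m hm
    fin_cases i <;> simp at hi <;> fin_cases j <;> simp at hj <;> fin_cases m <;> simp at hm <;>
      first | rfl | simp [doubleBracket, TripleType.left, TripleType.right, Brackets21.F, Brackets21.A]) (by simp)
  exact hasCommutantDims_of_table h.linearIndependent h.mem c1 c2 c3

theorem HasType.commutantDims_IV {κ : ℝ} (hκ : κ ≠ 0) (h : D.HasType (.C0_C0 κ hκ)) :
    D.HasCommutantDims (3, 3, 3) (3, 0) := by
  obtain ⟨e, h⟩ := h
  have hT := Frame.bracket_shifted (κ := κ) (p := 0) (q := 0) (e := e) (D := D) (by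
    simpa [TripleType.left, TripleType.right, Brackets21.C] using h)
  -- These three vectors span a perfect subalgebra, a copy of sl₂, so the commutants are constant
  -- from the first on.
  have step : ∀ {n : ℕ} {s : Finset (Fin 6)}, {1, 3, 4} ⊆ s →
      D.commutant n = Submodule.span ℝ (Frame.shifted κ e '' s) → D.commutant (n + 1) =
        Submodule.span ℝ (Frame.shifted κ e '' ({1, 3, 4} : Finset (Fin 6))) := by
    intro n s hs hn
    have hs' : ∀ m ∈ ({1, 3, 4} : Finset (Fin 6)), m ∈ s := fun m hm => hs hm
    refine D.commutant_succ_eq_span hT hn ?_ ?_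
    · intro i _ j _ m hm
      fin_cases m <;> simp at hm <;> fin_cases i <;> fin_cases j <;>
        simp [Frame.semisimpleBracket]
    · intro m hm
      simp only [Finset.mem_insert, Finset.mem_singleton] at hm
      rcases hm with rfl | rfl | rfl
      · exact ⟨1, hs' _ (by simp), 3, hs' _ (by simp), 2 * κ, mul_ne_zero two_ne_zero hκ, by
          simp [hT, Frame.semisimpleBracket, Fin.sum_univ_six]⟩
      · exact ⟨1, hs' _ (by simp), 4, hs' _ (by simp), 1, one_ne_zero, by
          simp [hT, Frame.semisimpleBracket, Fin.sum_univ_six]⟩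
      · exact ⟨3, hs' _ (by simp), 4, hs' _ (by simp), 2 * κ, mul_ne_zero two_ne_zero hκ, by
          simp [hT, Frame.semisimpleBracket, Fin.sum_univ_six]⟩
  have c1 := step (Finset.subset_univ _) (D.commutant_zero_eq_span (h.span_shifted κ))
  have c2 := step subset_rfl c1
  have c3 := step subset_rfl c2
  exact hasCommutantDims_of_table (h.linearIndependent_shifted κ) (h.shifted_mem κ) c1 c2 c3

theorem HasType.commutantDims_VIII {κ : ℝ} (hκ : κ ≠ 0) (h : D.HasType (.F_Fii κ hκ)) :
    D.HasCommutantDims (5, 5, 5) (3, 2) := by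
  obtain ⟨e, h⟩ := h
  have hT := Frame.bracket_shifted (κ := κ) (p := 1 / 2) (q := 1) (e := e) (D := D) (by
    simpa [TripleType.left, TripleType.right, Brackets21.F, div_eq_mul_inv] using h)
  -- The five vectors span a perfect subalgebra with even part sl₂ and an odd plane, so the
  -- commutants are again constant.
  have step : ∀ {n : ℕ} {s : Finset (Fin 6)}, {1, 2, 3, 4, 5} ⊆ s →
      D.commutant n = Submodule.span ℝ (Frame.shifted κ e '' s) → D.commutant (n + 1) =
        Submodule.span ℝ (Frame.shifted κ e '' ({1, 2, 3, 4, 5} : Finset (Fin 6))) := by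
    intro n s hs hn
    have hs' : ∀ m ∈ ({1, 2, 3, 4, 5} : Finset (Fin 6)), m ∈ s := fun m hm => hs hm
    refine D.commutant_succ_eq_span hT hn ?_ ?_
    · intro i _ j _ m hm
      fin_cases m <;> simp at hm <;> fin_cases i <;> fin_cases j <;>
        simp [Frame.semisimpleBracket]
    · intro m hm
      simp only [Finset.mem_insert, Finset.mem_singleton] at hm
      rcases hm with rfl | rfl | rfl | rfl | rfl
      · exact ⟨1, hs' _ (by simp), 3, hs' _ (by simp), 2 * κ, mul_ne_zero two_ne_zero hκ, by
          simp [hT, Frame.semisimpleBracket, Fin.sum_univ_six]⟩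
      · exact ⟨1, hs' _ (by simp), 5, hs' _ (by simp), κ, hκ, by
          simp [hT, Frame.semisimpleBracket, Fin.sum_univ_six]⟩
      · exact ⟨1, hs' _ (by simp), 4, hs' _ (by simp), 1, one_ne_zero, by
          simp [hT, Frame.semisimpleBracket, Fin.sum_univ_six]⟩
      · exact ⟨3, hs' _ (by simp), 4, hs' _ (by simp), 2 * κ, mul_ne_zero two_ne_zero hκ, by
          simp [hT, Frame.semisimpleBracket, Fin.sum_univ_six]⟩
      · exact ⟨2, hs' _ (by simp), 4, hs' _ (by simp), 1, one_ne_zero, by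
          simp [hT, Frame.semisimpleBracket, Fin.sum_univ_six]⟩
  have c1 := step (Finset.subset_univ _) (D.commutant_zero_eq_span (h.span_shifted κ))
  have c2 := step subset_rfl c1
  have c3 := step subset_rfl c2
  exact hasCommutantDims_of_table (h.linearIndependent_shifted κ) (h.shifted_mem κ) c1 c2 c3

theorem HasType.commutantDims {c : DoubleClass} (h : D.HasType c.rep) :
    D.HasCommutantDims c.commutantDims c.commutantSuperdim := by
  cases c with
  | I => exact HasType.commutantDims_I h
  | II => exact HasType.commutantDims_II h
  | III => exact HasType.commutantDims_III h
  | IV0 => exact HasType.commutantDims_IV0 h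
  | IV κ hκ => exact HasType.commutantDims_IV hκ h
  | V => exact HasType.commutantDims_V h
  | VI p hp => exact HasType.commutantDims_VI hp.ne' h
  | VII => exact HasType.commutantDims_VII h
  | VIII κ hκ => exact HasType.commutantDims_VIII hκ h

end MetricLieSuperalgebra

/-! ### Invariance of the parameters κ and p. -/

namespace MetricLieSuperalgebra

variable {V : Type*} [AddCommGroup V] [Module ℝ V] {D : MetricLieSuperalgebra V}

namespace Frame

variable {e : Fin 6 → V}

theorem bracket_eq_zero_of_basis {k l : Brackets21} (h : Frame D k l e) {z : V}
    (hz : ∀ i, D.bracket (e i) z = 0) (y : V) : D.bracket y z = 0 := by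
  have hy : y ∈ Submodule.span ℝ (Set.range e) := h.top ▸ Submodule.mem_top
  induction hy using Submodule.span_induction with
  | mem y hy => obtain ⟨i, rfl⟩ := hy; exact hz i
  | zero => simp
  | add a b _ _ ha hb => rw [map_add, LinearMap.add_apply, ha, hb, add_zero]
  | smul c a _ ha => rw [map_smul, LinearMap.smul_apply, ha, smul_zero]

theorem bracket_mem_commutant (x y : V) : D.bracket x y ∈ D.commutant 1 :=
  Submodule.subset_span ⟨x, Submodule.mem_top, y, Submodule.mem_top, rfl⟩

/-- In the superdoubles with a simple even derived algebra the parameter `κ` relates the double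
commutator to the bilinear form. -/
theorem double_bracket_semisimple {κ p q : ℝ}
    (h : Frame D ⟨![0, 1], ![p, 0], ![0, q]⟩ ⟨![0, κ], ![κ * p, 0], ![0, κ * q]⟩ e)
    {x y : V} (hx : x ∈ D.commutant 1) (hx₀ : x ∈ D.part 0) (hy : y ∈ D.commutant 1)
    (hy₀ : y ∈ D.part 0) :
    D.bracket x (D.bracket x y) = (-2 * κ) • (D.form x x • y - D.form x y • x) := by
  -- b̃¹ + κ b₁ is central, hence orthogonal to the commutant; for an even vector of the commutant
  -- this expresses the b₁ coordinate through the b̃¹ coordinate.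
  have hz : ∀ y, D.bracket y (e 3 + κ • e 0) = 0 := by
    refine h.bracket_eq_zero_of_basis fun i => ?_
    fin_cases i <;> simp [h.bracket_eq, doubleBracket, Fin.sum_univ_six] <;> module
  have fx := form_eq_zero_of_mem_commutant hz hx
  have fy := form_eq_zero_of_mem_commutant hz hy
  obtain ⟨a, rfl⟩ := h.exists_evenVec hx₀
  obtain ⟨b, rfl⟩ := h.exists_evenVec hy₀
  simp [evenVec, h.gram, frameGram] at fx fy
  have fx' : a 0 = -(κ * a 2) := by linarith
  have fy' : b 0 = -(κ * b 2) := by linarith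
  rw [h.bracket_evenVec, h.bracket_evenVec, h.form_evenVec, h.form_evenVec, ← evenVec_smul,
    ← evenVec_smul, sub_eq_add_neg, ← neg_one_smul ℝ (evenVec e (evenForm a b • a)),
    ← evenVec_smul, ← evenVec_add, ← evenVec_smul]
  congr 1
  ext i
  fin_cases i <;> simp [evenBracket, evenForm, fx', fy'] <;> ring

/-- The identity for the first frame is tested on b₂ and b̃² of the second. Both are commutators, b₂
is isotropic and dual to b̃², and the double bracket is 2κ' b₂; comparison gives κ = κ'. -/
theorem param_semisimple_unique {κ p q κ' p' q' : ℝ} {e' : Fin 6 → V}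
    (h : Frame D ⟨![0, 1], ![p, 0], ![0, q]⟩ ⟨![0, κ], ![κ * p, 0], ![0, κ * q]⟩ e)
    (h' : Frame D ⟨![0, 1], ![p', 0], ![0, q']⟩ ⟨![0, κ'], ![κ' * p', 0], ![0, κ' * q']⟩ e') :
    κ = κ' := by
  have h1 : e' 1 ∈ D.commutant 1 := by
    have := bracket_mem_commutant (D := D) (e' 0) (e' 1)
    simpa [h'.bracket_eq, doubleBracket, Fin.sum_univ_six] using this
  have h4 : e' 4 ∈ D.commutant 1 := by
    have := bracket_mem_commutant (D := D) (e' 0) (e' 4)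
    simpa [h'.bracket_eq, doubleBracket, Fin.sum_univ_six] using this
  have H := h.double_bracket_semisimple h1 (h'.mem 1) h4 (h'.mem 4)
  have H' := congrArg (fun v => D.form v (e' 4)) H
  simp [h'.bracket_eq, h'.gram, doubleBracket, frameGram, Fin.sum_univ_six] at H'
  linarith

/-- The element b₁' of the second frame has some b₁ coordinate x₀ in the first. It acts on the even
part of the commutant modulo b̃¹ with eigenvalues ±x₀, and on the odd plane with eigenvalues ±p x₀.
The eigenvectors b₂' and f' have eigenvalues 1 and p', so x₀² = 1 and p'² = p². -/
theorem param_solvable_unique {p p' : ℝ} {e' : Fin 6 → V}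
    (h : Frame D ⟨![0, 1], ![p, 0], ![0, 0]⟩ ⟨![0, 0], ![0, 0], ![0, 0]⟩ e)
    (h' : Frame D ⟨![0, 1], ![p', 0], ![0, 0]⟩ ⟨![0, 0], ![0, 0], ![0, 0]⟩ e') :
    p ^ 2 = p' ^ 2 := by
  have h1 : e' 1 ∈ D.commutant 1 := by
    have := bracket_mem_commutant (D := D) (e' 0) (e' 1)
    simpa [h'.bracket_eq, doubleBracket, Fin.sum_univ_six] using this
  have hz : ∀ y, D.bracket y (e 3) = 0 := by
    refine h.bracket_eq_zero_of_basis fun i => ?_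
    fin_cases i <;> simp [h.bracket_eq, doubleBracket, Fin.sum_univ_six]
  -- b̃¹ is central, so b₂', lying in the commutant, has no b₁ coordinate.
  have fy := form_eq_zero_of_mem_commutant hz h1
  have b1 : D.bracket (e' 0) (e' 1) = e' 1 := by
    simp [h'.bracket_eq, doubleBracket, Fin.sum_univ_six]
  have b2 : D.bracket (e' 0) (e' 2) = p' • e' 2 := by
    simp [h'.bracket_eq, doubleBracket, Fin.sum_univ_six]
  have n1 : e' 1 ≠ 0 := h'.linearIndependent.ne_zero 1
  have n2 : e' 2 ≠ 0 := h'.linearIndependent.ne_zero 2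
  obtain ⟨x, hx⟩ := h.exists_evenVec (h'.mem 0)
  obtain ⟨y, hy⟩ := h.exists_evenVec (h'.mem 1)
  obtain ⟨z, hz⟩ := h.exists_oddVec (h'.mem 2)
  rw [← hx, ← hy, h.bracket_evenVec] at b1
  rw [← hx, ← hz, h.bracket_evenVec_oddVec, ← oddVec_smul] at b2
  rw [← hy] at n1 fy
  rw [← hz] at n2
  have e1 := h.evenVec_injective b1
  have e2 := h.oddVec_injective b2
  simp [evenVec, h.gram, frameGram] at fy
  have e10 := congrFun e1 1
  have e11 := congrFun e1 2
  have e13 := congrFun e1 3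
  have e20 := congrFun e2 0
  have e21 := congrFun e2 1
  simp [evenBracket, evenOddBracket, fy, -mul_eq_mul_right_iff] at e10 e11 e13 e20 e21
  -- Otherwise the b₂ and b̃² coordinates of b₂' vanish; then its b̃¹ coordinate vanishes too,
  -- contradicting b₂' ≠ 0.
  have hx0 : x 0 ^ 2 = 1 := by
    by_contra hne
    have hne' : x 0 ^ 2 - 1 ≠ 0 := sub_ne_zero.2 hne
    have y1 : y 1 = 0 := by
      have : (x 0 ^ 2 - 1) * y 1 = 0 := by linear_combination (x 0 + 1) * e10
      simpa [hne'] using this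
    have y3 : y 3 = 0 := by
      have : (x 0 ^ 2 - 1) * y 3 = 0 := by linear_combination (1 - x 0) * e13
      simpa [hne'] using this
    rw [y1, y3] at e11
    apply n1
    simp [evenVec, fy, y1, y3, ← e11]
  by_contra hne
  have hne' : p ^ 2 - p' ^ 2 ≠ 0 := sub_ne_zero.2 hne
  have z0 : z 0 = 0 := by
    have : (p ^ 2 - p' ^ 2) * z 0 = 0 := by
      linear_combination (p * x 0 + p') * e20 - p ^ 2 * z 0 * hx0
    simpa [hne'] using this
  have z1 : z 1 = 0 := by
    have : (p ^ 2 - p' ^ 2) * z 1 = 0 := by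
      linear_combination (p' - p * x 0) * e21 - p ^ 2 * z 1 * hx0
    simpa [hne'] using this
  apply n2
  simp [oddVec, z0, z1]

end Frame

/-- The class of a superdouble is unique. -/
theorem class_unique {c c' : DoubleClass} (h : D.HasType c.rep) (h' : D.HasType c'.rep) :
    c = c' := by
  have hd : c.commutantDims = c'.commutantDims :=
    h.commutantDims.1.symm.trans h'.commutantDims.1
  have hs : c.commutantSuperdim = c'.commutantSuperdim :=
    h.commutantDims.2.symm.trans h'.commutantDims.2
  cases c with
  | IV κ hκ =>
    cases c' with
    | IV κ' hκ' =>
      obtain ⟨e, he⟩ := h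
      obtain ⟨e', he'⟩ := h'
      have := Frame.param_semisimple_unique (D := D) (κ := κ) (p := 0) (q := 0) (κ' := κ')
        (p' := 0) (q' := 0) (e := e) (e' := e')
        (by simpa [DoubleClass.rep, TripleType.left, TripleType.right, Brackets21.C] using he)
        (by simpa [DoubleClass.rep, TripleType.left, TripleType.right, Brackets21.C] using he')
      subst this
      rfl
    | _ => simp [DoubleClass.commutantDims, DoubleClass.commutantSuperdim] at hd hs
  | VI p hp =>
    cases c' with
    | VI p' hp' =>
      obtain ⟨e, he⟩ := h
      obtain ⟨e', he'⟩ := h'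
      have := Frame.param_solvable_unique he he'
      obtain rfl : p = p' := by nlinarith
      rfl
    | _ => simp [DoubleClass.commutantDims, DoubleClass.commutantSuperdim] at hd hs
  | VIII κ hκ =>
    cases c' with
    | VIII κ' hκ' =>
      obtain ⟨e, he⟩ := h
      obtain ⟨e', he'⟩ := h'
      have := Frame.param_semisimple_unique (D := D) (κ := κ) (p := 1 / 2) (q := 1) (κ' := κ')
        (p' := 1 / 2) (q' := 1) (e := e) (e' := e')
        (by simpa [DoubleClass.rep, TripleType.left, TripleType.right, Brackets21.F,
          div_eq_mul_inv] using he)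
        (by simpa [DoubleClass.rep, TripleType.left, TripleType.right, Brackets21.F,
          div_eq_mul_inv] using he')
      subst this
      rfl
    | _ => simp [DoubleClass.commutantDims, DoubleClass.commutantSuperdim] at hd hs
  -- The commutant dimensions separate all remaining classes except III and IV₀, whose first
  -- commutants differ in superdimension.
  | _ =>
    cases c' <;> first
      | rfl
      | simp [DoubleClass.commutantDims, DoubleClass.commutantSuperdim] at hd hs

end MetricLieSuperalgebra

/-! ### Invariants of the listed supertriples under base change. -/

namespace BaseChange

/-- The new coefficients are the old ones times an invertible matrix, which the transposed relations
invert. The same holds for `ff` and `bf`. -/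
theorem apply_bb_eq_zero_iff (P : BaseChange) (k : Brackets21) :
    ((P.apply k).bb 0 = 0 ∧ (P.apply k).bb 1 = 0) ↔ (k.bb 0 = 0 ∧ k.bb 1 = 0) := by
  have hd := P.det_ne_zero
  obtain ⟨t1, t2, t3, t4⟩ := P.transpose
  constructor
  · rintro ⟨h₁, h₂⟩
    simp [apply, hd] at h₁ h₂
    constructor
    · linear_combination P.a * h₁ + P.c * h₂ - k.bb 0 * t1 - k.bb 1 * t2
    · linear_combination P.b * h₁ + P.d * h₂ - k.bb 0 * t3 - k.bb 1 * t4
  · rintro ⟨h₁, h₂⟩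
    simp [apply, h₁, h₂]

theorem apply_ff_eq_zero_iff (P : BaseChange) (k : Brackets21) :
    ((P.apply k).ff 0 = 0 ∧ (P.apply k).ff 1 = 0) ↔ (k.ff 0 = 0 ∧ k.ff 1 = 0) := by
  have hu := P.u_ne_zero
  obtain ⟨t1, t2, t3, t4⟩ := P.transpose
  constructor
  · rintro ⟨h₁, h₂⟩
    simp [apply, hu] at h₁ h₂
    constructor
    · linear_combination P.a * h₁ + P.c * h₂ - k.ff 0 * t1 - k.ff 1 * t2
    · linear_combination P.b * h₁ + P.d * h₂ - k.ff 0 * t3 - k.ff 1 * t4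
  · rintro ⟨h₁, h₂⟩
    simp [apply, h₁, h₂]

theorem apply_bf_eq_zero_iff (P : BaseChange) (k : Brackets21) :
    ((P.apply k).bf 0 = 0 ∧ (P.apply k).bf 1 = 0) ↔ (k.bf 0 = 0 ∧ k.bf 1 = 0) := by
  obtain ⟨t1, t2, t3, t4⟩ := P.transpose
  constructor
  · rintro ⟨h₁, h₂⟩
    simp [apply] at h₁ h₂
    constructor
    · linear_combination P.a' * h₁ + P.c' * h₂ - k.bf 0 * t1 - k.bf 1 * t3
    · linear_combination P.b' * h₁ + P.d' * h₂ - k.bf 0 * t2 - k.bf 1 * t4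
  · rintro ⟨h₁, h₂⟩
    simp [apply, h₁, h₂]

/-- [b₁,b₂] is multiplied by the determinant and [b̃¹,b̃²] by its inverse, so their pairing is an
invariant number. For the types with κ it equals κ. -/
theorem dual_bb_pairing (P : BaseChange) (k l : Brackets21) :
    (P.dual.apply l).bb 0 * (P.apply k).bb 0 + (P.dual.apply l).bb 1 * (P.apply k).bb 1 =
      l.bb 0 * k.bb 0 + l.bb 1 * k.bb 1 := by
  obtain ⟨t1, t2, t3, t4⟩ := P.transpose
  have h := P.det_mul_det_dual
  calc _ = (P.det * P.dual.det) *
        ((l.bb 0 * k.bb 0) * (P.a * P.a' + P.c * P.c') + (l.bb 0 * k.bb 1) *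
          (P.a * P.b' + P.c * P.d') + (l.bb 1 * k.bb 0) * (P.b * P.a' + P.d * P.c') +
          (l.bb 1 * k.bb 1) * (P.b * P.b' + P.d * P.d')) := by
        simp [apply, dual]; ring
    _ = _ := by rw [h, t1, t2, t3, t4]; ring

/-- The pairing of [f̃,f̃] with [b₁,b₂] scales by the nonzero factor det · u'², so only its
vanishing is invariant. -/
theorem dual_ff_pairing (P : BaseChange) (k l : Brackets21) :
    (P.dual.apply l).ff 0 * (P.apply k).bb 0 + (P.dual.apply l).ff 1 * (P.apply k).bb 1 = 0 ↔
      l.ff 0 * k.bb 0 + l.ff 1 * k.bb 1 = 0 := by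
  obtain ⟨t1, t2, t3, t4⟩ := P.transpose
  have h : P.det * P.u' ^ 2 ≠ 0 := mul_ne_zero P.det_ne_zero (pow_ne_zero 2 P.dual.u_ne_zero)
  have : (P.dual.apply l).ff 0 * (P.apply k).bb 0 + (P.dual.apply l).ff 1 * (P.apply k).bb 1 =
      (P.det * P.u' ^ 2) * (l.ff 0 * k.bb 0 + l.ff 1 * k.bb 1) := by
    calc _ = (P.det * P.u' ^ 2) *
          ((l.ff 0 * k.bb 0) * (P.a * P.a' + P.c * P.c') + (l.ff 0 * k.bb 1) *
            (P.a * P.b' + P.c * P.d') + (l.ff 1 * k.bb 0) * (P.b * P.a' + P.d * P.c') +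
            (l.ff 1 * k.bb 1) * (P.b * P.b' + P.d * P.d')) := by
          simp [apply, dual]; ring
      _ = _ := by rw [t1, t2, t3, t4]; ring
  rw [this, mul_eq_zero, or_iff_right h]

end BaseChange

namespace TripleType

open Brackets21

/-- The shape of `𝒮`: whether `[b₁, b₂]`, the action on `f` or `[b₁, b₂]`, and `[f, f]` vanish. -/
def leftShape : TripleType → Bool × Bool × Bool
  | A_A => (true, true, true)
  | N_A => (true, true, false)
  | S_A | S_N _ | S_S => (true, false, true)
  | C_A _ | C_N _ _ | C_C _ | Chalf_N | C0_C0 _ _ => (false, false, true)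
  | F_A | F_C _ | F_Fi _ | F_Fii _ _ => (false, false, false)

/-- The shape of `𝒮̃`. -/
def rightShape : TripleType → Bool × Bool × Bool
  | A_A | N_A | S_A | C_A _ | F_A => (true, true, true)
  | S_N _ | C_N _ _ | Chalf_N => (true, true, false)
  | S_S => (true, false, true)
  | C_C _ | C0_C0 _ _ | F_C _ => (false, false, true)
  | F_Fi _ | F_Fii _ _ => (false, false, false)

/-- Whether `[b₁, b₂]` and `[b̃¹, b̃²]`, respectively `[b₁, b₂]` and `[f̃, f̃]`, are orthogonal. -/
def pairingShape : TripleType → Bool × Bool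
  | Chalf_N => (true, false)
  | C0_C0 _ _ => (false, true)
  | F_Fii _ _ => (false, false)
  | _ => (true, true)

/-- The shape `s` describes the vanishing of the brackets `k`. -/
def HasShape (k : Brackets21) (s : Bool × Bool × Bool) : Prop :=
  ((k.bb 0 = 0 ∧ k.bb 1 = 0) ↔ s.1 = true) ∧
  (((k.bb 0 = 0 ∧ k.bb 1 = 0) ∧ (k.bf 0 = 0 ∧ k.bf 1 = 0)) ↔ s.2.1 = true) ∧
  ((k.ff 0 = 0 ∧ k.ff 1 = 0) ↔ s.2.2 = true)

theorem HasShape.unique {k : Brackets21} {s s' : Bool × Bool × Bool} (h : HasShape k s)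
    (h' : HasShape k s') : s = s' :=
  Prod.ext (Bool.eq_iff_iff.2 (h.1.symm.trans h'.1))
    (Prod.ext (Bool.eq_iff_iff.2 (h.2.1.symm.trans h'.2.1))
      (Bool.eq_iff_iff.2 (h.2.2.symm.trans h'.2.2)))

theorem HasShape.apply {k : Brackets21} {s : Bool × Bool × Bool} (h : HasShape k s)
    (P : BaseChange) : HasShape (P.apply k) s := by
  rwa [HasShape, P.apply_bb_eq_zero_iff, P.apply_bf_eq_zero_iff, P.apply_ff_eq_zero_iff]

theorem hasShape_left (t : TripleType) : HasShape t.left t.leftShape := by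
  cases t <;> simp [HasShape, left, leftShape, A, N, S, C, F]

theorem hasShape_right (t : TripleType) : HasShape t.right t.rightShape := by
  cases t with
  | C0_C0 κ hκ => simp [HasShape, right, rightShape, hκ]
  | F_Fii κ hκ => simp [HasShape, right, rightShape, hκ]
  | _ => simp [HasShape, right, rightShape, A]

theorem bb_pairing_iff (t : TripleType) :
    t.right.bb 0 * t.left.bb 0 + t.right.bb 1 * t.left.bb 1 = 0 ↔
      t.pairingShape.1 = true := by
  cases t with
  | C0_C0 κ hκ => simp [left, right, pairingShape, C, hκ]
  | F_Fii κ hκ => simp [left, right, pairingShape, F, hκ]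
  | _ => simp [left, right, pairingShape, A, N, S, C, F]

theorem ff_pairing_iff (t : TripleType) :
    t.right.ff 0 * t.left.bb 0 + t.right.ff 1 * t.left.bb 1 = 0 ↔
      t.pairingShape.2 = true := by
  cases t with
  | C0_C0 κ hκ => simp [left, right, pairingShape, C]
  | F_Fii κ hκ => simp [left, right, pairingShape, F, hκ]
  | _ => simp [left, right, pairingShape, A, N, S, C, F]

theorem unit_eq_of_mul_sq {ε ε' : ℤˣ} {r : ℝ}
    (h : ((ε' : ℤ) : ℝ) = r ^ 2 * ((ε : ℤ) : ℝ)) : ε' = ε := by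
  have := sq_nonneg r
  rcases Int.units_eq_one_or ε with rfl | rfl <;>
    rcases Int.units_eq_one_or ε' with rfl | rfl <;> simp at h ⊢ <;> linarith

/-- A change of bases preserving `[b₁, b₂] = b₂`. -/
theorem baseChange_of_bb {P : BaseChange} (h₁ : P.det = 0 ∨ P.b' = 0) (h₂ : P.det * P.d' = 1) :
    P.a = 1 ∧ P.c = 0 := by
  have hb : P.b' = 0 := by simpa [P.det_ne_zero] using h₁
  have hdet := P.det_mul_det_dual
  have hd : P.d' ≠ 0 := right_ne_zero_of_mul_eq_one h₂
  obtain ⟨t1, t2, -, -⟩ := P.transpose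
  have ha := P.aa
  simp only [BaseChange.det, BaseChange.dual] at hdet h₂
  rw [hb] at hdet t2 ha
  have ha' : P.a' = 1 := by linear_combination hdet - P.a' * h₂
  rw [ha'] at ha
  refine ⟨by linarith, ?_⟩
  have : P.c * P.d' = 0 := by linarith
  simpa [hd] using this

/-- The listed supertriples are determined by their brackets up to a change of bases. -/
theorem eq_of_baseChange {t t' : TripleType} (P : BaseChange) (hl : t'.left = P.apply t.left)
    (hr : t'.right = P.dual.apply t.right) : t = t' := by
  have sl : t'.leftShape = t.leftShape :=
    (hl ▸ hasShape_left t').unique (t.hasShape_left.apply P)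
  have sr : t'.rightShape = t.rightShape :=
    (hr ▸ hasShape_right t').unique (t.hasShape_right.apply P.dual)
  have hbb := P.dual_bb_pairing t.left t.right
  have p1 : t'.pairingShape.1 = t.pairingShape.1 := by
    rw [Bool.eq_iff_iff, ← bb_pairing_iff, ← bb_pairing_iff, hl, hr, hbb]
  have p2 : t'.pairingShape.2 = t.pairingShape.2 := by
    rw [Bool.eq_iff_iff, ← ff_pairing_iff, ← ff_pairing_iff, hl, hr, P.dual_ff_pairing]
  rw [← hl, ← hr] at hbb
  have l0 := congrArg (fun k => k.bb 0) hl
  have l1 := congrArg (fun k => k.bb 1) hl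
  have l2 := congrArg (fun k => k.bf 0) hl
  have l3 := congrArg (fun k => k.bf 1) hl
  have l5 := congrArg (fun k => k.ff 1) hl
  have r0 := congrArg (fun k => k.bb 0) hr
  have r4 := congrArg (fun k => k.ff 0) hr
  clear hl hr
  -- Shapes and pairings exclude all pairs from different families; what remains are the families
  -- with a parameter.
  cases t <;> cases t' <;> first
    | rfl
    | (simp [leftShape] at sl; done)
    | (simp [rightShape] at sr; done)
    | (simp [pairingShape] at p1; done)
    | (simp [pairingShape] at p2; done)
    | skip
  all_goals clear sl sr p1 p2
  · simp [left, right, S, BaseChange.apply, BaseChange.dual] at l2 r4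
    congr
    exact (unit_eq_of_mul_sq (by rw [r4, ← l2, mul_one])).symm
  · simp [left, C, BaseChange.apply] at l0 l1 l2
    obtain ⟨ha, -⟩ := baseChange_of_bb l0 l1.symm
    rw [l2, ha, one_mul]
  · simp [left, right, C, BaseChange.apply, BaseChange.dual] at l0 l1 l2 r4
    obtain ⟨ha, -⟩ := baseChange_of_bb l0 l1.symm
    rw [ha, mul_one] at r4
    rw [l2, ha, one_mul, unit_eq_of_mul_sq r4]
  · simp [left, C, BaseChange.apply] at l0 l1 l2
    obtain ⟨ha, -⟩ := baseChange_of_bb l0 l1.symm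
    rw [l2, ha, one_mul]
  · simp [left, right, C] at hbb
    simp [hbb]
  · simp [left, right, F, BaseChange.apply, BaseChange.dual] at l0 l1 l5 r0
    obtain ⟨ha, -⟩ := baseChange_of_bb l0 l1.symm
    have hdet := P.det_mul_det_dual
    -- Preserving [f,f] = b₂ and [b₁,b₂] = b₂ makes the determinant a square, hence the sign ε of
    -- [b̃¹,b̃²] cannot change.
    have hd : P.det = P.u ^ 2 := by linear_combination P.det * l5 - P.u ^ 2 * l1
    have hdet' : P.dual.det = P.u' ^ 2 := by
      have huu : P.u ^ 2 * P.u' ^ 2 = 1 := by rw [← mul_pow, P.uu, one_pow]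
      rw [hd] at hdet
      exact mul_left_cancel₀ (pow_ne_zero 2 P.u_ne_zero) (hdet.trans huu.symm)
    rename_i ε ε'
    have r0' : ((ε' : ℤ) : ℝ) = P.dual.det * (((ε : ℤ) : ℝ) * P.a) := r0
    rw [hdet', ha, mul_one] at r0'
    rw [unit_eq_of_mul_sq r0']
  · simp [left, right, F, BaseChange.apply, BaseChange.dual] at l0 l1 r4
    obtain ⟨ha, -⟩ := baseChange_of_bb l0 l1.symm
    rw [ha, mul_one] at r4
    rw [unit_eq_of_mul_sq r4]
  · simp [left, right, F] at hbb
    simp [hbb]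

/-- If the dual of a listed supertriple is listed up to a change of bases, only the parameters
`p` and `ε` in `(C¹_p|C¹_{-p})` and `(F|F.i,ε)` change. -/
theorem eq_flip_of_baseChange {t t' : TripleType} (P : BaseChange)
    (hl : t'.left = P.apply t.right) (hr : t'.right = P.dual.apply t.left) : t' = t.flip := by
  have sl : t'.leftShape = t.rightShape :=
    (hl ▸ hasShape_left t').unique (t.hasShape_right.apply P)
  have sr : t'.rightShape = t.leftShape :=
    (hr ▸ hasShape_right t').unique (t.hasShape_left.apply P.dual)
  have hbb := P.dual_bb_pairing t.right t.left
  rw [add_comm (t.left.bb 0 * _), mul_comm (t.left.bb 0), mul_comm (t.left.bb 1),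
    add_comm (t.right.bb 1 * _)] at hbb
  have p1 : t'.pairingShape.1 = t.pairingShape.1 := by
    rw [Bool.eq_iff_iff, ← bb_pairing_iff, ← bb_pairing_iff, hl, hr, hbb]
  rw [← hl, ← hr] at hbb
  have l0 := congrArg (fun k => k.bb 0) hl
  have l1 := congrArg (fun k => k.bb 1) hl
  have l2 := congrArg (fun k => k.bf 0) hl
  have r4 := congrArg (fun k => k.ff 0) hr
  clear hl hr
  -- Only families whose two halves have equal shapes can contain their own duals; those with
  -- parameters are C_C, C0_C0, F_Fi and F_Fii.
  cases t <;> cases t' <;> first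
    | rfl
    | (simp [leftShape, rightShape] at sl; done)
    | (simp [leftShape, rightShape] at sr; done)
    | (simp [pairingShape] at p1; done)
    | skip
  all_goals clear sl sr p1
  · simp [left, right, C, BaseChange.apply] at l0 l1 l2
    rename_i p p'
    have ha : P.a' = 0 := l0.resolve_left P.det_ne_zero
    have hdet := P.det_mul_det_dual
    have haa := P.aa
    simp only [BaseChange.det, BaseChange.dual] at hdet l1
    rw [ha] at hdet haa
    have hb' : P.b' = -1 := by linear_combination P.b' * l1 - hdet
    rw [hb'] at haa
    rw [flip, l2, show P.b = -1 by linarith, neg_one_mul]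
  · simp [left, right, C] at hbb
    simp [flip, hbb]
  · simp [left, right, F, BaseChange.apply, BaseChange.dual] at l0 l1 l2 r4
    rename_i ε ε'
    -- The weight 1/2 of f is now produced by the weight -ε/2 of f̃, which fixes this entry as -ε;
    -- the odd square then inherits its sign.
    have hb : P.b = ((-ε : ℤˣ) : ℤ) := by
      rcases Int.units_eq_one_or ε with rfl | rfl <;> simp at l2 ⊢ <;> linarith
    rw [hb] at r4
    rw [flip, unit_eq_of_mul_sq r4]
  · simp [left, right, F] at hbb
    simp [flip, hbb]

end TripleType

/-! ### Isomorphisms and transport of frames. -/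

namespace MetricLieSuperalgebra

variable {V : Type*} [AddCommGroup V] [Module ℝ V]
variable {V' : Type*} [AddCommGroup V'] [Module ℝ V']
variable {D : MetricLieSuperalgebra V} {D' : MetricLieSuperalgebra V'}
variable {k l : Brackets21} {e : Fin 6 → V} {e' : Fin 6 → V'}

theorem map_leftSpan (P : V →ₗ[ℝ] V') (e : Fin 6 → V) :
    (leftSpan e).map P = leftSpan (P ∘ e) := by
  rw [leftSpan, Submodule.map_span]
  simp [leftSpan, Set.image_insert_eq]

theorem map_rightSpan (P : V →ₗ[ℝ] V') (e : Fin 6 → V) :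
    (rightSpan e).map P = rightSpan (P ∘ e) := by
  rw [rightSpan, Submodule.map_span]
  simp [rightSpan, Set.image_insert_eq]

theorem Frame.map (h : Frame D k l e) {P : V ≃ₗ[ℝ] V'} (hP : D.IsIso D' P) :
    Frame D' k l (P ∘ e) where
  mem i := hP.map_part _ _ (h.mem i)
  gram i j := by rw [← h.gram, hP.map_form]; rfl
  top := by
    rw [Set.range_comp, ← LinearEquiv.coe_coe, ← Submodule.map_span, h.top, Submodule.map_top,
      LinearEquiv.range]
  left := by
    obtain ⟨h₁, h₂, h₃⟩ := h.left
    refine ⟨?_, fun i => ?_, ?_⟩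
    · simpa [hP.map_bracket] using congrArg P h₁
    · have := congrArg P (h₂ i)
      fin_cases i <;> simpa [hP.map_bracket] using this
    · simpa [hP.map_bracket] using congrArg P h₃
  right := by
    obtain ⟨h₁, h₂, h₃⟩ := h.right
    refine ⟨?_, fun i => ?_, ?_⟩
    · simpa [hP.map_bracket] using congrArg P h₁
    · have := congrArg P (h₂ i)
      fin_cases i <;> simpa [hP.map_bracket] using this
    · simpa [hP.map_bracket] using congrArg P h₃

/-- Frames with the same brackets are related by an isomorphism. -/
theorem Frame.exists_isIso (h : Frame D k l e) (h' : Frame D' k l e') :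
    ∃ P : V ≃ₗ[ℝ] V', D.IsIso D' P ∧ P ∘ e = e' := by
  have hP : ∀ i, h.basis.equiv h'.basis (Equiv.refl _) (e i) = e' i := fun i => by
    simpa using h.basis.equiv_apply i h'.basis (Equiv.refl _)
  generalize h.basis.equiv h'.basis (Equiv.refl _) = P at hP
  refine ⟨P, ⟨fun i x hx => ?_, fun x y => ?_, fun x y => ?_⟩, funext hP⟩
  · rw [h.part_eq] at hx
    rw [h'.part_eq]
    have := Submodule.mem_map_of_mem (f := (P : V →ₗ[ℝ] V')) hx
    rw [Submodule.map_span, ← Set.image_comp] at this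
    rwa [← show P ∘ e = e' from funext hP]
  · have : D.bracket.compr₂ (P : V →ₗ[ℝ] V') =
        D'.bracket.compl₁₂ (P : V →ₗ[ℝ] V') (P : V →ₗ[ℝ] V') :=
      LinearMap.ext_basis h.basis h.basis fun i j => by
        simp [h.bracket_eq, h'.bracket_eq, hP]
    exact LinearMap.congr_fun₂ this x y
  · have : D.form = D'.form.compl₁₂ (P : V →ₗ[ℝ] V') (P : V →ₗ[ℝ] V') :=
      LinearMap.ext_basis h.basis h.basis fun i j => by simp [h.gram, h'.gram, hP]
    exact LinearMap.congr_fun₂ this x y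

theorem HasType.map {t : TripleType} (h : D.HasType t) (hD : D.Isomorphic D') : D'.HasType t := by
  obtain ⟨e, he⟩ := h
  obtain ⟨P, hP⟩ := hD
  exact ⟨_, he.map hP⟩

theorem HasType.isomorphic {t : TripleType} (h : D.HasType t) (h' : D'.HasType t) :
    D.Isomorphic D' := by
  obtain ⟨e, he⟩ := h
  obtain ⟨e', he'⟩ := h'
  obtain ⟨P, hP, -⟩ := he.exists_isIso he'
  exact ⟨P, hP⟩

theorem HasFrame.map {S St : Submodule ℝ V} {S' St' : Submodule ℝ V'} (h : D.HasFrame S St k l)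
    (hD : D.TripleIsomorphic S St D' S' St') : D'.HasFrame S' St' k l := by
  obtain ⟨e, he, rfl, rfl⟩ := h
  obtain ⟨P, hP, rfl, rfl⟩ := hD
  exact ⟨_, he.map hP, (map_leftSpan _ e).symm, (map_rightSpan _ e).symm⟩

theorem HasFrame.tripleIsomorphic {S St : Submodule ℝ V} {S' St' : Submodule ℝ V'}
    (h : D.HasFrame S St k l) (h' : D'.HasFrame S' St' k l) :
    D.TripleIsomorphic S St D' S' St' := by
  obtain ⟨e, he, rfl, rfl⟩ := h
  obtain ⟨e', he', rfl, rfl⟩ := h'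
  obtain ⟨P, hP, rfl⟩ := he.exists_isIso he'
  exact ⟨P, hP, map_leftSpan _ e, map_rightSpan _ e⟩

end MetricLieSuperalgebra

/-! ### Models on ℝ⁶. -/

namespace MetricLieSuperalgebra

variable (k l : Brackets21)

@[simp] theorem evenBracket_zero_left (y : Fin 4 → ℝ) : evenBracket k l 0 y = 0 := by
  ext i; fin_cases i <;> simp [evenBracket]

@[simp] theorem evenBracket_zero_right (x : Fin 4 → ℝ) : evenBracket k l x 0 = 0 := by
  ext i; fin_cases i <;> simp [evenBracket]

@[simp] theorem evenOddBracket_zero_left (y : Fin 2 → ℝ) : evenOddBracket k l 0 y = 0 := by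
  ext i; fin_cases i <;> simp [evenOddBracket]

@[simp] theorem evenOddBracket_zero_right (x : Fin 4 → ℝ) : evenOddBracket k l x 0 = 0 := by
  ext i; fin_cases i <;> simp [evenOddBracket]

@[simp] theorem evenOddBracket_neg_right (x : Fin 4 → ℝ) (y : Fin 2 → ℝ) :
    evenOddBracket k l x (-y) = -evenOddBracket k l x y := by
  ext i; fin_cases i <;> simp [evenOddBracket] <;> ring

@[simp] theorem oddBracket_zero_left (y : Fin 2 → ℝ) : oddBracket k l 0 y = 0 := by
  ext i; fin_cases i <;> simp [oddBracket]

@[simp] theorem oddBracket_zero_right (x : Fin 2 → ℝ) : oddBracket k l x 0 = 0 := by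
  ext i; fin_cases i <;> simp [oddBracket]

@[simp] theorem oddBracket_neg_right (x y : Fin 2 → ℝ) :
    oddBracket k l x (-y) = -oddBracket k l x y := by
  ext i; fin_cases i <;> simp [oddBracket] <;> ring

theorem evenBracket_skew (x y : Fin 4 → ℝ) : evenBracket k l x y = -evenBracket k l y x := by
  ext i; fin_cases i <;> simp [evenBracket] <;> ring

theorem oddBracket_symm (x y : Fin 2 → ℝ) : oddBracket k l x y = oddBracket k l y x := by
  ext i; fin_cases i <;> simp [oddBracket] <;> ring

/-- The even coordinates of a vector. -/
def evenCoord : (Fin 6 → ℝ) →ₗ[ℝ] Fin 4 → ℝ := LinearMap.funLeft ℝ ℝ ![0, 1, 3, 4]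

/-- The odd coordinates of a vector. -/
def oddCoord : (Fin 6 → ℝ) →ₗ[ℝ] Fin 2 → ℝ := LinearMap.funLeft ℝ ℝ ![2, 5]

/-- The vector with the given even and odd coordinates. -/
def ofCoord (x : Fin 4 → ℝ) (y : Fin 2 → ℝ) : Fin 6 → ℝ := ![x 0, x 1, y 0, x 2, x 3, y 1]

@[simp] theorem evenCoord_ofCoord (x : Fin 4 → ℝ) (y : Fin 2 → ℝ) :
    evenCoord (ofCoord x y) = x := by
  ext i; fin_cases i <;> simp [evenCoord, ofCoord, LinearMap.funLeft]

@[simp] theorem oddCoord_ofCoord (x : Fin 4 → ℝ) (y : Fin 2 → ℝ) :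
    oddCoord (ofCoord x y) = y := by
  ext i; fin_cases i <;> simp [oddCoord, ofCoord, LinearMap.funLeft]

theorem ofCoord_coord (v : Fin 6 → ℝ) : ofCoord (evenCoord v) (oddCoord v) = v := by
  ext i; fin_cases i <;> simp [evenCoord, oddCoord, ofCoord, LinearMap.funLeft]

theorem ofCoord_add (x x' : Fin 4 → ℝ) (y y' : Fin 2 → ℝ) :
    ofCoord (x + x') (y + y') = ofCoord x y + ofCoord x' y' := by
  ext i; fin_cases i <;> simp [ofCoord]

theorem ofCoord_smul (c : ℝ) (x : Fin 4 → ℝ) (y : Fin 2 → ℝ) :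
    ofCoord (c • x) (c • y) = c • ofCoord x y := by
  ext i; fin_cases i <;> simp [ofCoord]

theorem ofCoord_neg (x : Fin 4 → ℝ) (y : Fin 2 → ℝ) : ofCoord (-x) (-y) = -ofCoord x y := by
  ext i; fin_cases i <;> simp [ofCoord]

@[simp] theorem ofCoord_eq_zero {x : Fin 4 → ℝ} {y : Fin 2 → ℝ} :
    ofCoord x y = 0 ↔ x = 0 ∧ y = 0 := by
  refine ⟨fun h => ⟨?_, ?_⟩, ?_⟩
  · simpa using congrArg evenCoord h
  · simpa using congrArg oddCoord h
  · rintro ⟨rfl, rfl⟩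
    ext i; fin_cases i <;> simp [ofCoord]

/-- The bracket on `ℝ⁶` with the standard basis as a frame. -/
def modelBracket : (Fin 6 → ℝ) →ₗ[ℝ] (Fin 6 → ℝ) →ₗ[ℝ] Fin 6 → ℝ :=
  LinearMap.mk₂ ℝ (fun v w => ofCoord
      (evenBracket k l (evenCoord v) (evenCoord w) + oddBracket k l (oddCoord v) (oddCoord w))
      (evenOddBracket k l (evenCoord v) (oddCoord w)
        - evenOddBracket k l (evenCoord w) (oddCoord v)))
    (fun v v' w => by
      rw [← ofCoord_add, map_add, map_add]
      congr 1 <;> ext i <;> fin_cases i <;> simp [evenBracket, oddBracket, evenOddBracket] <;> ring)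
    (fun c v w => by
      rw [← ofCoord_smul, map_smul, map_smul]
      congr 1 <;> ext i <;> fin_cases i <;> simp [evenBracket, oddBracket, evenOddBracket] <;> ring)
    (fun v w w' => by
      rw [← ofCoord_add, map_add, map_add]
      congr 1 <;> ext i <;> fin_cases i <;> simp [evenBracket, oddBracket, evenOddBracket] <;> ring)
    (fun c v w => by
      rw [← ofCoord_smul, map_smul, map_smul]
      congr 1 <;> ext i <;> fin_cases i <;> simp [evenBracket, oddBracket, evenOddBracket] <;> ring)

/-- The form on `ℝ⁶` with the standard basis as a frame. -/
def modelForm : LinearMap.BilinForm ℝ (Fin 6 → ℝ) :=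
  LinearMap.mk₂ ℝ (fun v w => evenForm (evenCoord v) (evenCoord w)
      + oddForm (oddCoord v) (oddCoord w))
    (fun v v' w => by simp [evenForm, oddForm]; ring)
    (fun c v w => by simp [evenForm, oddForm]; ring)
    (fun v w w' => by simp [evenForm, oddForm]; ring)
    (fun c v w => by simp [evenForm, oddForm]; ring)

@[simp] theorem modelBracket_ofCoord (x x' : Fin 4 → ℝ) (y y' : Fin 2 → ℝ) :
    modelBracket k l (ofCoord x y) (ofCoord x' y') =
      ofCoord (evenBracket k l x x' + oddBracket k l y y')
        (evenOddBracket k l x y' - evenOddBracket k l x' y) := by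
  simp [modelBracket]

@[simp] theorem modelForm_ofCoord (x x' : Fin 4 → ℝ) (y y' : Fin 2 → ℝ) :
    modelForm (ofCoord x y) (ofCoord x' y') = evenForm x x' + oddForm y y' := by
  simp [modelForm]

/-- The grading on `ℝ⁶`. -/
def modelPart : ZMod 2 → Submodule ℝ (Fin 6 → ℝ) :=
  ![LinearMap.ker oddCoord, LinearMap.ker evenCoord]

theorem mem_modelPart_zero {v : Fin 6 → ℝ} : v ∈ modelPart 0 ↔ ∃ x, v = ofCoord x 0 := by
  change oddCoord v = 0 ↔ _
  refine ⟨fun h => ⟨evenCoord v, ?_⟩, ?_⟩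
  · rw [← h, ofCoord_coord]
  · rintro ⟨x, rfl⟩; simp

theorem mem_modelPart_one {v : Fin 6 → ℝ} : v ∈ modelPart 1 ↔ ∃ y, v = ofCoord 0 y := by
  change evenCoord v = 0 ↔ _
  refine ⟨fun h => ⟨oddCoord v, ?_⟩, ?_⟩
  · rw [← h, ofCoord_coord]
  · rintro ⟨x, rfl⟩; simp

theorem cases_of_mem_modelPart {i : ZMod 2} {v : Fin 6 → ℝ} (hv : v ∈ modelPart i) :
    (i = 0 ∧ ∃ x, v = ofCoord x 0) ∨ (i = 1 ∧ ∃ y, v = ofCoord 0 y) := by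
  fin_cases i
  · exact .inl ⟨rfl, mem_modelPart_zero.1 hv⟩
  · exact .inr ⟨rfl, mem_modelPart_one.1 hv⟩

/-- The super Jacobi identities in coordinates. -/
structure CoordJacobi : Prop where
  even : ∀ x y z, evenBracket k l x (evenBracket k l y z) + evenBracket k l y (evenBracket k l z x)
    + evenBracket k l z (evenBracket k l x y) = 0
  even_odd : ∀ x y u, evenOddBracket k l (evenBracket k l x y) u =
    evenOddBracket k l x (evenOddBracket k l y u) - evenOddBracket k l y (evenOddBracket k l x u)
  odd_even : ∀ x u v, evenBracket k l x (oddBracket k l u v) =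
    oddBracket k l (evenOddBracket k l x u) v + oddBracket k l u (evenOddBracket k l x v)
  odd : ∀ u v w, evenOddBracket k l (oddBracket k l u v) w +
    evenOddBracket k l (oddBracket k l v w) u + evenOddBracket k l (oddBracket k l w u) v = 0

variable {k l}

/-- The model of a double with the brackets `k` and `l` on `ℝ⁶`. -/
def model (h : CoordJacobi k l) : MetricLieSuperalgebra (Fin 6 → ℝ) where
  part := modelPart
  isCompl := by
    rw [isCompl_iff, Submodule.disjoint_def, codisjoint_iff, Submodule.eq_top_iff']
    refine ⟨fun v h₀ h₁ => ?_, fun v => ?_⟩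
    · rw [← ofCoord_coord v, show oddCoord v = 0 from h₀, show evenCoord v = 0 from h₁]
      ext i; fin_cases i <;> simp [ofCoord]
    · rw [← ofCoord_coord v, ← add_zero (evenCoord v), ← zero_add (oddCoord v), ofCoord_add]
      exact Submodule.add_mem_sup (mem_modelPart_zero.2 ⟨_, rfl⟩) (mem_modelPart_one.2 ⟨_, rfl⟩)
  bracket := modelBracket k l
  bracket_mem i j x hx y hy := by
    rcases cases_of_mem_modelPart hx with ⟨rfl, x, rfl⟩ | ⟨rfl, x, rfl⟩ <;>
      rcases cases_of_mem_modelPart hy with ⟨rfl, y, rfl⟩ | ⟨rfl, y, rfl⟩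
    · exact mem_modelPart_zero.2 ⟨_, by simp; rfl⟩
    · exact mem_modelPart_one.2 ⟨_, by simp; rfl⟩
    · exact mem_modelPart_one.2 ⟨_, by simp; rfl⟩
    · exact mem_modelPart_zero.2 ⟨_, by simp; rfl⟩
  skew i j x hx y hy := by
    rcases cases_of_mem_modelPart hx with ⟨rfl, x, rfl⟩ | ⟨rfl, x, rfl⟩ <;>
      rcases cases_of_mem_modelPart hy with ⟨rfl, y, rfl⟩ | ⟨rfl, y, rfl⟩
    · simp [koszulSign, evenBracket_skew k l x y, ← ofCoord_neg]
    · simp [koszulSign, ← ofCoord_neg]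
    · simp [koszulSign, ← ofCoord_neg]
    · simp [koszulSign, ZMod.val_one, oddBracket_symm k l x y]
  jacobi i j n x hx y hy z hz := by
    rcases cases_of_mem_modelPart hx with ⟨rfl, x, rfl⟩ | ⟨rfl, x, rfl⟩ <;>
      rcases cases_of_mem_modelPart hy with ⟨rfl, y, rfl⟩ | ⟨rfl, y, rfl⟩ <;>
      rcases cases_of_mem_modelPart hz with ⟨rfl, z, rfl⟩ | ⟨rfl, z, rfl⟩ <;>
      -- The eight parity patterns reduce, by skewness and symmetry, to the four identities of
      -- `CoordJacobi`.
      simp [koszulSign, ZMod.val_one, ← ofCoord_add, ← ofCoord_neg, ofCoord_eq_zero]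
    · exact h.even x y z
    · rw [h.even_odd]; abel
    · rw [h.even_odd]; abel
    · rw [h.odd_even, oddBracket_symm k l z]; abel
    · rw [h.even_odd]; abel
    · rw [h.odd_even, oddBracket_symm k l z, oddBracket_symm k l _ x]; abel
    · rw [h.odd_even, oddBracket_symm k l _ y]; abel
    · rw [← h.odd x y z]; abel
  form := modelForm
  nondegenerate := by
    refine ⟨fun v hv => ?_, fun v hv => ?_⟩ <;> rw [← ofCoord_coord v] at hv ⊢ <;>
      generalize evenCoord v = x at hv ⊢ <;> generalize oddCoord v = y at hv ⊢ <;>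
      have h0 := hv (ofCoord ![0, 0, 1, 0] 0) <;> have h1 := hv (ofCoord ![0, 0, 0, 1] 0) <;>
      have h2 := hv (ofCoord ![1, 0, 0, 0] 0) <;> have h3 := hv (ofCoord ![0, 1, 0, 0] 0) <;>
      have h4 := hv (ofCoord 0 ![0, 1]) <;> have h5 := hv (ofCoord 0 ![1, 0]) <;>
      simp [evenForm, oddForm] at h0 h1 h2 h3 h4 h5 <;>
      exact ofCoord_eq_zero.2 ⟨by ext i; fin_cases i <;> assumption,
        by ext i; fin_cases i <;> assumption⟩
  supersymmetric i j x hx y hy := by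
    rcases cases_of_mem_modelPart hx with ⟨rfl, x, rfl⟩ | ⟨rfl, x, rfl⟩ <;>
      rcases cases_of_mem_modelPart hy with ⟨rfl, y, rfl⟩ | ⟨rfl, y, rfl⟩ <;>
      simp [koszulSign, ZMod.val_one, evenForm, oddForm] <;> ring
  invariant i j n x hx y hy z hz := by
    rcases cases_of_mem_modelPart hx with ⟨rfl, x, rfl⟩ | ⟨rfl, x, rfl⟩ <;>
      rcases cases_of_mem_modelPart hy with ⟨rfl, y, rfl⟩ | ⟨rfl, y, rfl⟩ <;>
      rcases cases_of_mem_modelPart hz with ⟨rfl, z, rfl⟩ | ⟨rfl, z, rfl⟩ <;>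
      simp [koszulSign, ZMod.val_one, evenForm, oddForm, evenBracket, oddBracket,
        evenOddBracket] <;>
      ring

/-- The standard frame of the model. -/
def modelFrame : Fin 6 → Fin 6 → ℝ :=
  ![ofCoord ![1, 0, 0, 0] 0, ofCoord ![0, 1, 0, 0] 0, ofCoord 0 ![1, 0], ofCoord ![0, 0, 1, 0] 0,
    ofCoord ![0, 0, 0, 1] 0, ofCoord 0 ![0, 1]]

theorem model_frame (h : CoordJacobi k l) : Frame (model h) k l modelFrame := by
  have gram : ∀ i j, (model h).form (modelFrame i) (modelFrame j) = frameGram i j := by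
    intro i j
    change modelForm _ _ = _
    fin_cases i <;> fin_cases j <;> simp [modelFrame, frameGram, evenForm, oddForm]
  refine ⟨?_, gram, ?_, ⟨?_, ?_, ?_⟩, ⟨?_, ?_, ?_⟩⟩
  · intro i
    change _ ∈ modelPart _
    fin_cases i
    · exact mem_modelPart_zero.2 ⟨_, rfl⟩
    · exact mem_modelPart_zero.2 ⟨_, rfl⟩
    · exact mem_modelPart_one.2 ⟨_, rfl⟩
    · exact mem_modelPart_zero.2 ⟨_, rfl⟩
    · exact mem_modelPart_zero.2 ⟨_, rfl⟩
    · exact mem_modelPart_one.2 ⟨_, rfl⟩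
  · exact ((model h).linearIndependent_of_gram gram).span_eq_top_of_card_eq_finrank (by simp)
  · change modelBracket k l _ _ = _
    simp [modelFrame]
    ext i
    fin_cases i <;> simp [ofCoord, evenBracket]
  · intro i
    change modelBracket k l _ _ = _
    fin_cases i <;> simp [modelFrame] <;> ext j <;> fin_cases j <;> simp [ofCoord, evenOddBracket]
  · change modelBracket k l _ _ = _
    simp [modelFrame]
    ext i
    fin_cases i <;> simp [ofCoord, oddBracket]
  · change modelBracket k l _ _ = _
    simp [modelFrame]
    ext i
    fin_cases i <;> simp [ofCoord, evenBracket]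
  · intro i
    change modelBracket k l _ _ = _
    fin_cases i <;> simp [modelFrame] <;> ext j <;> fin_cases j <;> simp [ofCoord, evenOddBracket]
  · change modelBracket k l _ _ = _
    simp [modelFrame]
    ext i
    fin_cases i <;> simp [ofCoord, oddBracket]

/-- One representative per class suffices, because the others are further decompositions of the same
double. For it the identities are polynomial. -/
theorem coordJacobi_rep (c : DoubleClass) : CoordJacobi c.rep.left c.rep.right := by
  constructor
  · intro x y z
    ext i
    cases c <;> fin_cases i <;> simp [DoubleClass.rep, TripleType.left, TripleType.right,
      Brackets21.A, Brackets21.N, Brackets21.S, Brackets21.C, Brackets21.F, evenBracket] <;> ring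
  · intro x y z
    ext i
    cases c <;> fin_cases i <;> simp [DoubleClass.rep, TripleType.left, TripleType.right,
      Brackets21.A, Brackets21.N, Brackets21.S, Brackets21.C, Brackets21.F, evenBracket,
      evenOddBracket] <;> ring
  · intro x y z
    ext i
    cases c <;> fin_cases i <;> simp [DoubleClass.rep, TripleType.left, TripleType.right,
      Brackets21.A, Brackets21.N, Brackets21.S, Brackets21.C, Brackets21.F, evenBracket,
      evenOddBracket, oddBracket] <;> ring
  · intro x y z
    ext i
    cases c <;> fin_cases i <;> simp [DoubleClass.rep, TripleType.left, TripleType.right,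
      Brackets21.A, Brackets21.N, Brackets21.S, Brackets21.C, Brackets21.F,
      evenOddBracket, oddBracket] <;> ring

theorem exists_hasType_rep (c : DoubleClass) :
    ∃ D : MetricLieSuperalgebra (Fin 6 → ℝ), D.HasType c.rep :=
  ⟨_, _, model_frame (coordJacobi_rep c)⟩

end MetricLieSuperalgebra

/-! ### Assembly of the theorem. -/

namespace MetricLieSuperalgebra

variable {V : Type*} [AddCommGroup V] [Module ℝ V]
variable {V' : Type*} [AddCommGroup V'] [Module ℝ V']
variable {D : MetricLieSuperalgebra V} {D' : MetricLieSuperalgebra V'}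

/-- Every supertriple is listed in some class, up to T-duality. -/
theorem IsManinSupertriple.exists_class {S St : Submodule ℝ V} (h : D.IsManinSupertriple S St)
    (hdim : D.HasSuperdim 4 2) :
    ∃ c : DoubleClass, ∃ t ∈ c.triples, D.IsOfType t S St ∨ D.IsDualOfType t S St := by
  obtain ⟨t, ht | ht⟩ := h.classify hdim
  · obtain ⟨c, t', ht', H | H⟩ := ht.exists_class
    · exact ⟨c, t', ht', .inl H⟩
    · exact ⟨c, t', ht', .inr ⟨h, H⟩⟩
  · obtain ⟨c, t', ht', H | H⟩ := ht.exists_class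
    · exact ⟨c, t', ht', .inr ⟨h, H⟩⟩
    · exact ⟨c, t', ht', .inl H⟩

theorem belongsTo_of_isOfType_or {c : DoubleClass} {t : TripleType} (ht : t ∈ c.triples)
    {S St : Submodule ℝ V} (h : D.IsOfType t S St ∨ D.IsDualOfType t S St) : D.BelongsTo c :=
  h.elim (fun H => ⟨t, ht, S, St, H⟩) fun H => ⟨t, ht, St, S, H.2⟩

theorem BelongsTo.unique {c c' : DoubleClass} (h : D.BelongsTo c) (h' : D.BelongsTo c') : c = c' :=
  class_unique (belongsTo_iff.1 h) (belongsTo_iff.1 h')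

theorem isomorphic_iff {c c' : DoubleClass} (h : D.BelongsTo c) (h' : D'.BelongsTo c') :
    D.Isomorphic D' ↔ c = c' := by
  rw [belongsTo_iff] at h h'
  refine ⟨fun hD => class_unique (h.map hD) h', ?_⟩
  rintro rfl
  exact h.isomorphic h'

theorem IsOfType.hasFrame {t : TripleType} {S St : Submodule ℝ V} (h : D.IsOfType t S St) :
    D.HasFrame S St t.left t.right := isOfType_iff.1 h

theorem tripleIsomorphic_iff {t t' : TripleType} {S St : Submodule ℝ V} {S' St' : Submodule ℝ V'}
    (h : D.IsOfType t S St) (h' : D'.IsOfType t' S' St') :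
    D.TripleIsomorphic S St D' S' St' ↔ t = t' := by
  refine ⟨fun hD => ?_, ?_⟩
  · obtain ⟨P, hl, hr⟩ := (h.hasFrame.map hD).exists_baseChange h'.hasFrame
    exact TripleType.eq_of_baseChange P hl hr
  · rintro rfl
    exact h.hasFrame.tripleIsomorphic h'.hasFrame

theorem TripleIsomorphic.eq_flip {t t' : TripleType} {S St : Submodule ℝ V}
    {S' St' : Submodule ℝ V'} (h : D.IsOfType t S St) (h' : D'.IsOfType t' S' St')
    (hD : D.TripleIsomorphic St S D' S' St') : t' = t.flip := by
  obtain ⟨P, hl, hr⟩ := (h.hasFrame.swap.map hD).exists_baseChange h'.hasFrame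
  exact TripleType.eq_flip_of_baseChange P hl hr

end MetricLieSuperalgebra

theorem theorem2 :
    -- Every superdouble of superdimension (4,2) lies in exactly one class; it decomposes into
    -- all supertriples listed there and their duals, and into no others; its commutants.
    (∀ (V : Type*) [AddCommGroup V] [Module ℝ V] (D : MetricLieSuperalgebra V),
      D.IsDrinfeldSuperdouble → D.HasSuperdim 4 2 →
        (∃! c : DoubleClass, D.BelongsTo c) ∧
        ∀ c : DoubleClass, D.BelongsTo c →
          (∀ t ∈ c.triples,
            (∃ S St : Submodule ℝ V, D.IsOfType t S St) ∧
            (∃ S St : Submodule ℝ V, D.IsDualOfType t S St)) ∧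
          (∀ S St : Submodule ℝ V, D.IsManinSupertriple S St →
            ∃ t ∈ c.triples, D.IsOfType t S St ∨ D.IsDualOfType t S St) ∧
          (Module.finrank ℝ (D.commutant 1), Module.finrank ℝ (D.commutant 2),
            Module.finrank ℝ (D.commutant 3)) = c.commutantDims ∧
          (Module.finrank ℝ (D.commutant 1 ⊓ D.part 0 : Submodule ℝ V),
            Module.finrank ℝ (D.commutant 1 ⊓ D.part 1 : Submodule ℝ V)) =
              c.commutantSuperdim) ∧
    -- Every class is inhabited.
    (∀ c : DoubleClass, ∃ D : MetricLieSuperalgebra (Fin 6 → ℝ),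
      D.IsDrinfeldSuperdouble ∧ D.HasSuperdim 4 2 ∧ D.BelongsTo c) ∧
    -- The classes are isomorphism classes of superdoubles.
    (∀ (V V' : Type*) [AddCommGroup V] [Module ℝ V] [AddCommGroup V'] [Module ℝ V']
      (D : MetricLieSuperalgebra V) (D' : MetricLieSuperalgebra V') (c c' : DoubleClass),
      D.BelongsTo c → D'.BelongsTo c' → (D.Isomorphic D' ↔ c = c')) ∧
    -- The listed supertriples are pairwise nonisomorphic, also up to T-duality.
    (∀ (V V' : Type*) [AddCommGroup V] [Module ℝ V] [AddCommGroup V'] [Module ℝ V']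
      (D : MetricLieSuperalgebra V) (D' : MetricLieSuperalgebra V') (t t' : TripleType)
      (S St : Submodule ℝ V) (S' St' : Submodule ℝ V'),
      D.IsOfType t S St → D'.IsOfType t' S' St' →
        (D.TripleIsomorphic S St D' S' St' ↔ t = t') ∧
        (D.TripleIsomorphic St S D' S' St' → t' = t.flip)) := by
  refine ⟨fun V _ _ D hD hdim => ⟨?_, fun c hc => ⟨fun t ht => ?_, fun S St h => ?_, ?_⟩⟩,
    fun c => ?_,
    fun V V' _ _ _ _ D D' c c' h h' => MetricLieSuperalgebra.isomorphic_iff h h',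
    fun V V' _ _ _ _ D D' t t' S St S' St' h h' =>
      ⟨MetricLieSuperalgebra.tripleIsomorphic_iff h h', fun hD => hD.eq_flip h h'⟩⟩
  · obtain ⟨S, St, h⟩ := hD
    obtain ⟨c, t, ht, H⟩ := h.exists_class hdim
    exact ⟨c, MetricLieSuperalgebra.belongsTo_of_isOfType_or ht H, fun c' hc' =>
      hc'.unique (MetricLieSuperalgebra.belongsTo_of_isOfType_or ht H)⟩
  · obtain ⟨e, he⟩ := hc.hasType ht
    exact ⟨⟨_, _, MetricLieSuperalgebra.isOfType_iff.2 ⟨e, he, rfl, rfl⟩⟩, _, _,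
      MetricLieSuperalgebra.isDualOfType_iff.2 ⟨e, he, rfl, rfl⟩⟩
  · obtain ⟨c', t, ht, H⟩ := h.exists_class hdim
    -- The class supplied by the classification of this decomposition is a class of `D`, hence equal
    -- to `c`.
    obtain rfl := hc.unique (MetricLieSuperalgebra.belongsTo_of_isOfType_or ht H)
    exact ⟨t, ht, H⟩
  · exact (MetricLieSuperalgebra.belongsTo_iff.1 hc).commutantDims
  · obtain ⟨D, e, he⟩ := MetricLieSuperalgebra.exists_hasType_rep c
    exact ⟨D, ⟨_, _, he.isManinSupertriple⟩, he.hasSuperdim,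
      MetricLieSuperalgebra.belongsTo_iff.2 ⟨e, he⟩⟩
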